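/- **Theorem 5.1** (\label{4.28}). Let $\rho>0$, $0<\tilde\alpha<1$, $\wp\ge 0$, $\zeta=\rho\pi^{-1}\sin(\tilde\alpha\pi)$, $\eta(\xi)=|\xi|^{(2\tilde\alpha-1)/2}$, and let $\tau\in C([0,1])\cap C^1((0,1])$ satisfy $\tau(0)=0$, $\tau>0$ on $(0,1]$, $m_\tau:=\sup_{0<x\le 1}x|\tau'(x)|/\tau(x)<2$ and $\tau\in C^{[m_\tau]}([0,1])$. Let $H^1_\tau(0,1)$ be the space of all $\psi\in L^2(0,1)$ that are locally absolutely continuous in $(0,1]$ with $\sqrt{\tau}\,\psi_x\in L^2(0,1)$, let $H^2_\tau(0,1)=\{\psi\in H^1_\tau(0,1):\ \tau\psi_x\in H^1(0,1)\}$, and let $W^1_\tau(0,1)=\{\psi\in H^1_\tau(0,1):\psi(0)=0\}$ if $m_\tau<1$ and $W^1_\tau(0,1)=H^1_\tau(0,1)$ if $1\le m_\tau<2$. On the complex Hilbert space $\mathcal H=L^2(0,1)\times L^2(\mathbb R)$ with inner product $\int_0^1\psi\overline{\widetilde\psi}\,dx+\zeta\int_{\mathbb R}\vartheta\overline{\widetilde\vartheta}\,d\xi$,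 let $$\mathcal A(\psi,\vartheta)=\bigl(i(\tau\psi_x)_x,\ -(\xi^2+\wp)\vartheta+\eta(\xi)\psi(1)\bigr),$$ where $D(\mathcal A)$ consists of all $(\psi,\vartheta)\in\mathcal H$ with $\psi\in H^2_\tau(0,1)\cap W^1_\tau(0,1)$, $-(\xi^2+\wp)\vartheta+\eta(\xi)\psi(1)\in L^2(\mathbb R)$, $|\xi|\vartheta\in L^2(\mathbb R)$ and $(\tau\psi_x)(1)=i\zeta\int_{\mathbb R}\eta(\xi)\vartheta(\xi)\,d\xi$. (a) $\mathcal A$ generates a $C_0$-semigroup $(e^{t\mathcal A})_{t\ge0}$ on $\mathcal H$, and this semigroup is not exponentially stable: there are no $M,\omega>0$ with $\|e^{t\mathcal A}\|\le Me^{-\omega t}$ for all $t\ge 0$. (b) If $\tau(x)=x^\alpha$ with $0<\alpha<1$, then $\mathcal A$ has an infinite sequence of pairwise distinct eigenvalues $\lambda_k$ with $\operatorname{Im}\lambda_k\to-\infty$ and $\operatorname{Re}\lambda_k\to0$, and there is a constant $c>0$ such that, for every $k$, the number $i\operatorname{Im}\lambda_k$ lies in the resolvent set of $\mathcal A$ and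 $$\bigl\|(i\operatorname{Im}\lambda_k\,I-\mathcal A)^{-1}\bigr\|_{\mathcal L(\mathcal H)}\ \ge\ c\,|\lambda_k|^{1-\tilde\alpha}.$$ -/

import Mathlib

open MeasureTheory Set Filter Topology

noncomputable section

namespace DegenerateSchrodinger

/-! ### The degenerate coefficient -/

/-- The degeneracy index `m_τ = sup_{0 < x ≤ 1} x |τ'(x)| / τ(x)` (the derivative is one-sided at the
end point `x = 1`). -/
def degeneracyIndex (τ : ℝ → ℝ) : ℝ :=
  sSup ((fun x => x * |derivWithin τ (Icc 0 1) x| / τ x) '' Ioc 0 1)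

/-- The standing assumptions on the coefficient `τ`: it is continuous on `[0,1]`, of class `C¹` on
`(0,1]`, positive on `(0,1]`, zero at `0`, its degeneracy index is (finite and) less than `2`, and it
is of class `C^{[m_τ]}` on `[0,1]`. -/
structure IsDegenerateCoeff (τ : ℝ → ℝ) : Prop where
  continuousOn : ContinuousOn τ (Icc 0 1)
  contDiffOn : ContDiffOn ℝ 1 τ (Ioc 0 1)
  pos : ∀ x ∈ Ioc (0 : ℝ) 1, 0 < τ x
  zero : τ 0 = 0
  bddAbove : BddAbove ((fun x => x * |derivWithin τ (Icc 0 1) x| / τ x) '' Ioc 0 1)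
  index_lt_two : degeneracyIndex τ < 2
  contDiffOn_index : ContDiffOn ℝ (⌊degeneracyIndex τ⌋₊ : ℕ) τ (Icc 0 1)

lemma rpow_quotient {α : ℝ} (hα : 0 < α) {x : ℝ} (hx : x ∈ Ioc (0 : ℝ) 1) :
    x * |derivWithin (fun x : ℝ => x ^ α) (Icc 0 1) x| / x ^ α = α := by
  have h : derivWithin (fun x : ℝ => x ^ α) (Icc 0 1) x = α * x ^ (α - 1) :=
    (Real.hasDerivAt_rpow_const (Or.inl hx.1.ne')).hasDerivWithinAt.derivWithin
      (uniqueDiffOn_Icc zero_lt_one x (Ioc_subset_Icc_self hx))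
  have hp : 0 < x ^ α := Real.rpow_pos_of_pos hx.1 α
  rw [h, abs_of_nonneg (mul_nonneg hα.le (Real.rpow_nonneg hx.1.le _)), Real.rpow_sub_one hx.1.ne']
  field_simp [hx.1.ne']

lemma image_rpow {α : ℝ} (hα : 0 < α) :
    (fun x => x * |derivWithin (fun x : ℝ => x ^ α) (Icc 0 1) x| / x ^ α) '' Ioc 0 1 = {α} := by
  ext y
  constructor
  · rintro ⟨x, hx, rfl⟩
    exact rpow_quotient hα hx
  · rintro rfl
    exact ⟨1, ⟨zero_lt_one, le_rfl⟩, rpow_quotient hα ⟨zero_lt_one, le_rfl⟩⟩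

/-- The degeneracy index of `x ↦ x ^ α` is `α`. -/
lemma degeneracyIndex_rpow {α : ℝ} (hα : 0 < α) : degeneracyIndex (fun x : ℝ => x ^ α) = α := by
  rw [degeneracyIndex, image_rpow hα, csSup_singleton]

/-- The powers `x ↦ x ^ α`, `0 < α < 1`, satisfy the standing assumptions. -/
lemma isDegenerateCoeff_rpow {α : ℝ} (hα : 0 < α) (hα1 : α < 1) :
    IsDegenerateCoeff (fun x : ℝ => x ^ α) where
  continuousOn := (Real.continuous_rpow_const hα.le).continuousOn
  contDiffOn := fun _ hx => (Real.contDiffAt_rpow_const_of_ne hx.1.ne').contDiffWithinAt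
  pos := fun _ hx => Real.rpow_pos_of_pos hx.1 α
  zero := Real.zero_rpow hα.ne'
  bddAbove := by rw [image_rpow hα]; exact bddAbove_singleton
  index_lt_two := by rw [degeneracyIndex_rpow hα]; linarith
  contDiffOn_index := by
    rw [degeneracyIndex_rpow hα, Nat.floor_eq_zero.2 hα1, Nat.cast_zero, contDiffOn_zero]
    exact (Real.continuous_rpow_const hα.le).continuousOn

/-! ### Parameters and weight of the fractional damping -/

/-- The parameters of the boundary damping: gain `ρ > 0`, order `0 < α̃ < 1` and exponential weight
`℘ ≥ 0`. -/
structure DampingParams where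
  /-- the gain `ρ` -/
  rho : ℝ
  /-- the order `α̃` -/
  order : ℝ
  /-- the exponential weight `℘` -/
  wp : ℝ
  rho_pos : 0 < rho
  order_pos : 0 < order
  order_lt_one : order < 1
  wp_nonneg : 0 ≤ wp

/-- `ζ = ρ π⁻¹ sin(α̃ π)`. -/
def DampingParams.zeta (p : DampingParams) : ℝ :=
  p.rho * Real.pi⁻¹ * Real.sin (p.order * Real.pi)

/-- `η(ξ) = |ξ|^{(2α̃ - 1)/2}`. -/
def DampingParams.eta (p : DampingParams) (ξ : ℝ) : ℝ :=
  |ξ| ^ ((2 * p.order - 1) / 2)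

lemma DampingParams.zeta_pos (p : DampingParams) : 0 < p.zeta := by
  have h : 0 < Real.sin (p.order * Real.pi) := by
    apply Real.sin_pos_of_pos_of_lt_pi (mul_pos p.order_pos Real.pi_pos)
    have := p.order_lt_one
    nlinarith [Real.pi_pos]
  have := p.rho_pos
  have := Real.pi_pos
  unfold DampingParams.zeta
  positivity

/-! ### The state space -/

/-- Lebesgue measure on `(0,1)`. -/
abbrev unitMeasure : Measure ℝ := volume.restrict (Ioo 0 1)

/-- The measure `ζ dξ` on `ℝ`. -/
abbrev DampingParams.weightMeasure (p : DampingParams) : Measure ℝ :=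
  ENNReal.ofReal p.zeta • volume

/-- The state space `𝓗 = L²(0,1) × L²(ℝ)` of complex valued functions, with the inner product
`∫₀¹ ψ ψ̃* dx + ζ ∫_ℝ ϑ ϑ̃* dξ`. -/
abbrev StateSpace (p : DampingParams) : Type :=
  WithLp 2 (Lp ℂ 2 unitMeasure × Lp ℂ 2 p.weightMeasure)

lemma DampingParams.ae_iff (p : DampingParams) {P : ℝ → Prop} :
    (∀ᵐ ξ ∂p.weightMeasure, P ξ) ↔ ∀ᵐ ξ, P ξ := by
  have h : ENNReal.ofReal p.zeta ≠ 0 := by simpa using p.zeta_pos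
  simp only [DampingParams.weightMeasure, MeasureTheory.ae_iff, Measure.smul_apply, smul_eq_mul, mul_eq_zero, h,
    false_or]

/-- The norm of the state space is the energy norm. -/
lemma norm_sq_eq (p : DampingParams) (U : StateSpace p) :
    ‖U‖ ^ 2 = (∫ x in Ioo (0 : ℝ) 1, ‖U.fst x‖ ^ 2) + p.zeta * ∫ ξ, ‖U.snd ξ‖ ^ 2 := by
  have key : ∀ (μ : Measure ℝ) (f : Lp ℂ 2 μ), ‖f‖ ^ 2 = ∫ x, ‖f x‖ ^ 2 ∂μ := by
    intro μ f
    rw [← @inner_self_eq_norm_sq ℂ, L2.inner_def]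
    have : ∀ x, inner ℂ (f x) (f x) = ((‖f x‖ ^ 2 : ℝ) : ℂ) := by
      intro x; rw [inner_self_eq_norm_sq_to_K]; push_cast; rfl
    simp_rw [this]
    rw [integral_complex_ofReal]
    simp
  rw [WithLp.prod_norm_sq_eq_of_L2, key, key, integral_smul_measure,
    ENNReal.toReal_ofReal p.zeta_pos.le, smul_eq_mul]

/-! ### Weighted Sobolev spaces -/

/-- `u` is locally absolutely continuous in `(0,1]`. -/
def LocAbsCont (u : ℝ → ℂ) : Prop :=
  ∀ ε ∈ Ioo (0 : ℝ) 1, AbsolutelyContinuousOnInterval u ε 1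

/-- `u ∈ H¹_τ(0,1)`. -/
structure MemH1Weighted (τ : ℝ → ℝ) (u : ℝ → ℂ) : Prop where
  memLp : MemLp u 2 unitMeasure
  locAbsCont : LocAbsCont u
  memLp_deriv : MemLp (fun x => (Real.sqrt (τ x) : ℂ) * deriv u x) 2 unitMeasure

/-- `u ∈ W¹_τ(0,1)`: the space `H¹_τ(0,1)`, with the Dirichlet condition `u(0) = 0` if `m_τ < 1`. -/
structure MemW (τ : ℝ → ℝ) (u : ℝ → ℂ) : Prop where
  memH1 : MemH1Weighted τ u
  dirichlet : degeneracyIndex τ < 1 → Tendsto u (𝓝[>] 0) (𝓝 0)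

/-- `w` is the continuous representative of an element of the Sobolev space `H¹(0,1)`. -/
structure MemH1 (w : ℝ → ℂ) : Prop where
  absCont : AbsolutelyContinuousOnInterval w 0 1
  memLp_deriv : MemLp (deriv w) 2 unitMeasure

/-- `u ∈ H²_τ(0,1)`, where `w` is the continuous representative of the flux `τ uₓ ∈ H¹(0,1)`. -/
structure MemH2Weighted (τ : ℝ → ℝ) (u w : ℝ → ℂ) : Prop where
  memH1 : MemH1Weighted τ u
  flux_eq : w =ᵐ[unitMeasure] fun x => (τ x : ℂ) * deriv u x
  flux_memH1 : MemH1 w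

/-! ### The system operator -/

/-- The second component `-(ξ² + ℘) ϑ(ξ) + η(ξ) b` of the operator; `b` is the trace `ψ(1)`. -/
def memoryField (p : DampingParams) (ϑ : ℝ → ℂ) (b : ℂ) (ξ : ℝ) : ℂ :=
  -((ξ : ℂ) ^ 2 + p.wp) * ϑ ξ + p.eta ξ * b

/-- `U = (ψ, ϑ)` lies in the domain of the operator `𝓐`, where `u` is the locally absolutely
continuous representative of `ψ` and `w` the continuous representative of the flux `τ ψₓ`.
(The integrability of `η ϑ`, recorded so that the boundary condition makes sense, follows from
`ϑ, |ξ| ϑ ∈ L²(ℝ)`.) -/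
structure InDomain (τ : ℝ → ℝ) (p : DampingParams) (U : StateSpace p) (u w : ℝ → ℂ) : Prop where
  repr : U.fst =ᵐ[unitMeasure] u
  memH2 : MemH2Weighted τ u w
  memW : MemW τ u
  integrable : Integrable (fun ξ => (p.eta ξ : ℂ) * U.snd ξ)
  boundary : w 1 = Complex.I * p.zeta * ∫ ξ, (p.eta ξ : ℂ) * U.snd ξ
  memLp_memory : MemLp (memoryField p U.snd (u 1)) 2 volume
  memLp_abs : MemLp (fun ξ : ℝ => ((|ξ| : ℝ) : ℂ) * U.snd ξ) 2 volume

/-- `U ∈ D(𝓐)` and `V = 𝓐 U`, i.e. `V = (i (τ ψₓ)ₓ, -(ξ² + ℘) ϑ + η ψ(1))`. -/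
structure IsImage (τ : ℝ → ℝ) (p : DampingParams) (U V : StateSpace p) (u w : ℝ → ℂ) : Prop where
  inDomain : InDomain τ p U u w
  fst_eq : V.fst =ᵐ[unitMeasure] fun x => Complex.I * deriv w x
  snd_eq : V.snd =ᵐ[p.weightMeasure] memoryField p U.snd (u 1)

/-! #### The operator is well defined and linear -/

lemma ae_differentiableAt_of_absCont {f : ℝ → ℂ} {a b : ℝ}
    (hf : AbsolutelyContinuousOnInterval f a b) (hab : a ≤ b) :
    ∀ᵐ x, x ∈ Ioo a b → DifferentiableAt ℝ f x := by
  have h := hf.boundedVariationOn.locallyBoundedVariationOn.ae_differentiableWithinAt_of_mem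
  filter_upwards [h] with x hx hxab
  rw [uIcc_of_le hab] at hx
  exact (hx (Ioo_subset_Icc_self hxab)).differentiableAt (Icc_mem_nhds hxab.1 hxab.2)

lemma LocAbsCont.ae_differentiableAt {u : ℝ → ℂ} (hu : LocAbsCont u) :
    ∀ᵐ x ∂unitMeasure, DifferentiableAt ℝ u x := by
  rw [ae_restrict_iff' measurableSet_Ioo]
  have h : ∀ n : ℕ, ∀ᵐ x, x ∈ Ioo (1 / ((n : ℝ) + 2)) 1 → DifferentiableAt ℝ u x := fun n =>
    ae_differentiableAt_of_absCont
      (hu _ ⟨by positivity, by rw [div_lt_one (by positivity)]; linarith [n.cast_nonneg (α := ℝ)]⟩)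
      (by rw [div_le_one (by positivity)]; linarith [n.cast_nonneg (α := ℝ)])
  filter_upwards [ae_all_iff.2 h] with x hx hx01
  obtain ⟨n, hn⟩ := exists_nat_one_div_lt hx01.1
  refine hx n ⟨lt_of_le_of_lt ?_ hn, hx01.2⟩
  apply one_div_le_one_div_of_le <;> [positivity; linarith]

lemma MemH1.ae_differentiableAt {w : ℝ → ℂ} (hw : MemH1 w) :
    ∀ᵐ x ∂unitMeasure, DifferentiableAt ℝ w x := by
  rw [ae_restrict_iff' measurableSet_Ioo]
  exact ae_differentiableAt_of_absCont hw.absCont zero_le_one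

lemma LocAbsCont.continuousOn {u : ℝ → ℂ} (hu : LocAbsCont u) : ContinuousOn u (Ioc 0 1) := by
  intro x hx
  have hε : x / 2 ∈ Ioo (0 : ℝ) 1 := ⟨by linarith [hx.1], by linarith [hx.1, hx.2]⟩
  have h := (hu _ hε).continuousOn
  rw [uIcc_of_le hε.2.le] at h
  refine (h x ⟨by linarith [hx.1], hx.2⟩).mono_of_mem_nhdsWithin ?_
  have : Ioi (x / 2) ∈ 𝓝 x := Ioi_mem_nhds (by linarith [hx.1])
  filter_upwards [mem_nhdsWithin_of_mem_nhds this, self_mem_nhdsWithin] with y hy hy'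
  exact ⟨le_of_lt hy, hy'.2⟩

/-- A function that vanishes almost everywhere on `(0,1)` and is continuous on `(0,1]` vanishes on
`(0,1]`. -/
lemma eq_zero_of_ae {u : ℝ → ℂ} (hc : ContinuousOn u (Ioc 0 1)) (h : u =ᵐ[unitMeasure] 0) :
    ∀ x ∈ Ioc (0 : ℝ) 1, u x = 0 := by
  have h1 : EqOn u 0 (Ioo 0 1) :=
    Measure.eqOn_open_of_ae_eq h isOpen_Ioo (hc.mono Ioo_subset_Ioc_self) continuousOn_const
  intro x hx
  have h2 : x ∈ closure (Ioo (0 : ℝ) 1) := by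
    rw [closure_Ioo zero_ne_one]; exact Ioc_subset_Icc_self hx
  exact h1.of_subset_closure hc continuousOn_const Ioo_subset_Ioc_self
    (fun y hy => by rw [closure_Ioo zero_ne_one]; exact Ioc_subset_Icc_self hy) hx

lemma MemH1Weighted.add {τ : ℝ → ℝ} {u v : ℝ → ℂ} (hu : MemH1Weighted τ u)
    (hv : MemH1Weighted τ v) : MemH1Weighted τ (u + v) where
  memLp := hu.memLp.add hv.memLp
  locAbsCont := fun ε hε => (hu.locAbsCont ε hε).add (hv.locAbsCont ε hε)
  memLp_deriv := by
    refine (hu.memLp_deriv.add hv.memLp_deriv).ae_eq ?_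
    filter_upwards [hu.locAbsCont.ae_differentiableAt, hv.locAbsCont.ae_differentiableAt]
      with x h1 h2
    simp only [Pi.add_apply, deriv_add h1 h2]
    ring

lemma MemH1Weighted.smul {τ : ℝ → ℝ} {u : ℝ → ℂ} (c : ℂ) (hu : MemH1Weighted τ u) :
    MemH1Weighted τ (c • u) where
  memLp := hu.memLp.const_smul c
  locAbsCont := fun ε hε => (hu.locAbsCont ε hε).const_smul c
  memLp_deriv := by
    refine (hu.memLp_deriv.const_smul c).ae_eq ?_
    filter_upwards [hu.locAbsCont.ae_differentiableAt] with x h1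
    simp only [Pi.smul_apply, deriv_const_smul c h1, smul_eq_mul]
    ring

lemma MemH2Weighted.add {τ : ℝ → ℝ} {u v w z : ℝ → ℂ} (hu : MemH2Weighted τ u w)
    (hv : MemH2Weighted τ v z) : MemH2Weighted τ (u + v) (w + z) where
  memH1 := hu.memH1.add hv.memH1
  flux_eq := by
    filter_upwards [hu.memH1.locAbsCont.ae_differentiableAt,
      hv.memH1.locAbsCont.ae_differentiableAt, hu.flux_eq, hv.flux_eq] with x h1 h2 h3 h4
    simp only [Pi.add_apply, deriv_add h1 h2, h3, h4]
    ring
  flux_memH1 :=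
    { absCont := hu.flux_memH1.absCont.add hv.flux_memH1.absCont
      memLp_deriv := by
        refine (hu.flux_memH1.memLp_deriv.add hv.flux_memH1.memLp_deriv).ae_eq ?_
        filter_upwards [hu.flux_memH1.ae_differentiableAt, hv.flux_memH1.ae_differentiableAt]
          with x h1 h2
        simp only [Pi.add_apply, deriv_add h1 h2] }

lemma MemH2Weighted.smul {τ : ℝ → ℝ} {u w : ℝ → ℂ} (c : ℂ) (hu : MemH2Weighted τ u w) :
    MemH2Weighted τ (c • u) (c • w) where
  memH1 := hu.memH1.smul c
  flux_eq := by
    filter_upwards [hu.memH1.locAbsCont.ae_differentiableAt, hu.flux_eq] with x h1 h3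
    simp only [Pi.smul_apply, deriv_const_smul c h1, h3, smul_eq_mul]
    ring
  flux_memH1 :=
    { absCont := hu.flux_memH1.absCont.const_smul c
      memLp_deriv := by
        refine (hu.flux_memH1.memLp_deriv.const_smul c).ae_eq ?_
        filter_upwards [hu.flux_memH1.ae_differentiableAt] with x h1
        simp only [Pi.smul_apply, deriv_const_smul c h1] }

lemma MemW.add {τ : ℝ → ℝ} {u v : ℝ → ℂ} (hu : MemW τ u) (hv : MemW τ v) : MemW τ (u + v) where
  memH1 := hu.memH1.add hv.memH1
  dirichlet := fun h => by
    have := (hu.dirichlet h).add (hv.dirichlet h)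
    rwa [add_zero] at this

lemma MemW.smul {τ : ℝ → ℝ} {u : ℝ → ℂ} (c : ℂ) (hu : MemW τ u) : MemW τ (c • u) where
  memH1 := hu.memH1.smul c
  dirichlet := fun h => by
    have := (hu.dirichlet h).const_smul c
    rwa [smul_zero] at this

lemma snd_add_ae (p : DampingParams) (U V : StateSpace p) :
    ∀ᵐ ξ, (U + V).snd ξ = U.snd ξ + V.snd ξ :=
  p.ae_iff.1 (Lp.coeFn_add U.snd V.snd)

lemma snd_smul_ae (p : DampingParams) (c : ℂ) (U : StateSpace p) :
    ∀ᵐ ξ, (c • U).snd ξ = c * U.snd ξ :=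
  p.ae_iff.1 (Lp.coeFn_smul c U.snd)

lemma IsImage.add {τ : ℝ → ℝ} {p : DampingParams} {U V U' V' : StateSpace p} {u w u' w' : ℝ → ℂ}
    (h : IsImage τ p U V u w) (h' : IsImage τ p U' V' u' w') :
    IsImage τ p (U + U') (V + V') (u + u') (w + w') := by
  have hs := snd_add_ae p U U'
  have hm : ∀ᵐ ξ, memoryField p U.snd (u 1) ξ + memoryField p U'.snd (u' 1) ξ =
      memoryField p (U + U').snd ((u + u') 1) ξ := by
    filter_upwards [hs] with ξ h1
    simp only [memoryField, h1, Pi.add_apply]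
    ring
  have he : (fun ξ => (p.eta ξ : ℂ) * U.snd ξ + (p.eta ξ : ℂ) * U'.snd ξ) =ᵐ[volume]
      fun ξ => (p.eta ξ : ℂ) * (U + U').snd ξ := by
    filter_upwards [hs] with ξ h1
    rw [h1]; ring
  refine ⟨⟨?_, h.inDomain.memH2.add h'.inDomain.memH2, h.inDomain.memW.add h'.inDomain.memW,
    ?_, ?_, ?_, ?_⟩, ?_, ?_⟩
  · exact (Lp.coeFn_add U.fst U'.fst).trans (h.inDomain.repr.add h'.inDomain.repr)
  · exact (h.inDomain.integrable.add h'.inDomain.integrable).congr he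
  · rw [← integral_congr_ae he, integral_add h.inDomain.integrable h'.inDomain.integrable,
      Pi.add_apply, h.inDomain.boundary, h'.inDomain.boundary]
    ring
  · exact (h.inDomain.memLp_memory.add h'.inDomain.memLp_memory).ae_eq hm
  · refine (h.inDomain.memLp_abs.add h'.inDomain.memLp_abs).ae_eq ?_
    filter_upwards [hs] with ξ h1
    simp only [Pi.add_apply, h1]; ring
  · filter_upwards [Lp.coeFn_add V.fst V'.fst, h.fst_eq, h'.fst_eq,
      h.inDomain.memH2.flux_memH1.ae_differentiableAt,
      h'.inDomain.memH2.flux_memH1.ae_differentiableAt] with x h1 h2 h3 h4 h5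
    rw [deriv_add h4 h5, mul_add, ← h2, ← h3]
    exact h1
  · filter_upwards [Lp.coeFn_add V.snd V'.snd, h.snd_eq, h'.snd_eq, p.ae_iff.2 hm]
      with x h1 h2 h3 h4
    rw [← h4, ← h2, ← h3]
    exact h1

lemma IsImage.smul {τ : ℝ → ℝ} {p : DampingParams} {U V : StateSpace p} {u w : ℝ → ℂ} (c : ℂ)
    (h : IsImage τ p U V u w) : IsImage τ p (c • U) (c • V) (c • u) (c • w) := by
  have hs := snd_smul_ae p c U
  have hm : ∀ᵐ ξ, c * memoryField p U.snd (u 1) ξ =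
      memoryField p (c • U).snd ((c • u) 1) ξ := by
    filter_upwards [hs] with ξ h1
    simp only [memoryField, h1, Pi.smul_apply, smul_eq_mul]
    ring
  have he : (fun ξ => c * ((p.eta ξ : ℂ) * U.snd ξ)) =ᵐ[volume]
      fun ξ => (p.eta ξ : ℂ) * (c • U).snd ξ := by
    filter_upwards [hs] with ξ h1
    rw [h1]; ring
  refine ⟨⟨?_, h.inDomain.memH2.smul c, h.inDomain.memW.smul c, ?_, ?_, ?_, ?_⟩, ?_, ?_⟩
  · exact (Lp.coeFn_smul c U.fst).trans (h.inDomain.repr.const_smul c)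
  · exact (h.inDomain.integrable.const_mul c).congr he
  · rw [← integral_congr_ae he, integral_const_mul, Pi.smul_apply, h.inDomain.boundary,
      smul_eq_mul]
    ring
  · exact (h.inDomain.memLp_memory.const_smul c).ae_eq hm
  · refine (h.inDomain.memLp_abs.const_smul c).ae_eq ?_
    filter_upwards [hs] with ξ h1
    simp only [Pi.smul_apply, h1, smul_eq_mul]; ring
  · filter_upwards [Lp.coeFn_smul c V.fst, h.fst_eq,
      h.inDomain.memH2.flux_memH1.ae_differentiableAt] with x h1 h2 h4
    have h3 : (c • V).fst x = c * V.fst x := h1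
    rw [deriv_const_smul c h4, h3, h2, smul_eq_mul]
    ring
  · filter_upwards [Lp.coeFn_smul c V.snd, h.snd_eq, p.ae_iff.2 hm] with x h1 h2 h4
    rw [← h4, ← h2]
    exact h1

/-- The graph of `𝓐`. -/
def operatorGraph (τ : ℝ → ℝ) (p : DampingParams) :
    Submodule ℂ (StateSpace p × StateSpace p) where
  carrier := {x | ∃ u w, IsImage τ p x.1 x.2 u w}
  add_mem' := by
    rintro _ _ ⟨u, w, h⟩ ⟨u', w', h'⟩
    exact ⟨_, _, h.add h'⟩
  smul_mem' := by
    rintro c _ ⟨u, w, h⟩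
    exact ⟨_, _, h.smul c⟩
  zero_mem' := by
    have hz : ∀ᵐ ξ, (0 : StateSpace p).snd ξ = 0 := p.ae_iff.1 (Lp.coeFn_zero ℂ 2 _)
    have hd : deriv (0 : ℝ → ℂ) = 0 := by ext x; exact deriv_const x 0
    have hac : ∀ a b : ℝ, AbsolutelyContinuousOnInterval (0 : ℝ → ℂ) a b := fun a b =>
      (contDiff_const (c := (0 : ℂ))).contDiffOn.absolutelyContinuousOnInterval
    have hm : ∀ᵐ ξ, 0 = memoryField p (0 : StateSpace p).snd ((0 : ℝ → ℂ) 1) ξ := by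
      filter_upwards [hz] with ξ h1
      rw [memoryField, h1]; simp
    have he : (fun _ : ℝ => (0 : ℂ)) =ᵐ[volume]
        fun ξ => (p.eta ξ : ℂ) * (0 : StateSpace p).snd ξ := by
      filter_upwards [hz] with ξ h1
      rw [h1, mul_zero]
    have h1 : MemH1Weighted τ 0 :=
      ⟨MemLp.zero, fun ε _ => hac _ _, by simp [hd]⟩
    refine ⟨0, 0, ⟨Lp.coeFn_zero _ _ _, ⟨h1, ?_, hac _ _, ?_⟩, ⟨h1, fun _ => tendsto_const_nhds⟩,
      ?_, ?_, ?_, ?_⟩, ?_, ?_⟩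
    · simp only [hd, Pi.zero_apply, mul_zero]; rfl
    · rw [hd]; exact MemLp.zero
    · exact (integrable_zero _ _ _).congr he
    · rw [Prod.fst_zero, ← integral_congr_ae he]; simp
    · exact MemLp.zero.ae_eq hm
    · refine MemLp.zero.ae_eq (f := 0) ?_
      filter_upwards [hz] with ξ h1
      simp only [Prod.fst_zero, Pi.zero_apply, h1, mul_zero]
    · filter_upwards [Lp.coeFn_zero ℂ 2 unitMeasure] with x h1
      rw [hd]; simpa using h1
    · filter_upwards [Lp.coeFn_zero ℂ 2 p.weightMeasure, p.ae_iff.2 hm] with x h1 h2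
      exact h1.trans h2

/-- The system operator `𝓐`, an unbounded linear operator on `𝓗`:
`𝓐 (ψ, ϑ) = (i (τ ψₓ)ₓ, -(ξ² + ℘) ϑ + η ψ(1))` on the domain described by `InDomain`. -/
def systemOperator (τ : ℝ → ℝ) (p : DampingParams) : StateSpace p →ₗ.[ℂ] StateSpace p :=
  (operatorGraph τ p).toLinearPMap

/-- `𝓐` is well defined: the value is determined by the state. -/
lemma mem_graph_systemOperator {τ : ℝ → ℝ} {p : DampingParams} {U V : StateSpace p} :
    (U, V) ∈ (systemOperator τ p).graph ↔ ∃ u w, IsImage τ p U V u w := by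
  rw [systemOperator, Submodule.toLinearPMap_graph_eq]
  · rfl
  rintro ⟨U, V⟩ ⟨u, w, h⟩ hU
  simp only at hU h ⊢
  subst hU
  have hz : ∀ᵐ ξ, (0 : StateSpace p).snd ξ = 0 := p.ae_iff.1 (Lp.coeFn_zero ℂ 2 _)
  have hu : ∀ x ∈ Ioc (0 : ℝ) 1, u x = 0 :=
    eq_zero_of_ae h.inDomain.memW.memH1.locAbsCont.continuousOn
      (h.inDomain.repr.symm.trans (Lp.coeFn_zero _ _ _))
  have hdu : ∀ᵐ x ∂unitMeasure, deriv u x = 0 := by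
    filter_upwards [ae_restrict_mem measurableSet_Ioo] with x hx
    have : u =ᶠ[𝓝 x] fun _ => 0 := by
      filter_upwards [Ioo_mem_nhds hx.1 hx.2] with y hy using hu y (Ioo_subset_Ioc_self hy)
    rw [this.deriv_eq, deriv_const]
  have hwc : ContinuousOn w (Ioc 0 1) := by
    have := h.inDomain.memH2.flux_memH1.absCont.continuousOn
    rw [uIcc_of_le zero_le_one] at this
    exact this.mono Ioc_subset_Icc_self
  have hw : ∀ x ∈ Ioc (0 : ℝ) 1, w x = 0 := by
    refine eq_zero_of_ae hwc ?_
    filter_upwards [h.inDomain.memH2.flux_eq, hdu] with x h1 h2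
    rw [h1, h2, mul_zero]; rfl
  have h1 : V.fst = 0 := by
    refine Lp.ext ?_
    filter_upwards [h.fst_eq, Lp.coeFn_zero ℂ 2 unitMeasure, ae_restrict_mem measurableSet_Ioo]
      with x h1 h2 hx
    have : w =ᶠ[𝓝 x] fun _ => 0 := by
      filter_upwards [Ioo_mem_nhds hx.1 hx.2] with y hy using hw y (Ioo_subset_Ioc_self hy)
    rw [h1, h2, this.deriv_eq, deriv_const, mul_zero]; rfl
  have h2 : V.snd = 0 := by
    refine Lp.ext ?_
    filter_upwards [h.snd_eq, Lp.coeFn_zero ℂ 2 p.weightMeasure, p.ae_iff.2 hz] with x h1 h2 h3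
    rw [h1, h2]
    rw [memoryField, h3, hu 1 ⟨zero_lt_one, le_rfl⟩]; simp
  exact WithLp.ofLp_injective 2 (Prod.ext h1 h2)

/-! ### Semigroups, exponential stability, eigenvalues and resolvent -/

section Semigroup

variable {X : Type*} [NormedAddCommGroup X] [NormedSpace ℂ X]

/-- `S` is a `C₀`-semigroup of bounded linear operators on `X`. -/
structure IsC0Semigroup (S : NNReal → X →L[ℂ] X) : Prop where
  map_zero : S 0 = ContinuousLinearMap.id ℂ X
  map_add : ∀ s t, S (s + t) = (S s).comp (S t)
  continuous : ∀ x, Continuous fun t => S t x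

/-- The `C₀`-semigroup `S` is generated by the operator `A`: one has `x ∈ D(A)` and `A x = y` exactly
when `(S(t) x - x) / t → y` as `t → 0⁺`. -/
structure IsGeneratedBy (S : NNReal → X →L[ℂ] X) (A : X →ₗ.[ℂ] X) : Prop where
  isC0Semigroup : IsC0Semigroup S
  mem_graph_iff : ∀ x y, (x, y) ∈ A.graph ↔
    Tendsto (fun t : ℝ => ((t⁻¹ : ℝ) : ℂ) • (S t.toNNReal x - x)) (𝓝[>] 0) (𝓝 y)

/-- Exponential stability: `‖S(t)‖ ≤ M e^{-ω t}` for some `M, ω > 0` and all `t ≥ 0`. -/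
def ExponentiallyStable (S : NNReal → X →L[ℂ] X) : Prop :=
  ∃ M > 0, ∃ ω > 0, ∀ t : NNReal, ‖S t‖ ≤ M * Real.exp (-ω * t)

/-- `z` is an eigenvalue of the unbounded operator `A`. -/
def IsEigenvalue (A : X →ₗ.[ℂ] X) (z : ℂ) : Prop :=
  ∃ u : A.domain, (u : X) ≠ 0 ∧ A u = z • (u : X)

/-- `z` lies in the resolvent set of `A`, and `R = (z - A)⁻¹` is the (bounded) resolvent operator. -/
structure IsResolvent (A : X →ₗ.[ℂ] X) (z : ℂ) (R : X →L[ℂ] X) : Prop where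
  left_inv : ∀ u : A.domain, R (z • (u : X) - A u) = u
  right_inv : ∀ f : X, ∃ u : A.domain, (u : X) = R f ∧ z • (u : X) - A u = f

end Semigroup

end DegenerateSchrodinger

end

/-! Everything rests on eliminating the memory variable. If (λ - 𝓐)(ψ, ϑ) = (f₁, f₂), then ϑ = (f₂ +
η ψ(1)) / (λ + ξ² + ℘), and what remains is a Sturm–Liouville problem on (0,1) with the boundary
condition (τψₓ)(1) = i (input from f₂ + G(λ) ψ(1)), where G(λ) = ζ ∫ η² / (λ + ξ² + ℘) dξ is
`transferFun`.

Generation. Green's formula gives Re ⟨𝓐U, U⟩ = -ζ ∫ (ξ² + ℘)|ϑ|², so 𝓐 is dissipative. For λ = r > 0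
one has G(r) ≥ 0, the reduced problem is coercive, and r - 𝓐 is onto. The Hille–Yosida construction
then gives a contraction semigroup. The degenerate end point enters only through Green's formula:
the boundary term at 0 vanishes by the Dirichlet condition if m_τ < 1, and because the flux vanishes
at 0 if m_τ ≥ 1.

No exponential stability. Exponential stability would bound (iμ - 𝓐)⁻¹ uniformly in μ
(`ExponentiallyStable.exists_boundedBelow`). At λ = -iκ, however, G = O(κ^(α̃-1)) tends to 0, so the
boundary condition approaches the Neumann condition. A Rellich multiplier bounds the traces at 1
uniformly in κ (`exists_sq_trace_le`), and testing the damped solution against an approximate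
Neumann solution shows that large κ are not in the Neumann spectrum (`norm_le_of_boundedBelow`).
Then the spectrum of the Neumann resolvent T has a gap above 0, and T, being injective, nonnegative
and self-adjoint, would be invertible. This is absurd, since its range consists of functions
continuous on (0,1]. No eigenvalue asymptotics are needed, so τ can be general.

Powers. For τ = x^α the solutions of (τuₓ)ₓ = -zu that vanish at 0 are x^(1-α) f(z x^(2-α)), with
flux g(z x^(2-α)), where f and g are entire functions of Bessel type (`IsBesselPair`). The function
g has arbitrarily large positive zeros Y, the Neumann eigenvalues, and a Rouché-type argument puts a
zero z = Y + t of g(z) - i G(-iz) f(z) within |t| ≤ C Y^(α̃-1). Then λ = -iz is an eigenvalue with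
|Re λ| ≤ C Y^(α̃-1). Its eigenvector forces ‖(i Im λ - 𝓐)⁻¹‖ ≥ 1/|Re λ|, and an a priori estimate
(`exists_boundedBelow_rpow`) puts i Im λ in the resolvent set. -/

noncomputable section

namespace DegenerateSchrodinger

/-! ### Resolvents of operators given by their graph -/

section Resolvent

variable {X : Type*} [NormedAddCommGroup X] [NormedSpace ℂ X]

/-- `z - A` is onto. -/
def ResolventSurj (A : X →ₗ.[ℂ] X) (z : ℂ) : Prop :=
  ∀ F, ∃ U V, (U, V) ∈ A.graph ∧ z • U - V = F

/-- `‖(z - A) U‖ ≥ c ‖U‖` on the domain of `A`. -/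
def BoundedBelow (A : X →ₗ.[ℂ] X) (z : ℂ) (c : ℝ) : Prop :=
  ∀ U V, (U, V) ∈ A.graph → c * ‖U‖ ≤ ‖z • U - V‖

lemma BoundedBelow.eq {A : X →ₗ.[ℂ] X} {z : ℂ} {c : ℝ} (hb : BoundedBelow A z c) (hc : 0 < c)
    {U V U' V' : X} (h : (U, V) ∈ A.graph) (h' : (U', V') ∈ A.graph)
    (e : z • U - V = z • U' - V') : U = U' := by
  have h1 : (U - U', V - V') ∈ A.graph := A.graph.sub_mem h h'
  have h2 := hb _ _ h1
  have h3 : z • (U - U') - (V - V') = 0 := by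
    rw [smul_sub, sub_sub_sub_comm, e, sub_self]
  rw [h3, norm_zero] at h2
  have h4 : ‖U - U'‖ ≤ 0 := by
    by_contra hh
    push Not at hh
    have := mul_pos hc hh
    linarith
  exact sub_eq_zero.1 (norm_le_zero_iff.1 h4)

/-- The lower bound makes preimages under z - A unique. Linearity of the inverse is read off from
that uniqueness, and its norm bound from the same inequality. -/
lemma exists_isResolvent {A : X →ₗ.[ℂ] X} {z : ℂ} {c : ℝ} (hc : 0 < c) (hb : BoundedBelow A z c)
    (hs : ResolventSurj A z) : ∃ R : X →L[ℂ] X, IsResolvent A z R ∧ ‖R‖ ≤ c⁻¹ := by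
  choose u v hg he using hs
  let L : X →ₗ[ℂ] X :=
    { toFun := u
      map_add' := fun f g => by
        refine hb.eq hc (hg _) (A.graph.add_mem (hg f) (hg g)) ?_
        rw [he, smul_add, add_sub_add_comm, he, he]
      map_smul' := fun a f => by
        refine hb.eq hc (hg _) (A.graph.smul_mem a (hg f)) ?_
        rw [he, RingHom.id_apply, smul_comm, ← smul_sub, he] }
  have hL : ∀ f, ‖L f‖ ≤ c⁻¹ * ‖f‖ := fun f => by
    have := hb _ _ (hg f)
    rw [he] at this
    rw [inv_mul_eq_div, le_div_iff₀ hc, mul_comm]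
    exact this
  refine ⟨L.mkContinuous c⁻¹ hL, ⟨fun x => ?_, fun f => ?_⟩,
    L.mkContinuous_norm_le (inv_nonneg.2 hc.le) hL⟩
  · exact hb.eq hc (hg _) (A.mem_graph x) (he _)
  · obtain ⟨y, hy, hy'⟩ := (A.mem_graph_iff).1 (hg f)
    refine ⟨y, hy, ?_⟩
    rw [hy, hy']
    exact he f

lemma IsResolvent.mem_graph {A : X →ₗ.[ℂ] X} {z : ℂ} {R : X →L[ℂ] X} (h : IsResolvent A z R)
    (f : X) : (R f, z • R f - f) ∈ A.graph := by
  obtain ⟨u, h1, h2⟩ := h.right_inv f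
  refine (A.mem_graph_iff).2 ⟨u, h1, ?_⟩
  simp only
  rw [← h1, eq_sub_iff_add_eq, ← eq_sub_iff_add_eq', h2]

lemma IsResolvent.apply_of_mem {A : X →ₗ.[ℂ] X} {z : ℂ} {R : X →L[ℂ] X} (h : IsResolvent A z R)
    {U V : X} (hU : (U, V) ∈ A.graph) : R (z • U - V) = U := by
  obtain ⟨u, h1, h2⟩ := (A.mem_graph_iff).1 hU
  simp only at h1 h2
  rw [← h1, ← h2]
  exact h.left_inv u

/-- The resolvent set is open. -/
lemma ResolventSurj.of_near [CompleteSpace X] {A : X →ₗ.[ℂ] X} {z z' : ℂ} {c : ℝ} (hc : 0 < c)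
    (hb : BoundedBelow A z c) (hs : ResolventSurj A z) (hz : ‖z' - z‖ < c) :
    ResolventSurj A z' := by
  obtain ⟨R, hR, hn⟩ := exists_isResolvent hc hb hs
  intro F
  -- On the domain z' - A = (1 - (z - z')R)(z - A), so it is enough to invert 1 - (z - z')R by a
  -- Neumann series and then apply R.
  have h1 : ‖(z - z') • R‖ < 1 := by
    rw [norm_smul, norm_sub_rev]
    calc ‖z' - z‖ * ‖R‖ ≤ ‖z' - z‖ * c⁻¹ := by gcongr
      _ < c * c⁻¹ := by gcongr
      _ = 1 := mul_inv_cancel₀ hc.ne'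
  obtain ⟨F', hF⟩ := (ContinuousLinearMap.isUnit_iff_bijective.1
    (isUnit_one_sub_of_norm_lt_one h1)).2 F
  refine ⟨_, _, hR.mem_graph F', ?_⟩
  rw [← hF]
  simp only [sub_apply, one_apply_eq_self,
    smul_apply, sub_smul]
  abel

end Resolvent

/-! ### Maximal dissipative operators on Hilbert spaces -/

section Dissipative

variable {X : Type*} [NormedAddCommGroup X] [InnerProductSpace ℂ X]

/-- `A` is dissipative and `r - A` is onto for `r > 0`. -/
structure IsMaximalDissipative (A : X →ₗ.[ℂ] X) : Prop where
  re_inner_nonpos : ∀ U V, (U, V) ∈ A.graph → (inner ℂ U V).re ≤ 0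
  surj : ∀ r : ℝ, 0 < r → ResolventSurj A r

variable {A : X →ₗ.[ℂ] X}

/-- Pairing with U, dissipativity leaves Re ⟨U, (z - A)U⟩ ≥ Re z ‖U‖², and Cauchy–Schwarz removes
one factor ‖U‖. The estimate has content only for Re z > 0. -/
lemma IsMaximalDissipative.boundedBelow (hA : IsMaximalDissipative A) (z : ℂ) :
    BoundedBelow A z z.re := by
  intro U V h
  have h1 := hA.re_inner_nonpos U V h
  have h2 : z.re * ‖U‖ ^ 2 ≤ (inner ℂ U (z • U - V)).re := by
    rw [inner_sub_right, inner_smul_right, Complex.sub_re, inner_self_eq_norm_sq_to_K]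
    have : (z * ((‖U‖ : ℂ)) ^ 2).re = z.re * ‖U‖ ^ 2 := by
      rw [← Complex.ofReal_pow, Complex.re_mul_ofReal]
    simp only [Complex.coe_algebraMap] at *
    rw [this]; linarith
  have h3 : (inner ℂ U (z • U - V)).re ≤ ‖U‖ * ‖z • U - V‖ :=
    (Complex.re_le_norm _).trans (norm_inner_le_norm _ _)
  rcases (norm_nonneg U).eq_or_lt with h0 | h0
  · rw [← h0, mul_zero]; exact norm_nonneg _
  · have : ‖U‖ * (z.re * ‖U‖) ≤ ‖U‖ * ‖z • U - V‖ := by nlinarith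
    exact le_of_mul_le_mul_left this h0

variable [CompleteSpace X]

lemma IsMaximalDissipative.surj_of_re_pos (hA : IsMaximalDissipative A) {z : ℂ} (hz : 0 < z.re) :
    ResolventSurj A z := by
  -- With r = |z|² / Re z one has |z - r|² = r² - |z|² < r², so z lies in the disc about r where the
  -- Neumann series converges.
  set r : ℝ := (z.re ^ 2 + z.im ^ 2) / z.re with hr
  have hr0 : 0 < r := by positivity
  refine ResolventSurj.of_near (z := (r : ℂ)) (c := r) hr0 ?_ (hA.surj r hr0) ?_
  · simpa using hA.boundedBelow (r : ℂ)
  · have h1 : ‖z - r‖ ^ 2 = (z.re - r) ^ 2 + z.im ^ 2 := by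
      rw [Complex.sq_norm, Complex.normSq_apply]; simp; ring
    have h2 : r * z.re = z.re ^ 2 + z.im ^ 2 := by rw [hr]; field_simp
    refine lt_of_pow_lt_pow_left₀ 2 hr0.le ?_
    rw [h1]
    nlinarith [sq_nonneg z.im, sq_pos_of_pos hz]

/-- On the imaginary axis an a priori estimate alone yields surjectivity: moving right by c/3 costs
c/3 of the bound, surjectivity is known there, and the disc of radius 2c/3 about the shifted point
still contains z. -/
lemma IsMaximalDissipative.surj_of_boundedBelow (hA : IsMaximalDissipative A) {z : ℂ} {c : ℝ}
    (hc : 0 < c) (hz : z.re = 0) (hb : BoundedBelow A z c) : ResolventSurj A z := by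
  have hb' : BoundedBelow A (z + (c / 3 : ℝ)) (c - c / 3) := by
    intro U V h
    have h1 := hb U V h
    have h2 : z • U - V = ((z + (c / 3 : ℝ)) • U - V) - ((c / 3 : ℝ) : ℂ) • U := by
      rw [add_smul]; abel
    have h3 := norm_sub_le ((z + (c / 3 : ℝ)) • U - V) (((c / 3 : ℝ) : ℂ) • U)
    rw [← h2, norm_smul, Complex.norm_real, Real.norm_of_nonneg (by positivity)] at h3
    linarith
  refine ResolventSurj.of_near (by linarith) hb' (hA.surj_of_re_pos ?_) ?_
  · simp [hz]; positivity
  · rw [norm_sub_rev, add_sub_cancel_left, Complex.norm_real, Real.norm_of_nonneg (by positivity)]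
    linarith

/-- If x is orthogonal to the domain, write x = U - AU. Then 0 = ⟨U, x⟩ gives ‖U‖² = Re ⟨U, AU⟩ ≤ 0,
so U = 0 and x = 0. -/
lemma IsMaximalDissipative.dense (hA : IsMaximalDissipative A) : Dense (A.domain : Set X) := by
  rw [Submodule.dense_iff_topologicalClosure_eq_top, Submodule.topologicalClosure_eq_top_iff,
    Submodule.eq_bot_iff]
  intro x hx
  obtain ⟨U, V, h, e⟩ := hA.surj 1 one_pos x
  have h1 : inner ℂ U x = 0 := hx U (A.mem_domain_of_mem_graph h)
  have h2 := hA.re_inner_nonpos U V h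
  rw [← e, inner_sub_right, inner_smul_right, inner_self_eq_norm_sq_to_K] at h1
  have h3 := congrArg Complex.re h1
  simp only [Complex.sub_re, Complex.coe_algebraMap, Complex.ofReal_one, one_mul,
    Complex.zero_re, ← Complex.ofReal_pow, Complex.ofReal_re] at h3
  have h4 : U = 0 := by
    have : ‖U‖ ^ 2 ≤ 0 := by linarith
    exact norm_eq_zero.1 (pow_eq_zero_iff two_ne_zero |>.1 (le_antisymm this (sq_nonneg _)))
  have h5 : V = 0 := by
    subst h4
    exact A.graph_fst_eq_zero_snd h rfl
  rw [← e, h4, h5]; simp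

end Dissipative

/-! ### Generation of contraction semigroups -/

section Generation

variable {X : Type*} [NormedAddCommGroup X] [NormedSpace ℂ X]

/-- The exponential `exp (t B)` of a bounded operator. -/
def expOp (B : X →L[ℂ] X) (t : ℝ) : X →L[ℂ] X := NormedSpace.exp (t • B)

lemma expOp_zero (B : X →L[ℂ] X) : expOp B 0 = 1 := by simp [expOp]

lemma expOp_commute {B C : X →L[ℂ] X} (h : Commute B C) (t : ℝ) : Commute (expOp B t) C := by
  let : NormedAlgebra ℚ (X →L[ℂ] X) := NormedAlgebra.restrictScalars ℚ ℂ _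
  exact (h.smul_left t).exp_left

/-- Resolvent identity R' - R = (z - z') R R', used in both orders. For z = z' it says R = R'. -/
lemma IsResolvent.commute {A : X →ₗ.[ℂ] X} {z z' : ℂ} {R R' : X →L[ℂ] X}
    (h : IsResolvent A z R) (h' : IsResolvent A z' R') : Commute R R' := by
  have key : ∀ {z z' : ℂ} {R R' : X →L[ℂ] X}, IsResolvent A z R → IsResolvent A z' R' → ∀ f,
      R' f - R f = (z - z') • R (R' f) := by
    intro z z' R R' h h' f
    have h1 := h.apply_of_mem (h'.mem_graph f)
    rw [map_sub, map_sub, map_smul, map_smul] at h1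
    nth_rewrite 1 [← h1]
    rw [sub_smul]; abel
  refine ContinuousLinearMap.ext fun f => ?_
  have h1 := key h h' f
  have h2 := key h' h f
  rcases eq_or_ne z z' with e | e
  · have : R = R' := by
      ext f
      have := key h h' f
      rw [e, sub_self, zero_smul, sub_eq_zero] at this
      exact this.symm
    rw [this]
  · have h3 : (z - z') • (R (R' f) - R' (R f)) = 0 := by
      rw [smul_sub, ← h1, ← neg_sub z' z, neg_smul, ← h2]; abel
    have h4 := (smul_eq_zero.1 h3).resolve_left (sub_ne_zero.2 e)
    exact sub_eq_zero.1 h4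

variable [CompleteSpace X]

lemma expOp_add (B : X →L[ℂ] X) (s t : ℝ) : expOp B (s + t) = expOp B s * expOp B t := by
  have hc : Commute (s • B) (t • B) := ((Commute.refl B).smul_left s).smul_right t
  let : NormedAlgebra ℚ (X →L[ℂ] X) := NormedAlgebra.restrictScalars ℚ ℂ _
  rw [expOp, add_smul]
  exact NormedSpace.exp_add_of_commute hc

lemma hasDerivAt_expOp (B : X →L[ℂ] X) (t : ℝ) (x : X) :
    HasDerivAt (fun t => expOp B t x) (expOp B t (B x)) t := by
  have h := hasDerivAt_exp_smul_const (𝕂 := ℝ) B t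
  exact ((ContinuousLinearMap.apply ℂ X x).restrictScalars ℝ).hasFDerivAt.comp_hasDerivAt t h

/-- The Yosida approximation `r² R - r` built from `R = (r - A)⁻¹`. -/
def yosida (R : X →L[ℂ] X) (r : ℝ) : X →L[ℂ] X := (r ^ 2) • R - r • (1 : X →L[ℂ] X)

/-- `exp (t (r² R - r))` is a contraction if `‖R‖ ≤ 1 / r`. -/
lemma norm_expOp_yosida_le {R : X →L[ℂ] X} {r : ℝ} (hr : 0 < r) (hR : ‖R‖ ≤ r⁻¹) {t : ℝ}
    (ht : 0 ≤ t) (x : X) : ‖expOp (yosida R r) t x‖ ≤ ‖x‖ := by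
  set B := yosida R r with hB
  have hcomm : Commute B R := by
    rw [hB, yosida]
    exact ((Commute.refl R).smul_left _).sub_left ((Commute.one_left R).smul_left _)
  -- The rescaled orbit y = e^{rs} e^{sB} x solves y' = r²R y, and ‖r²R‖ ≤ r, so Grönwall gives
  -- ‖y(t)‖ ≤ e^{rt}‖x‖. The factor e^{rt} then cancels.
  have hd : ∀ s, HasDerivAt (fun s => Real.exp (r * s) • expOp B s x)
      ((r ^ 2) • R (Real.exp (r * s) • expOp B s x)) s := by
    intro s
    have h1 : HasDerivAt (fun s => Real.exp (r * s)) (Real.exp (r * s) * (r * 1)) s :=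
      ((hasDerivAt_id s).const_mul r).exp
    refine (h1.smul (hasDerivAt_expOp B s x)).congr_deriv ?_
    have h2 : expOp B s (R x) = R (expOp B s x) :=
      congrArg (fun T : X →L[ℂ] X => T x) (expOp_commute hcomm s).eq
    have h3 : B x = (r ^ 2) • R x - r • x := by simp [hB, yosida]
    have h4 : R (Real.exp (r * s) • expOp B s x) = Real.exp (r * s) • R (expOp B s x) :=
      (R.restrictScalars ℝ).map_smul _ _
    have h5 : expOp B s ((r ^ 2) • R x - r • x) = (r ^ 2) • expOp B s (R x) - r • expOp B s x := by
      rw [map_sub]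
      congr 1 <;> exact ((expOp B s).restrictScalars ℝ).map_smul _ _
    rw [h3, h5, h2, h4, smul_sub, smul_smul, smul_smul, smul_smul]
    module
  have h := norm_le_gronwallBound_of_norm_deriv_right_le (δ := ‖x‖) (K := r) (ε := 0)
    (a := 0) (b := t) (fun s _ => (hd s).continuousAt.continuousWithinAt)
    (fun s _ => (hd s).hasDerivWithinAt) (by simp [expOp_zero]) ?_ t ⟨ht, le_rfl⟩
  · rw [gronwallBound_ε0, sub_zero, norm_smul, Real.norm_of_nonneg (Real.exp_pos _).le,
      mul_comm] at h
    exact le_of_mul_le_mul_right h (Real.exp_pos _)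
  · intro s _
    rw [add_zero, norm_smul, Real.norm_of_nonneg (by positivity)]
    have := R.le_of_opNorm_le hR (Real.exp (r * s) • expOp B s x)
    calc r ^ 2 * ‖R (Real.exp (r * s) • expOp B s x)‖
        ≤ r ^ 2 * (r⁻¹ * ‖Real.exp (r * s) • expOp B s x‖) := by gcongr
      _ = _ := by field_simp

/-- Comparison of two commuting contraction semigroups. -/
lemma norm_expOp_sub_le {B C : X →L[ℂ] X} (hBC : Commute B C)
    (hB : ∀ t x, 0 ≤ t → ‖expOp B t x‖ ≤ ‖x‖) (hC : ∀ t x, 0 ≤ t → ‖expOp C t x‖ ≤ ‖x‖)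
    {t : ℝ} (ht : 0 ≤ t) (x : X) : ‖expOp B t x - expOp C t x‖ ≤ ‖B x - C x‖ * t := by
  -- The path s ↦ e^{sB} e^{(t-s)C} x interpolates between the two orbits. By commutation its
  -- velocity is the image of (B - C)x under two contractions.
  have hd : ∀ s, HasDerivAt (fun s => (expOp B s * expOp C (t - s)) x)
      (expOp B s (expOp C (t - s) (B x - C x))) s := by
    intro s
    have h1 := hasDerivAt_exp_smul_const (𝕂 := ℝ) B s
    have h2 := (hasDerivAt_exp_smul_const (𝕂 := ℝ) C (t - s)).scomp s
      ((hasDerivAt_id s).const_sub t)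
    have h4 := ((ContinuousLinearMap.apply ℂ X x).restrictScalars ℝ).hasFDerivAt.comp_hasDerivAt s
      (h1.mul h2)
    refine (h4.congr_deriv ?_)
    have hc : B (expOp C (t - s) x) = expOp C (t - s) (B x) :=
      congrArg (fun T : X →L[ℂ] X => T x) (expOp_commute hBC.symm (t - s)).eq.symm
    have e1 : NormedSpace.exp (s • B) = expOp B s := rfl
    have e2 : NormedSpace.exp ((t - s) • C) = expOp C (t - s) := rfl
    simp only [Function.comp_apply, e1, e2]
    simp [hc, ← sub_eq_add_neg]
  have h := norm_image_sub_le_of_norm_deriv_le_segment' (a := 0) (b := t) (C := ‖B x - C x‖)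
    (fun s _ => (hd s).hasDerivWithinAt)
    (fun s hs => (hB s _ hs.1).trans (hC _ _ (by linarith [hs.2]))) t ⟨ht, le_rfl⟩
  simpa [expOp_zero] using h

/-- Hille–Yosida theorem for contraction semigroups. -/
theorem exists_isGeneratedBy {A : X →ₗ.[ℂ] X} (hd : Dense (A.domain : Set X))
    (hb : ∀ r : ℝ, 0 < r → BoundedBelow A r r) (hs : ∀ r : ℝ, 0 < r → ResolventSurj A r) :
    ∃ S : NNReal → X →L[ℂ] X, IsGeneratedBy S A := by
  have hr : ∀ n : ℕ, (0 : ℝ) < n + 1 := fun n => by positivity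
  choose R hR hRn using fun n : ℕ => exists_isResolvent (hr n) (hb _ (hr n)) (hs _ (hr n))
  set Y : ℕ → X →L[ℂ] X := fun n => yosida (R n) (n + 1) with hY
  have hE : ∀ n t x, 0 ≤ t → ‖expOp (Y n) t x‖ ≤ ‖x‖ := fun n t x ht =>
    norm_expOp_yosida_le (hr n) (hRn n) ht x
  have hYc : ∀ n k, Commute (Y n) (Y k) := fun n k => by
    have h := (hR n).commute (hR k)
    simp only [hY, yosida]
    exact (((h.smul_left _).smul_right _).sub_right
      ((Commute.one_right _).smul_right _)).sub_left
        ((Commute.one_left _).smul_left _)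
  have approx : ∀ (x : X), ∀ ε > 0, ∃ U V, (U, V) ∈ A.graph ∧ ‖x - U‖ < ε := by
    intro x ε hε
    obtain ⟨U, hU, hxU⟩ := Metric.dense_iff.1 hd x ε hε
    refine ⟨U, A ⟨U, hxU⟩, A.mem_graph ⟨U, hxU⟩, ?_⟩
    rw [← dist_eq_norm, dist_comm]; exact hU
  -- strong convergence of `r R`
  have hrR : ∀ x, Tendsto (fun n : ℕ => ((n : ℝ) + 1) • R n x) atTop (𝓝 x) := by
    have hle : ∀ (n : ℕ) x, ‖((n : ℝ) + 1) • R n x‖ ≤ ‖x‖ := fun n x => by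
      rw [norm_smul, Real.norm_of_nonneg (hr n).le]
      have := (R n).le_of_opNorm_le (hRn n) x
      calc ((n : ℝ) + 1) * ‖R n x‖ ≤ (n + 1) * (((n : ℝ) + 1)⁻¹ * ‖x‖) := by
            gcongr
        _ = ‖x‖ := by field_simp
    intro x
    rw [Metric.tendsto_atTop]
    intro ε hε
    obtain ⟨U, V, hUV, hx⟩ := approx x (ε / 3) (by positivity)
    obtain ⟨N, hN⟩ := exists_nat_gt (‖V‖ / (ε / 3))
    refine ⟨N, fun n hn => ?_⟩
    -- On the domain rRU - U = RV has size at most ‖V‖/r. Density and the uniform bound ‖rR‖ ≤ 1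
    -- give the convergence everywhere.
    have h1 : ((n : ℝ) + 1) • R n U - U = R n V := by
      have := (hR n).apply_of_mem hUV
      rw [map_sub, map_smul] at this
      nth_rewrite 2 [← this]
      push_cast
      rw [← Complex.coe_smul]
      push_cast
      abel
    have h2 : ‖R n V‖ ≤ ε / 3 := by
      refine ((R n).le_of_opNorm_le (hRn n) V).trans ?_
      rw [inv_mul_le_iff₀ (hr n)]
      rw [div_lt_iff₀ (by positivity)] at hN
      have : (N : ℝ) ≤ n := by exact_mod_cast hn
      nlinarith
    have h3 : ((n : ℝ) + 1) • R n x - x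
        = ((n : ℝ) + 1) • R n (x - U) - (x - U) + R n V := by
      rw [← h1, map_sub, smul_sub]; abel
    rw [dist_eq_norm, h3]
    have h4 := hle n (x - U)
    have h5 := norm_add_le (((n : ℝ) + 1) • R n (x - U) - (x - U)) (R n V)
    have h6 := norm_sub_le (((n : ℝ) + 1) • R n (x - U)) (x - U)
    linarith
  have hYU : ∀ U V, (U, V) ∈ A.graph → Tendsto (fun n => Y n U) atTop (𝓝 V) := by
    intro U V h
    -- On the domain the Yosida approximation is r(rRU - U) = rRV, so its limit is V.
    refine (hrR V).congr fun n => ?_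
    have := (hR n).apply_of_mem h
    rw [map_sub, map_smul, sub_eq_iff_eq_add] at this
    have h2 : R n V = ((n : ℝ) + 1) • R n U - U := by
      rw [eq_sub_iff_add_eq, add_comm, ← this, ← Complex.coe_smul]
    rw [h2]
    simp only [hY, yosida, sub_apply, smul_apply, one_apply_eq_self, smul_sub, smul_smul, sq]
  -- the limit semigroup
  have hlim : ∀ (t : NNReal) (x : X), ∃ y, Tendsto (fun n => expOp (Y n) t x) atTop (𝓝 y) := by
    intro t x
    refine cauchySeq_tendsto_of_complete (Metric.cauchySeq_iff.2 fun ε hε => ?_)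
    obtain ⟨U, V, hUV, hx⟩ := approx x (ε / 3) (by positivity)
    have hc := (hYU U V hUV).cauchySeq
    obtain ⟨N, hN⟩ := Metric.cauchySeq_iff.1 hc (ε / 3 / (t + 1)) (by positivity)
    refine ⟨N, fun n hn k hk => ?_⟩
    have h1 : ‖expOp (Y n) t U - expOp (Y k) t U‖ ≤ ‖Y n U - Y k U‖ * t :=
      norm_expOp_sub_le (hYc n k) (hE n) (hE k) t.2 U
    have h2 := hN n hn k hk
    rw [dist_eq_norm, lt_div_iff₀ (by positivity)] at h2
    have h3 : ‖Y n U - Y k U‖ * t ≤ ‖Y n U - Y k U‖ * (t + 1) := by gcongr; linarith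
    have h4 : expOp (Y n) t x - expOp (Y k) t x = (expOp (Y n) t U - expOp (Y k) t U)
        + expOp (Y n) t (x - U) - expOp (Y k) t (x - U) := by
      rw [map_sub, map_sub]; abel
    rw [dist_eq_norm, h4]
    have h5 := hE n t (x - U) t.2
    have h6 := hE k t (x - U) t.2
    have h7 := norm_sub_le ((expOp (Y n) t U - expOp (Y k) t U)
        + expOp (Y n) t (x - U)) (expOp (Y k) t (x - U))
    have h8 := norm_add_le (expOp (Y n) t U - expOp (Y k) t U) (expOp (Y n) t (x - U))
    linarith
  choose s hs' using hlim
  have hsn : ∀ t x, ‖s t x‖ ≤ ‖x‖ := fun t x =>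
    le_of_tendsto' (hs' t x).norm fun n => hE n t x t.2
  let S : NNReal → X →L[ℂ] X := fun t =>
    LinearMap.mkContinuous
      { toFun := s t
        map_add' := fun x y => tendsto_nhds_unique (hs' t _) (by
          simpa only [map_add] using (hs' t x).add (hs' t y))
        map_smul' := fun a x => tendsto_nhds_unique (hs' t _) (by
          simp only [map_smul]
          exact (hs' t x).const_smul a) } 1
      (fun x => by rw [one_mul]; exact hsn t x)
  have hSs : ∀ t x, S t x = s t x := fun t x => rfl
  have hSlim : ∀ (t : NNReal) x, Tendsto (fun n => expOp (Y n) t x) atTop (𝓝 (S t x)) := hs'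
  have hSn : ∀ t x, ‖S t x‖ ≤ ‖x‖ := hsn
  have hLip : ∀ n x, ∀ a : ℝ, 0 ≤ a → ∀ b : ℝ, 0 ≤ b →
      ‖expOp (Y n) b x - expOp (Y n) a x‖ ≤ ‖Y n x‖ * ‖b - a‖ := fun n x a ha b hb =>
    (convex_Ici (0 : ℝ)).norm_image_sub_le_of_norm_hasDerivWithin_le
      (fun t _ => (hasDerivAt_expOp (Y n) t x).hasDerivWithinAt) (fun t ht => hE n t _ ht) ha hb
  have hSLip : ∀ U V, (U, V) ∈ A.graph → ∀ a b : NNReal,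
      ‖S b U - S a U‖ ≤ ‖V‖ * ‖(b : ℝ) - a‖ := fun U V h a b =>
    le_of_tendsto_of_tendsto' ((hSlim b U).sub (hSlim a U)).norm
      ((hYU U V h).norm.mul_const _) fun n => hLip n U a a.2 b b.2
  have hzero : S 0 = ContinuousLinearMap.id ℂ X := by
    ext x
    refine tendsto_nhds_unique (hSlim 0 x) ?_
    simp [expOp_zero]
  have hC0 : IsC0Semigroup S := by
    refine ⟨hzero, fun a b => ?_, fun x => ?_⟩
    · ext x
      refine tendsto_nhds_unique (hSlim (a + b) x) ?_
      have h1 : Tendsto (fun n => expOp (Y n) a (expOp (Y n) b x) - expOp (Y n) a (S b x)) atTop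
          (𝓝 0) := by
        refine squeeze_zero_norm (fun n => ?_)
          (by simpa using ((hSlim b x).sub_const (S b x)).norm)
        rw [← map_sub]
        exact hE n a _ a.2
      have h2 := h1.add (hSlim a (S b x))
      simp only [sub_add_cancel, zero_add] at h2
      refine h2.congr fun n => ?_
      rw [NNReal.coe_add, expOp_add]; rfl
    · rw [Metric.continuous_iff]
      intro b ε hε
      obtain ⟨U, V, hUV, hx⟩ := approx x (ε / 3) (by positivity)
      refine ⟨ε / 3 / (‖V‖ + 1), by positivity, fun a ha => ?_⟩
      rw [NNReal.dist_eq, lt_div_iff₀ (by positivity), ← Real.norm_eq_abs] at ha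
      have h1 := hSLip U V hUV b a
      have h4 : S a x - S b x = (S a U - S b U) + S a (x - U) - S b (x - U) := by
        rw [map_sub, map_sub]; abel
      rw [dist_eq_norm, h4]
      have h5 := hSn a (x - U)
      have h6 := hSn b (x - U)
      have h7 := norm_sub_le ((S a U - S b U) + S a (x - U)) (S b (x - U))
      have h8 := norm_add_le (S a U - S b U) (S a (x - U))
      nlinarith [norm_nonneg ((a : ℝ) - b)]
  have hgen : ∀ x y, (x, y) ∈ A.graph →
      Tendsto (fun t : ℝ => ((t⁻¹ : ℝ) : ℂ) • (S t.toNNReal x - x)) (𝓝[>] 0) (𝓝 y) := by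
    intro x y h
    rw [Metric.tendsto_nhds]
    intro ε hε
    -- The image y of x need not lie in the domain. It is replaced by a nearby U that does, whose
    -- orbits are Lipschitz in time; the estimate is made for the approximating semigroups and
    -- passes to the limit in n.
    obtain ⟨U, V, hUV, hyU⟩ := approx y (ε / 4) (by positivity)
    have hδ : (0 : ℝ) < ε / 4 / (‖V‖ + 1) := by positivity
    filter_upwards [Ioo_mem_nhdsGT hδ] with t ht
    have ht0 : (t.toNNReal : ℝ) = t := Real.coe_toNNReal _ ht.1.le
    have hn : ∀ n, ‖expOp (Y n) t x - x - t • y‖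
        ≤ (‖Y n x - y‖ + (2 * (ε / 4) + t * ‖Y n U‖)) * t := by
      intro n
      have hdd : ∀ r, HasDerivAt (fun r => expOp (Y n) r x - r • y)
          (expOp (Y n) r (Y n x) - (1 : ℝ) • y) r := fun r =>
        (hasDerivAt_expOp (Y n) r x).sub ((hasDerivAt_id r).smul_const y)
      have h1 := norm_image_sub_le_of_norm_deriv_le_segment' (a := 0) (b := t)
        (C := ‖Y n x - y‖ + (2 * (ε / 4) + t * ‖Y n U‖))
        (fun r _ => (hdd r).hasDerivWithinAt) (fun r hr => ?_) t ⟨ht.1.le, le_rfl⟩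
      · simpa [expOp_zero, sub_right_comm] using h1
      · have e1 : expOp (Y n) r (Y n x) - (1 : ℝ) • y = expOp (Y n) r (Y n x - y)
            + (expOp (Y n) r (y - U) - (y - U)) + (expOp (Y n) r U - expOp (Y n) 0 U) := by
          rw [expOp_zero, one_smul, map_sub, map_sub, one_apply_eq_self]; abel
        rw [e1]
        refine (norm_add_le _ _).trans ((add_le_add ((norm_add_le _ _).trans (add_le_add
          (hE n r _ hr.1) ((norm_sub_le _ _).trans (add_le_add (hE n r _ hr.1) le_rfl))))
          (hLip n U 0 le_rfl r hr.1)).trans ?_)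
        rw [sub_zero, Real.norm_of_nonneg hr.1]
        nlinarith [hr.2, norm_nonneg (Y n U), norm_nonneg (y - U)]
    have h2 : ‖S t.toNNReal x - x - t • y‖ ≤ (0 + (2 * (ε / 4) + t * ‖V‖)) * t := by
      have l1 := hSlim t.toNNReal x
      rw [ht0] at l1
      have l2 : Tendsto (fun n => ‖Y n x - y‖) atTop (𝓝 0) := by
        simpa using ((hYU x y h).sub_const y).norm
      exact le_of_tendsto_of_tendsto' ((l1.sub_const x).sub_const (t • y)).norm
        ((l2.add (((hYU U V hUV).norm.const_mul t).const_add _)).mul_const t) hn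
    have h3 : ((t⁻¹ : ℝ) : ℂ) • (S t.toNNReal x - x) - y
        = t⁻¹ • (S t.toNNReal x - x - t • y) := by
      rw [Complex.coe_smul, smul_sub t⁻¹ _ (t • y), smul_smul, inv_mul_cancel₀ ht.1.ne', one_smul]
    rw [dist_eq_norm, h3, norm_smul, norm_inv, Real.norm_of_nonneg ht.1.le,
      inv_mul_lt_iff₀ ht.1]
    have h4 : t * ‖V‖ < ε / 4 := by
      have := ht.2
      rw [lt_div_iff₀ (by positivity)] at this
      nlinarith [ht.1]
    nlinarith [ht.1]
  refine ⟨S, hC0, fun x y => ⟨hgen x y, fun h => ?_⟩⟩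
  -- Converse inclusion: the generator of S extends A, and 1 - A is already onto. The difference of
  -- x and the solution U of (1 - A)U = x - y is an eigenvector of the generator for the value 1, or
  -- zero.
  obtain ⟨U, V, hUV, e⟩ := hs 1 one_pos (x - y)
  have h1 : Tendsto (fun t : ℝ => ((t⁻¹ : ℝ) : ℂ) • (S t.toNNReal (x - U) - (x - U))) (𝓝[>] 0)
      (𝓝 (x - U)) := by
    have : x - U = y - V := by
      rw [Complex.ofReal_one, one_smul] at e
      rw [sub_eq_sub_iff_add_eq_add] at e ⊢
      rw [← e, add_comm]
    have h2 := h.sub (hgen U V hUV)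
    rw [← this] at h2
    refine h2.congr fun t => ?_
    rw [← smul_sub, map_sub]; congr 1; abel
  -- A nonzero z whose difference quotient tends to z would satisfy ‖S(t)z‖ > (1 + t)‖z‖ - t‖z‖ =
  -- ‖z‖ for some small t > 0, against contractivity.
  have hz : x - U = 0 := by
    set z := x - U
    clear_value z
    by_contra hne
    have hpos : 0 < ‖z‖ := norm_pos_iff.2 hne
    have h2 := Metric.tendsto_nhds.1 h1 (‖z‖) hpos
    obtain ⟨t, ht1, ht2⟩ := (h2.and self_mem_nhdsWithin).exists
    have ht : 0 < t := ht2
    have h3 : S t.toNNReal z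
        = (1 + t) • z + t • (((t⁻¹ : ℝ) : ℂ) • (S t.toNNReal z - z) - z) := by
      rw [Complex.coe_smul, smul_sub, smul_smul, mul_inv_cancel₀ ht.ne', one_smul, add_smul,
        one_smul]; abel
    have h4 := hSn t.toNNReal z
    rw [dist_eq_norm] at ht1
    have h5 : ‖(1 + t) • z‖ = (1 + t) * ‖z‖ := by
      rw [norm_smul, Real.norm_of_nonneg (by positivity)]
    have h6 : ‖t • (((t⁻¹ : ℝ) : ℂ) • (S t.toNNReal z - z) - z)‖ < t * ‖z‖ := by
      rw [norm_smul, Real.norm_of_nonneg ht.le]; gcongr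
    have h7 := norm_sub_le (S t.toNNReal z) (t • (((t⁻¹ : ℝ) : ℂ) • (S t.toNNReal z - z) - z))
    rw [← eq_sub_iff_add_eq.2 h3.symm, h5] at h7
    linarith
  have hxU : x = U := sub_eq_zero.1 hz
  have hyV : y = V := by
    rw [Complex.ofReal_one, one_smul, ← hxU] at e
    exact (sub_right_inj.1 e).symm
  rw [hxU, hyV]; exact hUV

omit [CompleteSpace X] in
lemma IsGeneratedBy.hasDerivWithinAt {A : X →ₗ.[ℂ] X} {S : NNReal → X →L[ℂ] X}
    (hS : IsGeneratedBy S A) {U V : X} (h : (U, V) ∈ A.graph) {t : ℝ} (ht : 0 ≤ t) :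
    HasDerivWithinAt (fun t : ℝ => S t.toNNReal U) (S t.toNNReal V) (Ici t) t := by
  rw [← hasDerivWithinAt_Ioi_iff_Ici, hasDerivWithinAt_iff_tendsto_slope' self_notMem_Ioi]
  have h1 := (hS.mem_graph_iff U V).1 h
  have h2 : Tendsto (fun x : ℝ => x - t) (𝓝[>] t) (𝓝[>] 0) := by
    refine tendsto_nhdsWithin_iff.2 ⟨?_, ?_⟩
    · have : Tendsto (fun x : ℝ => x - t) (𝓝 t) (𝓝 (t - t)) := tendsto_id.sub_const t
      rw [sub_self] at this
      exact this.mono_left nhdsWithin_le_nhds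
    · filter_upwards [self_mem_nhdsWithin] with x hx
      exact mem_Ioi.2 (by linarith [mem_Ioi.1 hx])
  have h3 := ((S t.toNNReal).continuous.tendsto V).comp (h1.comp h2)
  refine h3.congr' ?_
  filter_upwards [self_mem_nhdsWithin] with x hx
  have hx' : 0 < x - t := by linarith [mem_Ioi.1 hx]
  have e1 : x.toNNReal = t.toNNReal + (x - t).toNNReal := by
    rw [← Real.toNNReal_add ht hx'.le, add_sub_cancel]
  simp only [Function.comp_apply]
  rw [slope_def_module, e1, hS.isC0Semigroup.map_add, map_smul, map_sub, Complex.coe_smul]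
  rfl

omit [CompleteSpace X] in
/-- The generator of an exponentially stable semigroup is uniformly bounded below along the
imaginary axis. -/
theorem ExponentiallyStable.exists_boundedBelow {A : X →ₗ.[ℂ] X} {S : NNReal → X →L[ℂ] X}
    (hS : IsGeneratedBy S A) (h : ExponentiallyStable S) :
    ∃ c > 0, ∀ μ : ℝ, BoundedBelow A (Complex.I * μ) c := by
  obtain ⟨M, hM, ω, hω, hn⟩ := h
  refine ⟨ω / M, by positivity, fun μ U V hUV => ?_⟩
  set y := (Complex.I * μ) • U - V with hy
  set e : ℝ → ℂ := fun t => Complex.exp (-(Complex.I * μ) * t) with he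
  have hen : ∀ t, ‖e t‖ = 1 := fun t => by
    simp only [he]
    rw [Complex.norm_exp]; simp
  have hed : ∀ t, HasDerivAt e (-(Complex.I * μ) * e t) t := fun t => by
    have := ((Complex.ofRealCLM.hasDerivAt (x := t)).const_mul (-(Complex.I * μ))).cexp
    simp only [Complex.ofRealCLM_apply, Complex.ofReal_one, mul_one] at this
    rw [mul_comm]; exact this
  have hSn : ∀ t : ℝ, 0 ≤ t → ∀ x, ‖S t.toNNReal x‖ ≤ M * Real.exp (-ω * t) * ‖x‖ := by
    intro t ht x
    have := (S t.toNNReal).le_of_opNorm_le (hn t.toNNReal) x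
    rwa [Real.coe_toNNReal _ ht] at this
  -- Formally U = ∫₀^∞ e^{-iμt} S(t) y dt. Instead of integrating, the norm of e^{-iμt} S(t)U - U is
  -- compared with a scalar primitive; right derivatives suffice for this.
  have hd : ∀ t, 0 ≤ t → HasDerivWithinAt (fun t : ℝ => e t • S t.toNNReal U - U)
      (-(e t • S t.toNNReal y)) (Ici t) t := by
    intro t ht
    have h1 := ((hed t).hasDerivWithinAt.smul (hS.hasDerivWithinAt hUV ht)).sub_const U
    refine h1.congr_deriv ?_
    rw [hy, map_sub, map_smul, smul_sub, smul_smul, mul_smul, neg_smul, mul_comm, mul_smul, smul_smul]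
    module
  -- The scalar majorant vanishes at 0, has derivative M e^{-ωt}‖y‖, and tends to M‖y‖/ω. Since
  -- e^{-iμt} S(t)U → 0, the limit t → ∞ reads ‖U‖ ≤ (M/ω)‖y‖.
  have hB : ∀ t, HasDerivAt (fun t : ℝ => M / ω * ‖y‖ * (1 - Real.exp (-ω * t)))
      (M * Real.exp (-ω * t) * ‖y‖) t := by
    intro t
    have h1 : HasDerivAt (fun t : ℝ => Real.exp (-ω * t)) (Real.exp (-ω * t) * (-ω * 1)) t :=
      ((hasDerivAt_id t).const_mul (-ω)).exp
    refine ((h1.const_sub 1).const_mul (M / ω * ‖y‖)).congr_deriv ?_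
    field_simp
  have hmain : ∀ t : ℝ, 0 ≤ t → ‖e t • S t.toNNReal U - U‖
      ≤ M / ω * ‖y‖ * (1 - Real.exp (-ω * t)) := by
    intro t ht
    refine image_norm_le_of_norm_deriv_right_le_deriv_boundary (a := 0) (b := t)
      (f := fun t : ℝ => e t • S t.toNNReal U - U)
      (f' := fun t => -(e t • S t.toNNReal y)) ?_ (fun s hs => hd s hs.1) ?_ hB
      (fun s hs => ?_) ⟨ht, le_rfl⟩
    · refine Continuous.continuousOn ?_
      have hc : Continuous e := continuous_iff_continuousAt.2 fun t => (hed t).continuousAt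
      have hc2 : Continuous fun t : ℝ => S t.toNNReal U :=
        (hS.isC0Semigroup.continuous U).comp continuous_real_toNNReal
      exact (hc.smul hc2).sub continuous_const
    · simp [he, hS.isC0Semigroup.map_zero]
    · rw [norm_neg, norm_smul, hen, one_mul]
      exact hSn s hs.1 y
  have hexp : Tendsto (fun t : ℝ => Real.exp (-ω * t)) atTop (𝓝 0) :=
    Real.tendsto_exp_atBot.comp (tendsto_id.const_mul_atTop_of_neg (by linarith))
  have hz : Tendsto (fun t : ℝ => e t • S t.toNNReal U) atTop (𝓝 0) := by
    have hM0 := (hexp.const_mul M).mul_const ‖U‖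
    rw [mul_zero, zero_mul] at hM0
    refine squeeze_zero_norm' ?_ hM0
    filter_upwards [eventually_ge_atTop 0] with t ht
    rw [norm_smul, hen, one_mul]
    exact hSn t ht U
  have hfin : ‖(0 : X) - U‖ ≤ M / ω * ‖y‖ * (1 - 0) := by
    refine le_of_tendsto_of_tendsto (hz.sub_const U).norm
      ((hexp.const_sub 1).const_mul (M / ω * ‖y‖)) ?_
    filter_upwards [eventually_ge_atTop 0] with t ht using hmain t ht
  rw [zero_sub, norm_neg, sub_zero, mul_one, div_mul_eq_mul_div, le_div_iff₀ hω] at hfin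
  rw [div_mul_eq_mul_div, div_le_iff₀ hM]
  linarith

end Generation

/-! ### Absolutely continuous complex valued functions -/

section AbsCont

/-- Maps that do not increase distances do not increase the sums defining absolute continuity. This
passes between a complex function and its real and imaginary parts, to which the real fundamental
theorem applies. -/
lemma absCont_comp {E F : Type*} [PseudoMetricSpace E] [PseudoMetricSpace F] {f : ℝ → E} {a b : ℝ}
    (hf : AbsolutelyContinuousOnInterval f a b) {g : E → F}
    (hg : ∀ x y, dist (g x) (g y) ≤ dist x y) :
    AbsolutelyContinuousOnInterval (fun x => g (f x)) a b := by
  refine squeeze_zero (fun t => ?_) (fun t => ?_) hf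
  · exact Finset.sum_nonneg fun i _ => dist_nonneg
  · exact Finset.sum_le_sum fun i _ => hg _ _

variable {f g : ℝ → ℂ} {a b : ℝ}

lemma absCont_re (hf : AbsolutelyContinuousOnInterval f a b) :
    AbsolutelyContinuousOnInterval (fun x => (f x).re) a b :=
  absCont_comp hf fun x y => by
    rw [Real.dist_eq, ← Complex.sub_re, dist_eq_norm]; exact Complex.abs_re_le_norm _

lemma absCont_im (hf : AbsolutelyContinuousOnInterval f a b) :
    AbsolutelyContinuousOnInterval (fun x => (f x).im) a b :=
  absCont_comp hf fun x y => by
    rw [Real.dist_eq, ← Complex.sub_im, dist_eq_norm]; exact Complex.abs_im_le_norm _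

lemma absCont_conj (hf : AbsolutelyContinuousOnInterval f a b) :
    AbsolutelyContinuousOnInterval (fun x => starRingEnd ℂ (f x)) a b :=
  absCont_comp hf fun x y => (Complex.dist_conj_conj x y).le

lemma absCont_ofReal {h : ℝ → ℝ} (hf : AbsolutelyContinuousOnInterval h a b) :
    AbsolutelyContinuousOnInterval (fun x => (h x : ℂ)) a b :=
  absCont_comp hf fun x y => by rw [dist_eq_norm, ← Complex.ofReal_sub, Complex.norm_real]; rfl

lemma absCont_mul (hf : AbsolutelyContinuousOnInterval f a b)
    (hg : AbsolutelyContinuousOnInterval g a b) :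
    AbsolutelyContinuousOnInterval (fun x => f x * g x) a b :=
  hf.smul hg

lemma absCont_const (c : ℂ) : AbsolutelyContinuousOnInterval (fun _ : ℝ => c) a b :=
  contDiff_const.contDiffOn.absolutelyContinuousOnInterval

lemma absCont_ae_differentiableAt (hf : AbsolutelyContinuousOnInterval f a b) :
    ∀ᵐ x, x ∈ uIoc a b → DifferentiableAt ℝ f x := by
  filter_upwards [hf.boundedVariationOn.ae_differentiableAt_of_mem_uIcc] with x hx h
  exact hx (uIoc_subset_uIcc h)

lemma absCont_intervalIntegrable_deriv (hf : AbsolutelyContinuousOnInterval f a b) :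
    IntervalIntegrable (deriv f) volume a b := by
  have h1 := (absCont_re hf).intervalIntegrable_deriv
  have h2 := (absCont_im hf).intervalIntegrable_deriv
  have h3 : IntervalIntegrable (fun x => ((deriv (fun x => (f x).re) x : ℝ) : ℂ)
      + ((deriv (fun x => (f x).im) x : ℝ) : ℂ) * Complex.I) volume a b :=
    IntervalIntegrable.add ⟨h1.1.ofReal, h1.2.ofReal⟩
      (IntervalIntegrable.mul_const ⟨h2.1.ofReal, h2.2.ofReal⟩ _)
  refine h3.congr_ae ?_
  rw [EventuallyEq, ae_restrict_iff' measurableSet_uIoc]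
  filter_upwards [absCont_ae_differentiableAt hf] with x hx hm
  have hd := (hx hm).hasDerivAt
  have e1 := (Complex.reCLM.hasFDerivAt.comp_hasDerivAt x hd).deriv
  have e2 := (Complex.imCLM.hasFDerivAt.comp_hasDerivAt x hd).deriv
  have e1' : deriv (fun x => (f x).re) x = (deriv f x).re := e1
  have e2' : deriv (fun x => (f x).im) x = (deriv f x).im := e2
  rw [e1', e2', Complex.re_add_im]

lemma absCont_integral_deriv (hf : AbsolutelyContinuousOnInterval f a b) :
    ∫ x in a..b, deriv f x = f b - f a := by
  have h1 := (absCont_re hf).integral_deriv_eq_sub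
  have h2 := (absCont_im hf).integral_deriv_eq_sub
  have hi := absCont_intervalIntegrable_deriv hf
  have key : ∀ L : ℂ →L[ℝ] ℝ, ∫ x in a..b, deriv (fun x => L (f x)) x
      = L (∫ x in a..b, deriv f x) := by
    intro L
    rw [← ContinuousLinearMap.intervalIntegral_comp_comm L hi]
    refine intervalIntegral.integral_congr_ae ?_
    filter_upwards [absCont_ae_differentiableAt hf] with x hx hm
    exact (L.hasFDerivAt.comp_hasDerivAt x (hx hm).hasDerivAt).deriv
  have k1 := key Complex.reCLM
  have k2 := key Complex.imCLM
  simp only [Complex.reCLM_apply, Complex.imCLM_apply] at k1 k2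
  apply Complex.ext
  · rw [← k1, h1, Complex.sub_re]
  · rw [← k2, h2, Complex.sub_im]

lemma absCont_congr (hf : AbsolutelyContinuousOnInterval f a b) (h : EqOn f g (uIcc a b)) :
    AbsolutelyContinuousOnInterval g a b := by
  rw [absolutelyContinuousOnInterval_iff] at hf ⊢
  intro ε hε
  obtain ⟨δ, hδ, H⟩ := hf ε hε
  refine ⟨δ, hδ, fun E hE hs => ?_⟩
  refine lt_of_eq_of_lt (Finset.sum_congr rfl fun i hi => ?_) (H E hE hs)
  have := hE.1 i hi
  rw [h this.1, h this.2]

lemma absCont_primitive {c : ℝ} (h : IntervalIntegrable f volume a b) (hc : c ∈ uIcc a b) :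
    AbsolutelyContinuousOnInterval (fun x => ∫ t in c..x, f t) a b := by
  have h1 : IntervalIntegrable (fun x => (f x).re) volume a b := ⟨h.1.re, h.2.re⟩
  have h2 : IntervalIntegrable (fun x => (f x).im) volume a b := ⟨h.1.im, h.2.im⟩
  have a1 := absCont_ofReal (h1.absolutelyContinuousOnInterval_intervalIntegral hc)
  have a2 := absCont_ofReal (h2.absolutelyContinuousOnInterval_intervalIntegral hc)
  have a3 := a1.add (absCont_mul a2 (absCont_const Complex.I))
  have he : ∀ x ∈ uIcc a b, (∫ t in c..x, f t) = ((∫ t in c..x, (f t).re : ℝ) : ℂ)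
      + ((∫ t in c..x, (f t).im : ℝ) : ℂ) * Complex.I := by
    intro x hx
    have hi : IntervalIntegrable f volume c x := h.mono_set (uIcc_subset_uIcc hc hx)
    have e1 := ContinuousLinearMap.intervalIntegral_comp_comm Complex.reCLM hi
    have e2 := ContinuousLinearMap.intervalIntegral_comp_comm Complex.imCLM hi
    simp only [Complex.reCLM_apply, Complex.imCLM_apply] at e1 e2
    rw [e1, e2, Complex.re_add_im]
  exact absCont_congr a3 fun x hx => (he x hx).symm

/-- Integration by parts, sesquilinear form. -/
lemma absCont_integral_mul_conj (hf : AbsolutelyContinuousOnInterval f a b)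
    (hg : AbsolutelyContinuousOnInterval g a b) :
    ∫ x in a..b, (deriv f x * starRingEnd ℂ (g x) + f x * starRingEnd ℂ (deriv g x))
      = f b * starRingEnd ℂ (g b) - f a * starRingEnd ℂ (g a) := by
  rw [← absCont_integral_deriv (absCont_mul hf (absCont_conj hg))]
  refine intervalIntegral.integral_congr_ae ?_
  filter_upwards [absCont_ae_differentiableAt hf, absCont_ae_differentiableAt hg] with x h1 h2 hm
  have h3 : HasDerivAt (fun x => starRingEnd ℂ (g x)) (starRingEnd ℂ (deriv g x)) x :=
    Complex.conjCLE.hasFDerivAt.comp_hasDerivAt x (h2 hm).hasDerivAt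
  exact ((h1 hm).hasDerivAt.mul h3).deriv.symm

end AbsCont

/-! ### Integral inequalities -/

lemma sq_norm_integral_mul_le {μ : Measure ℝ} {f g : ℝ → ℂ} (hf : MemLp f 2 μ) (hg : MemLp g 2 μ) :
    ‖∫ x, f x * g x ∂μ‖ ^ 2 ≤ (∫ x, ‖f x‖ ^ 2 ∂μ) * ∫ x, ‖g x‖ ^ 2 ∂μ := by
  have h := integral_mul_norm_le_Lp_mul_Lq (μ := μ) (f := f) (g := g) Real.HolderConjugate.two_two
    (by simpa using hf) (by simpa using hg)
  simp only [Real.rpow_two] at h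
  have h1 : ‖∫ x, f x * g x ∂μ‖ ≤ ∫ x, ‖f x‖ * ‖g x‖ ∂μ := by
    refine (norm_integral_le_integral_norm _).trans_eq ?_
    simp
  have h0 : 0 ≤ ∫ x, ‖f x‖ ^ 2 ∂μ := integral_nonneg fun x => by positivity
  have h0' : 0 ≤ ∫ x, ‖g x‖ ^ 2 ∂μ := integral_nonneg fun x => by positivity
  calc ‖∫ x, f x * g x ∂μ‖ ^ 2
      ≤ ((∫ x, ‖f x‖ ^ 2 ∂μ) ^ (1 / (2 : ℝ)) * (∫ x, ‖g x‖ ^ 2 ∂μ) ^ (1 / (2 : ℝ))) ^ 2 := by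
        gcongr; exact h1.trans h
    _ = _ := by
        rw [mul_pow, ← Real.sqrt_eq_rpow, ← Real.sqrt_eq_rpow, Real.sq_sqrt h0, Real.sq_sqrt h0']

lemma integrable_sq_norm {μ : Measure ℝ} {f : ℝ → ℂ} (hf : MemLp f 2 μ) :
    Integrable (fun x => ‖f x‖ ^ 2) μ :=
  (memLp_two_iff_integrable_sq_norm hf.1).1 hf

lemma memLp_mono_measure {f : ℝ → ℂ} {s : Set ℝ} (hf : MemLp f 2 unitMeasure)
    (hs : s ⊆ Ioo 0 1) : MemLp f 2 (volume.restrict s) :=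
  hf.mono_measure (Measure.restrict_mono hs le_rfl)

/-- This excludes nonzero boundary values at the degenerate end point: they would make an integrable
function dominate c/x near 0. -/
lemma not_integrableOn_of_inv_le {f : ℝ → ℝ} {c : ℝ} (hc : 0 < c)
    (h : ∀ᶠ x in 𝓝[>] 0, c ≤ x * f x) : ¬ IntegrableOn f (Ioo 0 1) := by
  intro hf
  obtain ⟨δ, hδ, H⟩ := (mem_nhdsGT_iff_exists_Ioo_subset).1 h
  set δ' := min δ 1
  have hδ' : 0 < δ' := lt_min hδ one_pos
  have h1 : IntegrableOn (fun x : ℝ => x⁻¹) (Ioo 0 δ') := by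
    have h2 : IntegrableOn f (Ioo 0 δ') := hf.mono_set (Ioo_subset_Ioo le_rfl (min_le_right _ _))
    refine Integrable.mono' (h2.const_mul c⁻¹)
      (measurable_inv.aestronglyMeasurable) ?_
    filter_upwards [ae_restrict_mem measurableSet_Ioo] with x hx
    have h3 : c ≤ x * f x := H ⟨hx.1, hx.2.trans_le (min_le_left _ _)⟩
    rw [norm_inv, Real.norm_of_nonneg hx.1.le, inv_mul_eq_div, le_div_iff₀ hc,
      inv_mul_le_iff₀ hx.1]
    exact h3
  have h2 : IntervalIntegrable (fun x : ℝ => x⁻¹) volume 0 δ' := by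
    rw [intervalIntegrable_iff_integrableOn_Ioo_of_le hδ'.le]; exact h1
  rw [intervalIntegrable_inv_iff] at h2
  rcases h2 with h2 | h2
  · exact hδ'.ne h2
  · exact h2 left_mem_uIcc

/-! ### The coefficient -/

section Coefficient

variable {τ : ℝ → ℝ}

lemma IsDegenerateCoeff.quotient_le (hτ : IsDegenerateCoeff τ) {x : ℝ} (hx : x ∈ Ioc (0 : ℝ) 1) :
    x * |derivWithin τ (Icc 0 1) x| ≤ degeneracyIndex τ * τ x := by
  have := le_csSup hτ.bddAbove ⟨x, hx, rfl⟩
  rwa [div_le_iff₀ (hτ.pos x hx)] at this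

lemma IsDegenerateCoeff.index_nonneg (hτ : IsDegenerateCoeff τ) : 0 ≤ degeneracyIndex τ := by
  have h1 : (1 : ℝ) ∈ Ioc (0 : ℝ) 1 := ⟨one_pos, le_rfl⟩
  have := hτ.quotient_le h1
  have h2 := hτ.pos 1 h1
  by_contra! h
  nlinarith [abs_nonneg (derivWithin τ (Icc 0 1) 1)]

lemma IsDegenerateCoeff.continuousOn_Ioc (hτ : IsDegenerateCoeff τ) : ContinuousOn τ (Ioc 0 1) :=
  hτ.continuousOn.mono Ioc_subset_Icc_self

lemma IsDegenerateCoeff.hasDerivAt (hτ : IsDegenerateCoeff τ) {x : ℝ} (hx : x ∈ Ioo (0 : ℝ) 1) :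
    HasDerivAt τ (derivWithin τ (Icc 0 1) x) x := by
  have h1 : DifferentiableAt ℝ τ x :=
    (hτ.contDiffOn.differentiableOn one_ne_zero x (Ioo_subset_Ioc_self hx)).differentiableAt
      (Ioc_mem_nhds hx.1 hx.2)
  rw [h1.derivWithin (uniqueDiffOn_Icc zero_lt_one x (Ioo_subset_Icc_self hx))]
  exact h1.hasDerivAt

/-- The inequality xτ' ≤ m τ says that τ x^(-m) is nonincreasing; compare with its value at 1. -/
lemma IsDegenerateCoeff.lower_bound (hτ : IsDegenerateCoeff τ) {x : ℝ} (hx : x ∈ Ioc (0 : ℝ) 1) :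
    τ 1 * x ^ degeneracyIndex τ ≤ τ x := by
  set m := degeneracyIndex τ
  have hanti : AntitoneOn (fun x => τ x * x ^ (-m)) (Ioc 0 1) := by
    refine antitoneOn_of_hasDerivWithinAt_nonpos (convex_Ioc 0 1)
      (f' := fun x => derivWithin τ (Icc 0 1) x * x ^ (-m) + τ x * (-m * x ^ (-m - 1)))
      ?_ ?_ ?_
    · exact hτ.continuousOn_Ioc.mul fun y hy =>
        (Real.continuousAt_rpow_const y (-m) (Or.inl hy.1.ne')).continuousWithinAt
    · intro y hy
      rw [interior_Ioc] at hy
      exact ((hτ.hasDerivAt hy).mul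
        (Real.hasDerivAt_rpow_const (Or.inl hy.1.ne'))).hasDerivWithinAt
    · intro y hy
      rw [interior_Ioc] at hy
      have h1 := hτ.quotient_le (Ioo_subset_Ioc_self hy)
      have h2 : y * derivWithin τ (Icc 0 1) y ≤ m * τ y :=
        (mul_le_mul_of_nonneg_left (le_abs_self _) hy.1.le).trans h1
      have h3 : y ^ (-m) = y * y ^ (-m - 1) := by
        rw [Real.rpow_sub_one hy.1.ne']; field_simp [hy.1.ne']
      have h4 : 0 < y ^ (-m - 1) := Real.rpow_pos_of_pos hy.1 _
      rw [h3]
      have : derivWithin τ (Icc 0 1) y * (y * y ^ (-m - 1)) + τ y * (-m * y ^ (-m - 1))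
        = (y * derivWithin τ (Icc 0 1) y - m * τ y) * y ^ (-m - 1) := by ring
      rw [this]
      exact mul_nonpos_of_nonpos_of_nonneg (by linarith) h4.le
  have h := hanti hx ⟨one_pos, le_rfl⟩ hx.2
  simp only [Real.one_rpow, mul_one] at h
  rwa [Real.rpow_neg hx.1.le, ← div_eq_mul_inv, le_div_iff₀ (Real.rpow_pos_of_pos hx.1 _)] at h

/-- Here [m_τ] = 1, so τ is C¹ up to 0, hence Lipschitz, and τ(0) = 0. This is where the smoothness
assumption up to the end point is used. -/
lemma IsDegenerateCoeff.upper_bound (hτ : IsDegenerateCoeff τ) (h1 : 1 ≤ degeneracyIndex τ) :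
    ∃ C > 0, ∀ x ∈ Icc (0 : ℝ) 1, τ x ≤ C * x := by
  have hf : ⌊degeneracyIndex τ⌋₊ = 1 := by
    rw [Nat.floor_eq_iff hτ.index_nonneg]
    have := hτ.index_lt_two
    constructor <;> norm_num <;> assumption
  have hc := hτ.contDiffOn_index
  rw [hf, Nat.cast_one] at hc
  obtain ⟨K, hK⟩ := hc.exists_lipschitzOnWith one_ne_zero (convex_Icc 0 1) isCompact_Icc
  refine ⟨K + 1, by positivity, fun x hx => ?_⟩
  have := hK.dist_le_mul x hx 0 ⟨le_rfl, zero_le_one⟩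
  rw [hτ.zero, Real.dist_eq, Real.dist_eq, sub_zero, sub_zero, abs_of_nonneg hx.1] at this
  nlinarith [le_abs_self (τ x), hx.1]

/-- `τ ^ (-1/2)`. -/
def invSqrt (τ : ℝ → ℝ) (x : ℝ) : ℝ := (Real.sqrt (τ x))⁻¹

lemma invSqrt_sq (hτ : IsDegenerateCoeff τ) {x : ℝ} (hx : x ∈ Ioc (0 : ℝ) 1) :
    invSqrt τ x ^ 2 = (τ x)⁻¹ := by
  rw [invSqrt, inv_pow, Real.sq_sqrt (hτ.pos x hx).le]

lemma sqrt_mul_invSqrt (hτ : IsDegenerateCoeff τ) {x : ℝ} (hx : x ∈ Ioc (0 : ℝ) 1) :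
    Real.sqrt (τ x) * invSqrt τ x = 1 :=
  mul_inv_cancel₀ (Real.sqrt_pos.2 (hτ.pos x hx)).ne'

lemma continuousOn_invSqrt (hτ : IsDegenerateCoeff τ) : ContinuousOn (invSqrt τ) (Ioc 0 1) :=
  (hτ.continuousOn_Ioc.sqrt).inv₀ fun x hx => (Real.sqrt_pos.2 (hτ.pos x hx)).ne'

lemma aestronglyMeasurable_of_continuousOn {E : Type*} [TopologicalSpace E]
    [TopologicalSpace.PseudoMetrizableSpace E] {f : ℝ → E} (hf : ContinuousOn f (Ioc 0 1)) :
    AEStronglyMeasurable f unitMeasure :=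
  (hf.mono Ioo_subset_Ioc_self).aestronglyMeasurable measurableSet_Ioo

lemma invSqrt_sq_le (hτ : IsDegenerateCoeff τ) {x : ℝ} (hx : x ∈ Ioc (0 : ℝ) 1) :
    invSqrt τ x ^ 2 ≤ (τ 1)⁻¹ * x ^ (-degeneracyIndex τ) := by
  rw [invSqrt_sq hτ hx, Real.rpow_neg hx.1.le, ← mul_inv]
  have h1 := hτ.pos 1 ⟨one_pos, le_rfl⟩
  exact inv_anti₀ (mul_pos h1 (Real.rpow_pos_of_pos hx.1 _)) (hτ.lower_bound hx)

lemma integrableOn_rpow_unit {r : ℝ} (hr : -1 < r) : IntegrableOn (fun x : ℝ => x ^ r) (Ioo 0 1) :=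
  (intervalIntegral.integrableOn_Ioo_rpow_iff one_pos).2 hr

lemma memLp_two_of_sq_le {f : ℝ → ℂ} {g : ℝ → ℝ} (hf : AEStronglyMeasurable f unitMeasure)
    (hg : IntegrableOn g (Ioo 0 1)) (h : ∀ x ∈ Ioo (0 : ℝ) 1, ‖f x‖ ^ 2 ≤ g x) :
    MemLp f 2 unitMeasure := by
  rw [memLp_two_iff_integrable_sq_norm hf]
  refine Integrable.mono' hg (hf.norm.pow 2) ?_
  filter_upwards [ae_restrict_mem measurableSet_Ioo] with x hx
  rw [Real.norm_of_nonneg (by positivity)]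
  exact h x hx

lemma memLp_invSqrt (hτ : IsDegenerateCoeff τ) (h1 : degeneracyIndex τ < 1) :
    MemLp (fun x => (invSqrt τ x : ℂ)) 2 unitMeasure := by
  refine memLp_two_of_sq_le (aestronglyMeasurable_of_continuousOn
    (Complex.continuous_ofReal.comp_continuousOn (continuousOn_invSqrt hτ)))
    ((integrableOn_rpow_unit (r := -degeneracyIndex τ) (by linarith)).const_mul (τ 1)⁻¹)
    fun x hx => ?_
  rw [Complex.norm_real, Real.norm_eq_abs, sq_abs]
  exact invSqrt_sq_le hτ (Ioo_subset_Ioc_self hx)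

end Coefficient

/-! ### Fluxes -/

section Flux

variable {τ : ℝ → ℝ} {u v w : ℝ → ℂ}

lemma MemH1.continuousOn (hw : MemH1 w) : ContinuousOn w (Icc 0 1) := by
  have := hw.absCont.continuousOn
  rwa [uIcc_of_le zero_le_one] at this

lemma MemH1.absCont_mono (hw : MemH1 w) {a b : ℝ} (ha : a ∈ Icc (0 : ℝ) 1)
    (hb : b ∈ Icc (0 : ℝ) 1) : AbsolutelyContinuousOnInterval w a b := by
  refine hw.absCont.mono ?_
  rw [uIcc_of_le zero_le_one]
  exact uIcc_subset_Icc ha hb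

/-- Cauchy–Schwarz on w(x) - w(0) = ∫₀ˣ w'. The factor x compensates the singularity of 1/τ when
w(0) = 0. -/
lemma MemH1.sq_norm_sub_le (hw : MemH1 w) {x : ℝ} (hx : x ∈ Icc (0 : ℝ) 1) :
    ‖w x - w 0‖ ^ 2 ≤ x * ∫ y in Ioo (0 : ℝ) 1, ‖deriv w y‖ ^ 2 := by
  have h1 := absCont_integral_deriv (hw.absCont_mono ⟨le_rfl, zero_le_one⟩ hx)
  rw [← h1, intervalIntegral.integral_of_le hx.1, integral_Ioc_eq_integral_Ioo]
  have hs : Ioo 0 x ⊆ Ioo 0 1 := Ioo_subset_Ioo le_rfl hx.2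
  have h2 := sq_norm_integral_mul_le (μ := volume.restrict (Ioo 0 x)) (f := fun _ => 1)
    (memLp_const 1) (memLp_mono_measure hw.memLp_deriv hs)
  simp only [one_mul, norm_one, one_pow, integral_const, smul_eq_mul, mul_one] at h2
  refine h2.trans ?_
  have h3 : (volume.restrict (Ioo 0 x)).real univ = x := by simp [Measure.real, hx.1]
  rw [h3]
  refine mul_le_mul_of_nonneg_left ?_ hx.1
  exact setIntegral_mono_set (integrable_sq_norm hw.memLp_deriv)
    (Eventually.of_forall fun _ => by positivity) hs.eventuallyLE

lemma MemH2Weighted.invSqrt_mul_flux (hτ : IsDegenerateCoeff τ) (hu : MemH2Weighted τ u w) :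
    (fun x => (invSqrt τ x : ℂ) * w x) =ᵐ[unitMeasure]
      fun x => (Real.sqrt (τ x) : ℂ) * deriv u x := by
  filter_upwards [hu.flux_eq, ae_restrict_mem measurableSet_Ioo] with x h1 hx
  have h2 := sqrt_mul_invSqrt hτ (Ioo_subset_Ioc_self hx)
  have h3 := Real.mul_self_sqrt (hτ.pos x (Ioo_subset_Ioc_self hx)).le
  have h5 : (τ x : ℂ) = Real.sqrt (τ x) * Real.sqrt (τ x) := by exact_mod_cast h3.symm
  rw [h1, h5]
  have h4 : (Real.sqrt (τ x) : ℂ) * invSqrt τ x = 1 := by exact_mod_cast h2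
  calc (invSqrt τ x : ℂ) * (Real.sqrt (τ x) * Real.sqrt (τ x) * deriv u x)
      = (Real.sqrt (τ x) * invSqrt τ x) * (Real.sqrt (τ x) * deriv u x) := by ring
    _ = _ := by rw [h4, one_mul]

/-- In the strongly degenerate case the flux vanishes at the degenerate end point. -/
lemma MemH2Weighted.flux_zero (hτ : IsDegenerateCoeff τ) (hu : MemH2Weighted τ u w)
    (h1 : 1 ≤ degeneracyIndex τ) : w 0 = 0 := by
  by_contra h0
  obtain ⟨C, hC, hCx⟩ := hτ.upper_bound h1
  -- The square of √τ uₓ equals |w|²/τ, which would be at least (|w(0)|/2)²/(Cx) near 0 because τ ≤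
  -- Cx.
  have hi : IntegrableOn (fun x => ‖(invSqrt τ x : ℂ) * w x‖ ^ 2) (Ioo 0 1) :=
    integrable_sq_norm (hu.memH1.memLp_deriv.ae_eq (hu.invSqrt_mul_flux hτ).symm)
  have hn : 0 < ‖w 0‖ := norm_pos_iff.2 h0
  refine not_integrableOn_of_inv_le (c := (‖w 0‖ / 2) ^ 2 / C) (by positivity) ?_ hi
  have hc : Tendsto (fun x => ‖w x‖) (𝓝[>] 0) (𝓝 ‖w 0‖) :=
    ((hu.flux_memH1.continuousOn 0 ⟨le_rfl, zero_le_one⟩).mono_left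
      (nhdsWithin_le_of_mem (Icc_mem_nhdsGT zero_lt_one))).norm
  filter_upwards [hc.eventually_const_lt (half_lt_self hn), Ioo_mem_nhdsGT zero_lt_one]
    with x hx hx1
  have hx1' := Ioo_subset_Ioc_self hx1
  rw [norm_mul, Complex.norm_real, mul_pow, Real.norm_eq_abs, sq_abs, invSqrt_sq hτ hx1',
    div_le_iff₀ hC]
  have h2 := hCx x (Ioo_subset_Icc_self hx1)
  have h3 := hτ.pos x hx1'
  have h4 : 1 ≤ x * (τ x)⁻¹ * C := by
    rw [← div_eq_mul_inv, div_mul_eq_mul_div, le_div_iff₀ h3]; linarith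
  calc (‖w 0‖ / 2) ^ 2 ≤ ‖w x‖ ^ 2 := by gcongr
    _ ≤ ‖w x‖ ^ 2 * (x * (τ x)⁻¹ * C) := le_mul_of_one_le_right (by positivity) h4
    _ = _ := by ring

/-- For m_τ < 1 the function 1/τ is integrable and w is bounded. For m_τ ≥ 1 one has |w|² ≤ Mx and
1/τ ≤ Cx^(-m), so |w|²/τ ≤ CM x^(1-m) with 1 - m > -1. -/
lemma MemH1.memLp_invSqrt_mul (hτ : IsDegenerateCoeff τ) (hw : MemH1 w)
    (h0 : 1 ≤ degeneracyIndex τ → w 0 = 0) :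
    MemLp (fun x => (invSqrt τ x : ℂ) * w x) 2 unitMeasure := by
  have hm : AEStronglyMeasurable (fun x => (invSqrt τ x : ℂ) * w x) unitMeasure :=
    aestronglyMeasurable_of_continuousOn
      ((Complex.continuous_ofReal.comp_continuousOn (continuousOn_invSqrt hτ)).mul
        (hw.continuousOn.mono Ioc_subset_Icc_self))
  rcases lt_or_ge (degeneracyIndex τ) 1 with h1 | h1
  · obtain ⟨C, hC⟩ := isCompact_Icc.exists_bound_of_continuousOn hw.continuousOn
    refine memLp_two_of_sq_le hm
      ((integrable_sq_norm (memLp_invSqrt hτ h1)).mul_const (C ^ 2)) fun x hx => ?_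
    rw [norm_mul, mul_pow]
    have := hC x (Ioo_subset_Icc_self hx)
    gcongr
  · set M := ∫ y in Ioo (0 : ℝ) 1, ‖deriv w y‖ ^ 2
    have h2 := hτ.index_lt_two
    refine memLp_two_of_sq_le hm
      ((integrableOn_rpow_unit (r := 1 - degeneracyIndex τ) (by linarith)).const_mul ((τ 1)⁻¹ * M))
      fun x hx => ?_
    have h3 := hw.sq_norm_sub_le (Ioo_subset_Icc_self hx)
    rw [h0 h1, sub_zero] at h3
    rw [norm_mul, mul_pow, Complex.norm_real, Real.norm_eq_abs, sq_abs, sub_eq_add_neg,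
      Real.rpow_add hx.1, Real.rpow_one]
    calc _ ≤ (τ 1)⁻¹ * x ^ (-degeneracyIndex τ) * (x * M) :=
          mul_le_mul (invSqrt_sq_le hτ (Ioo_subset_Ioc_self hx)) h3 (by positivity)
            ((sq_nonneg _).trans (invSqrt_sq_le hτ (Ioo_subset_Ioc_self hx)))
      _ = _ := by ring

lemma memLp_conj {μ : Measure ℝ} {f : ℝ → ℂ} (hf : MemLp f 2 μ) :
    MemLp (fun x => starRingEnd ℂ (f x)) 2 μ := hf.star

lemma integrable_flux_mul (hτ : IsDegenerateCoeff τ) (hv : MemH1Weighted τ v) (hw : MemH1 w)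
    (h0 : 1 ≤ degeneracyIndex τ → w 0 = 0) :
    IntegrableOn (fun x => w x * starRingEnd ℂ (deriv v x)) (Ioo 0 1) := by
  have h1 := (hw.memLp_invSqrt_mul hτ h0).integrable_mul (memLp_conj hv.memLp_deriv)
  refine h1.congr ?_
  filter_upwards [ae_restrict_mem measurableSet_Ioo] with x hx
  have h2 : (Real.sqrt (τ x) : ℂ) * invSqrt τ x = 1 := by
    exact_mod_cast sqrt_mul_invSqrt hτ (Ioo_subset_Ioc_self hx)
  simp only [Pi.mul_apply, map_mul, Complex.conj_ofReal]
  linear_combination (w x * starRingEnd ℂ (deriv v x)) * h2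

lemma MemH1.integrable_deriv_mul (hv : MemH1Weighted τ v) (hw : MemH1 w) :
    IntegrableOn (fun x => deriv w x * starRingEnd ℂ (v x)) (Ioo 0 1) :=
  hw.memLp_deriv.integrable_mul (memLp_conj hv.memLp)

/-- Green's formula. -/
lemma green (hτ : IsDegenerateCoeff τ) (hv : MemW τ v) (hw : MemH1 w)
    (h0 : 1 ≤ degeneracyIndex τ → w 0 = 0) :
    (∫ x in Ioo (0 : ℝ) 1, deriv w x * starRingEnd ℂ (v x))
      + ∫ x in Ioo (0 : ℝ) 1, w x * starRingEnd ℂ (deriv v x) = w 1 * starRingEnd ℂ (v 1) := by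
  have i1 := hw.integrable_deriv_mul hv.memH1
  have i2 := integrable_flux_mul hτ hv.memH1 hw h0
  rw [← integral_add i1 i2]
  set F := fun x => deriv w x * starRingEnd ℂ (v x) + w x * starRingEnd ℂ (deriv v x) with hF
  have iF : IntervalIntegrable F volume 0 1 := by
    rw [intervalIntegrable_iff_integrableOn_Ioo_of_le zero_le_one]; exact i1.add i2
  have hpart : ∀ ε ∈ Ioo (0 : ℝ) 1, ∫ x in ε..1, F x
      = w 1 * starRingEnd ℂ (v 1) - w ε * starRingEnd ℂ (v ε) := fun ε hε =>
    absCont_integral_mul_conj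
      (hw.absCont_mono (Ioo_subset_Icc_self hε) ⟨zero_le_one, le_rfl⟩) (hv.memH1.locAbsCont ε hε)
  have hlim : Tendsto (fun ε => ∫ x in ε..1, F x) (𝓝[>] 0) (𝓝 (∫ x in (0 : ℝ)..1, F x)) := by
    have h1 := intervalIntegral.continuousOn_primitive_interval' iF right_mem_uIcc 0 left_mem_uIcc
    rw [uIcc_of_le zero_le_one] at h1
    have h2 : Tendsto (fun ε => ∫ x in (1 : ℝ)..ε, F x) (𝓝[>] 0) (𝓝 (∫ x in (1 : ℝ)..0, F x)) :=
      h1.mono_left (nhdsWithin_le_of_mem (Icc_mem_nhdsGT zero_lt_one))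
    simpa only [intervalIntegral.integral_symm _ (1 : ℝ), neg_neg] using h2.neg
  -- Integrating by parts on (ε, 1) shows that the boundary term has a limit at 0, so only its value
  -- is in question.
  have hwv : Tendsto (fun ε => w ε * starRingEnd ℂ (v ε)) (𝓝[>] 0)
      (𝓝 (w 1 * starRingEnd ℂ (v 1) - ∫ x in (0 : ℝ)..1, F x)) := by
    refine (hlim.const_sub (w 1 * starRingEnd ℂ (v 1))).congr' ?_
    filter_upwards [Ioo_mem_nhdsGT zero_lt_one] with ε hε
    rw [hpart ε hε]; ring
  have hwc : Tendsto w (𝓝[>] 0) (𝓝 (w 0)) := (hw.continuousOn 0 ⟨le_rfl, zero_le_one⟩).mono_left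
      (nhdsWithin_le_of_mem (Icc_mem_nhdsGT zero_lt_one))
  have hzero : w 1 * starRingEnd ℂ (v 1) - ∫ x in (0 : ℝ)..1, F x = 0 := by
    rcases lt_or_ge (degeneracyIndex τ) 1 with h1 | h1
    · have h2 := hwc.mul ((Complex.continuous_conj.tendsto 0).comp (hv.dirichlet h1))
      rw [map_zero, mul_zero] at h2
      exact tendsto_nhds_unique hwv h2
    -- Strong degeneracy: |w|² ≤ Mx, so a nonzero limit of w v̄ would force |v|² ≥ c/x near 0,
    -- against v ∈ L².
    · set L := w 1 * starRingEnd ℂ (v 1) - ∫ x in (0 : ℝ)..1, F x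
      by_contra hL
      have hLn : 0 < ‖L‖ := norm_pos_iff.2 hL
      set M := ∫ y in Ioo (0 : ℝ) 1, ‖deriv w y‖ ^ 2
      have hM : 0 ≤ M := integral_nonneg fun _ => by positivity
      refine not_integrableOn_of_inv_le (c := (‖L‖ / 2) ^ 2 / (M + 1)) (by positivity) ?_
        (integrable_sq_norm hv.memH1.memLp)
      filter_upwards [hwv.norm.eventually_const_lt (half_lt_self hLn),
        Ioo_mem_nhdsGT zero_lt_one] with x hx hx1
      have h3 := hw.sq_norm_sub_le (Ioo_subset_Icc_self hx1)
      rw [h0 h1, sub_zero] at h3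
      rw [div_le_iff₀ (by positivity)]
      rw [norm_mul, RCLike.norm_conj] at hx
      calc (‖L‖ / 2) ^ 2 ≤ (‖w x‖ * ‖v x‖) ^ 2 := by gcongr
        _ = ‖w x‖ ^ 2 * ‖v x‖ ^ 2 := by ring
        _ ≤ (x * M) * ‖v x‖ ^ 2 := by gcongr
        _ ≤ (x * (M + 1)) * ‖v x‖ ^ 2 := by have := hx1.1; gcongr; linarith
        _ = _ := by ring
  have := sub_eq_zero.1 hzero
  rw [this, intervalIntegral.integral_of_le zero_le_one, integral_Ioc_eq_integral_Ioo]

end Flux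

/-! ### The form domain -/

section Form

variable {τ : ℝ → ℝ}

/-- `∫₁ˣ τ ^ (-1/2) q`. -/
def weightedPrimitive (τ : ℝ → ℝ) (q : ℝ → ℂ) (x : ℝ) : ℂ :=
  ∫ y in (1 : ℝ)..x, (invSqrt τ y : ℂ) * q y

lemma memLp_invSqrt_Ioo (hτ : IsDegenerateCoeff τ) {x : ℝ} (hx : x ∈ Ioc (0 : ℝ) 1) :
    MemLp (fun y => (invSqrt τ y : ℂ)) 2 (volume.restrict (Ioo x 1)) := by
  have hs : Icc x 1 ⊆ Ioc 0 1 := fun y hy => ⟨hx.1.trans_le hy.1, hy.2⟩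
  have hc : ContinuousOn (fun y => (invSqrt τ y : ℂ)) (Icc x 1) :=
    Complex.continuous_ofReal.comp_continuousOn ((continuousOn_invSqrt hτ).mono hs)
  obtain ⟨C, hC⟩ := isCompact_Icc.exists_bound_of_continuousOn hc
  refine MemLp.of_bound ((hc.mono Ioo_subset_Icc_self).aestronglyMeasurable measurableSet_Ioo) C ?_
  filter_upwards [ae_restrict_mem measurableSet_Ioo] with y hy using hC y (Ioo_subset_Icc_self hy)

lemma intervalIntegrable_invSqrt_mul (hτ : IsDegenerateCoeff τ) {q : ℝ → ℂ}
    (hq : MemLp q 2 unitMeasure) {x : ℝ} (hx : x ∈ Ioc (0 : ℝ) 1) :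
    IntervalIntegrable (fun y => (invSqrt τ y : ℂ) * q y) volume x 1 := by
  rw [intervalIntegrable_iff_integrableOn_Ioo_of_le hx.2]
  exact (memLp_invSqrt_Ioo hτ hx).integrable_mul
    (memLp_mono_measure hq (Ioo_subset_Ioo hx.1.le le_rfl))

lemma locAbsCont_weightedPrimitive (hτ : IsDegenerateCoeff τ) {q : ℝ → ℂ}
    (hq : MemLp q 2 unitMeasure) : LocAbsCont (weightedPrimitive τ q) := fun _ hε =>
  absCont_primitive (intervalIntegrable_invSqrt_mul hτ hq (Ioo_subset_Ioc_self hε)) right_mem_uIcc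

lemma deriv_weightedPrimitive (hτ : IsDegenerateCoeff τ) {q : ℝ → ℂ}
    (hq : MemLp q 2 unitMeasure) :
    ∀ᵐ x ∂unitMeasure, HasDerivAt (weightedPrimitive τ q) ((invSqrt τ x : ℂ) * q x) x := by
  rw [ae_restrict_iff' measurableSet_Ioo]
  have h : ∀ n : ℕ, ∀ᵐ x, x ∈ Ioo (1 / ((n : ℝ) + 2)) 1 →
      HasDerivAt (weightedPrimitive τ q) ((invSqrt τ x : ℂ) * q x) x := fun n => by
    have hn : 1 / ((n : ℝ) + 2) ∈ Ioc (0 : ℝ) 1 :=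
      ⟨by positivity, by rw [div_le_one (by positivity)]; linarith [n.cast_nonneg (α := ℝ)]⟩
    filter_upwards [(intervalIntegrable_invSqrt_mul hτ hq hn).ae_hasDerivAt_integral] with x hx hm
    refine hx ?_ 1 right_mem_uIcc
    rw [uIcc_of_le hn.2]; exact Ioo_subset_Icc_self hm
  filter_upwards [ae_all_iff.2 h] with x hx hx01
  obtain ⟨n, hn⟩ := exists_nat_one_div_lt hx01.1
  refine hx n ⟨lt_of_le_of_lt ?_ hn, hx01.2⟩
  apply one_div_le_one_div_of_le <;> [positivity; linarith]

/-- On (x, 1), with θ = m_τ/2 < 1, one has y^(-m) = y^(-θ) y^(-θ) ≤ x^(-θ) y^(-θ). The second factor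
is integrable, and the resulting bound x^(-θ) is integrable too. This treats all m_τ < 2 at once,
without a logarithm at m_τ = 1. -/
lemma exists_sq_norm_weightedPrimitive_le (hτ : IsDegenerateCoeff τ) :
    ∃ C ≥ 0, ∀ q : ℝ → ℂ, MemLp q 2 unitMeasure → ∀ x ∈ Ioc (0 : ℝ) 1,
      ‖weightedPrimitive τ q x‖ ^ 2
        ≤ C * x ^ (-(degeneracyIndex τ / 2)) * ∫ y in Ioo (0 : ℝ) 1, ‖q y‖ ^ 2 := by
  set θ := degeneracyIndex τ / 2 with hθ
  have hθ0 : 0 ≤ θ := by have := hτ.index_nonneg; positivity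
  have hθ1 : θ < 1 := by have := hτ.index_lt_two; linarith
  have h1 := hτ.pos 1 ⟨one_pos, le_rfl⟩
  have hI := integrableOn_rpow_unit (r := -θ) (by linarith)
  refine ⟨(τ 1)⁻¹ * ∫ y in Ioo (0 : ℝ) 1, y ^ (-θ), mul_nonneg (inv_nonneg.2 h1.le)
    (setIntegral_nonneg measurableSet_Ioo fun y hy => Real.rpow_nonneg hy.1.le _),
    fun q hq x hx => ?_⟩
  have hs : Ioo x 1 ⊆ Ioo 0 1 := Ioo_subset_Ioo hx.1.le le_rfl
  have h2 := sq_norm_integral_mul_le (memLp_invSqrt_Ioo hτ hx) (memLp_mono_measure hq hs)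
  have h3 : ‖weightedPrimitive τ q x‖ = ‖∫ y in Ioo x 1, (invSqrt τ y : ℂ) * q y‖ := by
    rw [weightedPrimitive, intervalIntegral.integral_symm, norm_neg,
      intervalIntegral.integral_of_le hx.2, integral_Ioc_eq_integral_Ioo]
  rw [h3]
  refine h2.trans (mul_le_mul ?_ ?_ (integral_nonneg fun _ => by positivity) ?_)
  · have h4 : ∫ y in Ioo x 1, ‖(invSqrt τ y : ℂ)‖ ^ 2
        ≤ ∫ y in Ioo x 1, (τ 1)⁻¹ * x ^ (-θ) * y ^ (-θ) := by
      refine setIntegral_mono_on (integrable_sq_norm (memLp_invSqrt_Ioo hτ hx))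
        ((hI.mono_set hs).const_mul _) measurableSet_Ioo fun y hy => ?_
      have hy0 : 0 < y := hx.1.trans hy.1
      rw [Complex.norm_real, Real.norm_eq_abs, sq_abs]
      refine (invSqrt_sq_le hτ ⟨hy0, hy.2.le⟩).trans ?_
      have h5 : y ^ (-degeneracyIndex τ) = y ^ (-θ) * y ^ (-θ) := by
        rw [← Real.rpow_add hy0]; congr 1; rw [hθ]; ring
      have h6 : y ^ (-θ) ≤ x ^ (-θ) :=
        Real.rpow_le_rpow_of_nonpos hx.1 hy.1.le (by linarith)
      rw [h5, mul_assoc]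
      gcongr
    refine h4.trans ?_
    rw [integral_const_mul]
    have h7 : ∫ y in Ioo x 1, y ^ (-θ) ≤ ∫ y in Ioo (0 : ℝ) 1, y ^ (-θ) := by
      refine setIntegral_mono_set hI ?_ hs.eventuallyLE
      filter_upwards [ae_restrict_mem measurableSet_Ioo] with y hy
      exact Real.rpow_nonneg hy.1.le _
    have h8 := Real.rpow_nonneg hx.1.le (-θ)
    calc _ ≤ (τ 1)⁻¹ * x ^ (-θ) * ∫ y in Ioo (0 : ℝ) 1, y ^ (-θ) := by gcongr
      _ = _ := by ring
  · exact setIntegral_mono_set (integrable_sq_norm hq)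
      (Eventually.of_forall fun _ => by positivity) hs.eventuallyLE
  · have h8 := Real.rpow_nonneg hx.1.le (-θ)
    have : 0 ≤ ∫ y in Ioo (0 : ℝ) 1, y ^ (-θ) :=
      setIntegral_nonneg measurableSet_Ioo fun y hy => Real.rpow_nonneg hy.1.le _
    positivity

/-- The space `L²(0,1)`. -/
abbrev L2Unit : Type := Lp ℂ 2 unitMeasure

lemma sq_norm_L2 {μ : Measure ℝ} (f : Lp ℂ 2 μ) : ‖f‖ ^ 2 = ∫ x, ‖f x‖ ^ 2 ∂μ := by
  rw [← @inner_self_eq_norm_sq ℂ, L2.inner_def]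
  have : ∀ x, inner ℂ (f x) (f x) = ((‖f x‖ ^ 2 : ℝ) : ℂ) := by
    intro x; rw [inner_self_eq_norm_sq_to_K]; push_cast; rfl
  simp_rw [this]
  rw [integral_complex_ofReal]
  simp

lemma memLp_weightedPrimitive (hτ : IsDegenerateCoeff τ) {q : ℝ → ℂ}
    (hq : MemLp q 2 unitMeasure) : MemLp (weightedPrimitive τ q) 2 unitMeasure := by
  obtain ⟨C, hC0, hC⟩ := exists_sq_norm_weightedPrimitive_le hτ
  have h2 := hτ.index_lt_two
  refine memLp_two_of_sq_le (aestronglyMeasurable_of_continuousOn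
    (locAbsCont_weightedPrimitive hτ hq).continuousOn)
    (((integrableOn_rpow_unit (r := -(degeneracyIndex τ / 2)) (by linarith)).const_mul
      C).mul_const (∫ y in Ioo (0 : ℝ) 1, ‖q y‖ ^ 2)) fun x hx => ?_
  exact hC q hq x (Ioo_subset_Ioc_self hx)

/-- `q ↦ ∫₁ˣ τ ^ (-1/2) q` is a bounded operator on `L²(0,1)`. -/
lemma exists_primitiveOp (hτ : IsDegenerateCoeff τ) :
    ∃ K : L2Unit →L[ℂ] L2Unit, ∀ q, K q =ᵐ[unitMeasure] weightedPrimitive τ q := by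
  obtain ⟨C, hC0, hC⟩ := exists_sq_norm_weightedPrimitive_le hτ
  have h2 := hτ.index_lt_two
  have hI := integrableOn_rpow_unit (r := -(degeneracyIndex τ / 2)) (by linarith)
  have hm : ∀ q : L2Unit, MemLp (weightedPrimitive τ q) 2 unitMeasure := fun q =>
    memLp_weightedPrimitive hτ (Lp.memLp q)
  let L : L2Unit →ₗ[ℂ] L2Unit :=
    { toFun := fun q => (hm q).toLp
      map_add' := fun q r => by
        refine Lp.ext ?_
        filter_upwards [(hm (q + r)).coeFn_toLp, (hm q).coeFn_toLp, (hm r).coeFn_toLp,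
          Lp.coeFn_add (hm q).toLp (hm r).toLp, ae_restrict_mem measurableSet_Ioo]
          with x h1 h2 h3 h4 hx
        rw [h1, h4, Pi.add_apply, h2, h3, weightedPrimitive, weightedPrimitive, weightedPrimitive,
          ← intervalIntegral.integral_add
            (intervalIntegrable_invSqrt_mul hτ (Lp.memLp q) (Ioo_subset_Ioc_self hx)).symm
            (intervalIntegrable_invSqrt_mul hτ (Lp.memLp r) (Ioo_subset_Ioc_self hx)).symm,
          intervalIntegral.integral_symm x 1, intervalIntegral.integral_symm x 1,
          intervalIntegral.integral_of_le hx.2.le, intervalIntegral.integral_of_le hx.2.le,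
          integral_Ioc_eq_integral_Ioo, integral_Ioc_eq_integral_Ioo]
        congr 1
        refine integral_congr_ae (ae_restrict_of_ae_restrict_of_subset
          (Ioo_subset_Ioo hx.1.le le_rfl) ?_)
        filter_upwards [Lp.coeFn_add q r] with y hy
        rw [hy, Pi.add_apply, mul_add]
      map_smul' := fun a q => by
        refine Lp.ext ?_
        filter_upwards [(hm (a • q)).coeFn_toLp, (hm q).coeFn_toLp,
          Lp.coeFn_smul a (hm q).toLp, ae_restrict_mem measurableSet_Ioo]
          with x h1 h2 h4 hx
        rw [RingHom.id_apply, h1, h4, Pi.smul_apply, h2, weightedPrimitive, weightedPrimitive,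
          ← intervalIntegral.integral_smul,
          intervalIntegral.integral_symm x 1, intervalIntegral.integral_symm x 1,
          intervalIntegral.integral_of_le hx.2.le, intervalIntegral.integral_of_le hx.2.le,
          integral_Ioc_eq_integral_Ioo, integral_Ioc_eq_integral_Ioo]
        congr 1
        refine integral_congr_ae (ae_restrict_of_ae_restrict_of_subset
          (Ioo_subset_Ioo hx.1.le le_rfl) ?_)
        filter_upwards [Lp.coeFn_smul a q] with y hy
        rw [hy, Pi.smul_apply, smul_eq_mul, smul_eq_mul]; ring }
  set I := ∫ x in Ioo (0 : ℝ) 1, x ^ (-(degeneracyIndex τ / 2))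
  have hI0 : 0 ≤ I := setIntegral_nonneg measurableSet_Ioo fun y hy => Real.rpow_nonneg hy.1.le _
  have hL : ∀ q, ‖L q‖ ≤ Real.sqrt (C * I) * ‖q‖ := fun q => by
    refine (pow_le_pow_iff_left₀ (norm_nonneg _) (by positivity) two_ne_zero).1 ?_
    rw [mul_pow, Real.sq_sqrt (by positivity), sq_norm_L2, sq_norm_L2]
    have e1 : ∫ x in Ioo (0 : ℝ) 1, ‖L q x‖ ^ 2
        = ∫ x in Ioo (0 : ℝ) 1, ‖weightedPrimitive τ q x‖ ^ 2 :=
      integral_congr_ae (by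
        filter_upwards [(hm q).coeFn_toLp] with x hx
        change ‖((hm q).toLp : L2Unit) x‖ ^ 2 = _
        rw [hx])
    rw [e1, ← integral_const_mul C, ← integral_mul_const]
    refine setIntegral_mono_on (integrable_sq_norm (hm q))
      ((hI.const_mul C).mul_const _) measurableSet_Ioo fun x hx => ?_
    exact hC q (Lp.memLp q) x (Ioo_subset_Ioc_self hx)
  exact ⟨L.mkContinuous _ hL, fun q => (hm q).coeFn_toLp⟩

/-- A Hilbert space realisation of `W¹_τ(0,1)`: `emb` is the inclusion into `L²(0,1)`, `grad` is
`u ↦ √τ uₓ`, and `trace` is `u ↦ u(1)`. -/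
structure FormSpace (τ : ℝ → ℝ) (Q : Type) [NormedAddCommGroup Q] [InnerProductSpace ℂ Q] where
  emb : Q →L[ℂ] L2Unit
  grad : Q →L[ℂ] L2Unit
  trace : Q →L[ℂ] ℂ
  coercive : ∃ c > 0, ∀ v, c * ‖v‖ ^ 2 ≤ ‖emb v‖ ^ 2 + ‖grad v‖ ^ 2
  repr : ∀ v, ∃ u, MemW τ u ∧ emb v =ᵐ[unitMeasure] u ∧
    (grad v =ᵐ[unitMeasure] fun x => (Real.sqrt (τ x) : ℂ) * deriv u x) ∧ u 1 = trace v
  grad_surj : ∀ q, ∃ v, grad v = q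
  const_mem : 1 ≤ degeneracyIndex τ →
    ∃ v, grad v = 0 ∧ emb v =ᵐ[unitMeasure] (fun _ => 1) ∧ trace v = 1

lemma memH1Weighted_primitive (hτ : IsDegenerateCoeff τ) (q : L2Unit) (b : ℂ) :
    MemH1Weighted τ (fun x => b + weightedPrimitive τ q x) ∧
    q =ᵐ[unitMeasure]
      fun x => (Real.sqrt (τ x) : ℂ) * deriv (fun x => b + weightedPrimitive τ q x) x := by
  have h : q =ᵐ[unitMeasure]
      fun x => (Real.sqrt (τ x) : ℂ) * deriv (fun x => b + weightedPrimitive τ q x) x := by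
    filter_upwards [deriv_weightedPrimitive hτ (Lp.memLp q), ae_restrict_mem measurableSet_Ioo]
      with x hx hx1
    have h2 : (Real.sqrt (τ x) : ℂ) * invSqrt τ x = 1 := by
      exact_mod_cast sqrt_mul_invSqrt hτ (Ioo_subset_Ioc_self hx1)
    rw [(hx.const_add b).deriv, ← mul_assoc, h2, one_mul]
  exact ⟨⟨(memLp_const b).add (memLp_weightedPrimitive hτ (Lp.memLp q)), fun ε hε =>
    (absCont_const b).add (locAbsCont_weightedPrimitive hτ (Lp.memLp q) ε hε),
    (Lp.memLp q).ae_eq h⟩, h⟩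

/-- The constant function `1` in `L²(0,1)`. -/
def oneL2 : L2Unit := (memLp_const (μ := unitMeasure) (1 : ℂ)).toLp

lemma oneL2_ae : oneL2 =ᵐ[unitMeasure] fun _ => (1 : ℂ) := MemLp.coeFn_toLp _

lemma norm_oneL2 : ‖oneL2‖ = 1 := by
  have h : ‖oneL2‖ ^ 2 = 1 := by
    rw [sq_norm_L2]
    have : ∫ x in Ioo (0 : ℝ) 1, ‖oneL2 x‖ ^ 2 = ∫ x in Ioo (0 : ℝ) 1, (1 : ℝ) :=
      integral_congr_ae (by filter_upwards [oneL2_ae] with x hx; rw [hx]; simp)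
    rw [this]; simp
  exact (pow_eq_one_iff_of_nonneg (norm_nonneg _) two_ne_zero).1 h

lemma weightedPrimitive_one (q : ℝ → ℂ) : weightedPrimitive τ q 1 = 0 := by
  simp [weightedPrimitive]

/-- A function is recovered from q = √τ uₓ and u(1) by u = u(1) + ∫₁ˣ τ^(-1/2) q. For m_τ ≥ 1 the
pair (q, u(1)) is free and the space is L² × ℂ. For m_τ < 1 the condition u(0) = 0 fixes u(1) = ∫₀¹
τ^(-1/2) q, and the space is L² alone. Completeness is then immediate. -/
lemma exists_formSpace (hτ : IsDegenerateCoeff τ) :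
    ∃ (Q : Type) (_ : NormedAddCommGroup Q) (_ : InnerProductSpace ℂ Q) (_ : CompleteSpace Q),
      Nonempty (FormSpace τ Q) := by
  obtain ⟨K, hK⟩ := exists_primitiveOp hτ
  have hrep : ∀ (q : L2Unit) (b : ℂ), (K q + b • oneL2 : L2Unit) =ᵐ[unitMeasure]
      fun x => b + weightedPrimitive τ q x := fun q b => by
    filter_upwards [Lp.coeFn_add (K q) (b • oneL2), Lp.coeFn_smul b oneL2, hK q, oneL2_ae]
      with x h1 h2 h3 h4
    rw [h1, Pi.add_apply, h2, Pi.smul_apply, h3, h4, smul_eq_mul, mul_one, add_comm]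
  rcases lt_or_ge (degeneracyIndex τ) 1 with h1 | h1
  · have hs := memLp_invSqrt hτ h1
    have hsae := hs.coeFn_toLp
    let l : L2Unit →L[ℂ] ℂ := innerSL ℂ hs.toLp
    have hl : ∀ q : L2Unit, l q = ∫ y in (0 : ℝ)..1, (invSqrt τ y : ℂ) * q y := fun q => by
      change inner ℂ hs.toLp q = _
      rw [L2.inner_def, intervalIntegral.integral_of_le zero_le_one, integral_Ioc_eq_integral_Ioo]
      refine integral_congr_ae ?_
      filter_upwards [hsae] with x hx
      rw [RCLike.inner_apply, hx, Complex.conj_ofReal, mul_comm]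
    refine ⟨L2Unit, inferInstance, inferInstance, inferInstance,
      ⟨⟨K + l.smulRight oneL2, ContinuousLinearMap.id ℂ _, l, ⟨1, one_pos, fun v => ?_⟩,
        fun q => ?_, fun q => ⟨q, rfl⟩, fun h => absurd h (not_le.2 h1)⟩⟩⟩
    · simp only [one_mul, ContinuousLinearMap.id_apply]
      nlinarith [sq_nonneg ‖(K + l.smulRight oneL2) v‖]
    · obtain ⟨k1, k2⟩ := memH1Weighted_primitive hτ q (l q)
      refine ⟨fun x => l q + weightedPrimitive τ q x, ⟨k1, fun _ => ?_⟩, hrep q (l q), k2,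
        by simp [weightedPrimitive_one]⟩
      have hi : IntervalIntegrable (fun y => (invSqrt τ y : ℂ) * q y) volume 0 1 := by
        rw [intervalIntegrable_iff_integrableOn_Ioo_of_le zero_le_one]
        exact hs.integrable_mul (Lp.memLp q)
      have hc := intervalIntegral.continuousOn_primitive_interval' hi right_mem_uIcc 0 left_mem_uIcc
      rw [uIcc_of_le zero_le_one] at hc
      have h2 : Tendsto (weightedPrimitive τ q) (𝓝[>] 0) (𝓝 (weightedPrimitive τ q 0)) :=
        hc.mono_left (nhdsWithin_le_of_mem (Icc_mem_nhdsGT zero_lt_one))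
      have h3 := h2.const_add (l q)
      rw [hl q, weightedPrimitive, intervalIntegral.integral_symm 0 1, add_neg_cancel] at h3
      rw [hl q]
      exact h3
  · let e1 : WithLp 2 (L2Unit × ℂ) →L[ℂ] L2Unit := WithLp.fstL 2 ℂ L2Unit ℂ
    let e2 : WithLp 2 (L2Unit × ℂ) →L[ℂ] ℂ := WithLp.sndL 2 ℂ L2Unit ℂ
    refine ⟨WithLp 2 (L2Unit × ℂ), inferInstance, inferInstance, inferInstance,
      -- The trace is controlled by solving u = Kq + u(1) for u(1): |u(1)| ≤ ‖u‖ + ‖K‖‖q‖, hence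
      -- ‖q‖² + |u(1)|² ≤ 2‖u‖² + (1 + 2‖K‖²)‖q‖².
      ⟨⟨K.comp e1 + e2.smulRight oneL2, e1, e2, ⟨(2 + 2 * ‖K‖ ^ 2)⁻¹, by positivity, fun v => ?_⟩,
        fun v => ?_, fun q => ⟨WithLp.toLp 2 (q, 0), rfl⟩, fun h => ?_⟩⟩⟩
    · have hv : ‖v‖ ^ 2 = ‖e1 v‖ ^ 2 + ‖e2 v‖ ^ 2 := WithLp.prod_norm_sq_eq_of_L2 v
      set E := (K.comp e1 + e2.smulRight oneL2) v with hE
      have hE' : e2 v • oneL2 = E - K (e1 v) := by simp [hE]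
      have hb : ‖e2 v‖ ≤ ‖E‖ + ‖K‖ * ‖e1 v‖ := by
        have := congrArg norm hE'
        rw [norm_smul, norm_oneL2, mul_one] at this
        rw [this]
        exact (norm_sub_le _ _).trans (add_le_add le_rfl (K.le_opNorm _))
      have hb2 : ‖e2 v‖ ^ 2 ≤ (‖E‖ + ‖K‖ * ‖e1 v‖) ^ 2 := by gcongr
      rw [inv_mul_le_iff₀ (by positivity), hv]
      nlinarith [sq_nonneg (‖E‖ - ‖K‖ * ‖e1 v‖), sq_nonneg (‖K‖ * ‖E‖), sq_nonneg ‖e1 v‖]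
    · obtain ⟨k1, k2⟩ := memH1Weighted_primitive hτ (e1 v) (e2 v)
      exact ⟨fun x => e2 v + weightedPrimitive τ (e1 v) x,
        ⟨k1, fun h => absurd h (not_lt.2 h1)⟩, hrep (e1 v) (e2 v), k2,
        by simp [weightedPrimitive_one]⟩
    · refine ⟨WithLp.toLp 2 (0, 1), rfl, ?_, rfl⟩
      have : (K.comp e1 + e2.smulRight oneL2) (WithLp.toLp 2 (0, 1)) = oneL2 := by
        simp [e1, e2]
      rw [this]; exact oneL2_ae

lemma integral_conj_mul_eq_inner (f g : L2Unit) :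
    inner ℂ f g = ∫ x in Ioo (0 : ℝ) 1, g x * starRingEnd ℂ (f x) := by
  rw [L2.inner_def]; rfl

/-- Regularity of weak solutions of `-(τ uₓ)ₓ = f`, `(τ uₓ)(1) = c`. -/
lemma FormSpace.strong_form {Q : Type} [NormedAddCommGroup Q] [InnerProductSpace ℂ Q]
    (Φ : FormSpace τ Q) (hτ : IsDegenerateCoeff τ) {v : Q} {f : L2Unit} {c : ℂ}
    (h : ∀ t, inner ℂ (Φ.grad t) (Φ.grad v)
      = inner ℂ (Φ.emb t) f + starRingEnd ℂ (Φ.trace t) * c) :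
    ∃ u w, MemW τ u ∧ MemH2Weighted τ u w ∧ Φ.emb v =ᵐ[unitMeasure] u ∧ u 1 = Φ.trace v ∧
      (∀ᵐ x ∂unitMeasure, deriv w x = -f x) ∧ w 1 = c := by
  have hfi : IntervalIntegrable f volume 0 1 := by
    rw [intervalIntegrable_iff_integrableOn_Ioo_of_le zero_le_one]
    exact (Lp.memLp f).integrable one_le_two
  -- The flux is written down first, as the primitive with the right derivative and end value, and
  -- only afterwards identified with τuₓ.
  set w : ℝ → ℂ := fun x => c - ∫ y in (1 : ℝ)..x, f y with hw
  have hwd : ∀ᵐ x ∂unitMeasure, deriv w x = -f x := by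
    rw [ae_restrict_iff' measurableSet_Ioo]
    filter_upwards [hfi.ae_hasDerivAt_integral] with x hx hm
    refine ((hx ?_ 1 right_mem_uIcc).const_sub c).deriv
    rw [uIcc_of_le zero_le_one]; exact Ioo_subset_Icc_self hm
  have hw1 : w 1 = c := by simp [hw]
  have hwH : MemH1 w := by
    refine ⟨(absCont_const c).sub (absCont_primitive hfi right_mem_uIcc), ?_⟩
    refine (Lp.memLp f).neg.ae_eq ?_
    filter_upwards [hwd] with x hx
    rw [hx]; rfl
  -- Testing the weak equation with the constant 1 gives 0 = ∫ f + c, which is w(0).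
  have hw0 : 1 ≤ degeneracyIndex τ → w 0 = 0 := by
    intro h1
    obtain ⟨t, t1, t2, t3⟩ := Φ.const_mem h1
    have h2 := h t
    rw [t1, t3, inner_zero_left, map_one, one_mul, integral_conj_mul_eq_inner] at h2
    have h3 : ∫ x in Ioo (0 : ℝ) 1, f x * starRingEnd ℂ (Φ.emb t x)
        = ∫ x in Ioo (0 : ℝ) 1, f x := integral_congr_ae (by
      filter_upwards [t2] with x hx
      rw [hx, map_one, mul_one])
    rw [h3] at h2
    simp only [hw]
    rw [intervalIntegral.integral_symm, intervalIntegral.integral_of_le zero_le_one,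
      integral_Ioc_eq_integral_Ioo, sub_neg_eq_add, add_comm]
    exact h2.symm
  have hsw := hwH.memLp_invSqrt_mul hτ hw0
  -- Green's formula for the candidate w and the weak equation for v agree on every test gradient,
  -- and the gradients fill L². So √τ uₓ = τ^(-1/2) w.
  have hgrad : Φ.grad v = hsw.toLp := by
    refine ext_inner_left ℂ fun q => ?_
    obtain ⟨t, rfl⟩ := Φ.grad_surj q
    obtain ⟨ut, t1, t2, t3, t4⟩ := Φ.repr t
    have hg := green hτ t1 hwH hw0
    rw [h t, integral_conj_mul_eq_inner, integral_conj_mul_eq_inner]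
    have e1 : ∫ x in Ioo (0 : ℝ) 1, deriv w x * starRingEnd ℂ (ut x)
        = -∫ x in Ioo (0 : ℝ) 1, f x * starRingEnd ℂ (Φ.emb t x) := by
      rw [← integral_neg]
      refine integral_congr_ae ?_
      filter_upwards [hwd, t2] with x h1 h2
      rw [h1, h2, neg_mul]
    have e2 : ∫ x in Ioo (0 : ℝ) 1, w x * starRingEnd ℂ (deriv ut x)
        = ∫ x in Ioo (0 : ℝ) 1, (hsw.toLp : L2Unit) x * starRingEnd ℂ (Φ.grad t x) := by
      refine integral_congr_ae ?_
      filter_upwards [t3, hsw.coeFn_toLp, ae_restrict_mem measurableSet_Ioo] with x h1 h2 hx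
      have h4 : (Real.sqrt (τ x) : ℂ) * invSqrt τ x = 1 := by
        exact_mod_cast sqrt_mul_invSqrt hτ (Ioo_subset_Ioc_self hx)
      rw [h1, h2, map_mul, Complex.conj_ofReal]
      linear_combination -(w x * starRingEnd ℂ (deriv ut x)) * h4
    rw [e1, e2, hw1, t4] at hg
    rw [← sub_eq_zero]
    linear_combination -hg
  obtain ⟨u, u1, u2, u3, u4⟩ := Φ.repr v
  refine ⟨u, w, u1, ⟨u1.memH1, ?_, hwH⟩, u2, u4, hwd, hw1⟩
  rw [hgrad] at u3
  filter_upwards [u3, hsw.coeFn_toLp, ae_restrict_mem measurableSet_Ioo] with x h1 h2 hx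
  have hx' := Ioo_subset_Ioc_self hx
  have h4 : (Real.sqrt (τ x) : ℂ) * invSqrt τ x = 1 := by
    exact_mod_cast sqrt_mul_invSqrt hτ hx'
  have h5 : (Real.sqrt (τ x) : ℂ) * Real.sqrt (τ x) = τ x := by
    exact_mod_cast Real.mul_self_sqrt (hτ.pos x hx').le
  have h6 := h2.symm.trans h1
  calc w x = (Real.sqrt (τ x) * invSqrt τ x) * w x := by rw [h4, one_mul]
    _ = Real.sqrt (τ x) * (invSqrt τ x * w x) := by ring
    _ = _ := by rw [h6, ← mul_assoc, h5]

end Form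

/-! ### The memory variable -/

section Memory

variable (p : DampingParams)

lemma DampingParams.eta_nonneg (ξ : ℝ) : 0 ≤ p.eta ξ := Real.rpow_nonneg (abs_nonneg _) _

lemma DampingParams.eta_sq (ξ : ℝ) : p.eta ξ ^ 2 = |ξ| ^ (2 * p.order - 1) := by
  rw [DampingParams.eta, ← Real.rpow_natCast, ← Real.rpow_mul (abs_nonneg _)]
  congr 1; push_cast; ring

lemma DampingParams.measurable_eta : Measurable p.eta :=
  (measurable_id.abs).pow_const _

lemma integrable_of_comp_abs {f : ℝ → ℝ} (h : IntegrableOn (fun x => f |x|) (Ioi 0)) :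
    Integrable (fun x => f |x|) := by
  have int_Iic : IntegrableOn (fun x ↦ f |x|) (Iic 0) := by
    rw [← Measure.map_neg_eq_self (volume : Measure ℝ)]
    let m : MeasurableEmbedding fun x : ℝ => -x := (Homeomorph.neg ℝ).measurableEmbedding
    rw [m.integrableOn_map_iff]
    simp_rw [Function.comp_def, abs_neg, neg_preimage, neg_Iic, neg_zero]
    exact Iff.mpr integrableOn_Ici_iff_integrableOn_Ioi h
  rw [← integrableOn_univ, ← Iic_union_Ioi (a := (0 : ℝ))]
  exact int_Iic.union h

/-- The integrand behaves like |ξ|^(2α̃-1) near 0 and like |ξ|^(2α̃-3) at infinity; both are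
integrable exactly because 0 < α̃ < 1. -/
lemma DampingParams.integrable_eta_sq :
    Integrable (fun ξ : ℝ => p.eta ξ ^ 2 / (1 + ξ ^ 2)) := by
  have h0 := p.order_pos
  have h1 := p.order_lt_one
  have h : Integrable (fun ξ : ℝ => (fun y : ℝ => y ^ (2 * p.order - 1) / (1 + y ^ 2)) |ξ|) := by
    refine integrable_of_comp_abs (f := fun y : ℝ => y ^ (2 * p.order - 1) / (1 + y ^ 2)) ?_
    have hm : Measurable (fun ξ : ℝ => |ξ| ^ (2 * p.order - 1) / (1 + |ξ| ^ 2)) := by fun_prop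
    rw [← Ioc_union_Ioi_eq_Ioi (zero_le_one (α := ℝ))]
    refine IntegrableOn.union ?_ ?_
    · rw [integrableOn_Ioc_iff_integrableOn_Ioo]
      refine Integrable.mono' (integrableOn_rpow_unit (r := 2 * p.order - 1) (by linarith))
        hm.aestronglyMeasurable ?_
      filter_upwards [ae_restrict_mem measurableSet_Ioo] with x hx
      rw [abs_of_pos hx.1, Real.norm_of_nonneg (by have := hx.1; positivity)]
      exact div_le_self (Real.rpow_nonneg hx.1.le _) (by nlinarith)
    · refine Integrable.mono' (integrableOn_Ioi_rpow_of_lt (a := 2 * p.order - 3) (by linarith)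
        one_pos) hm.aestronglyMeasurable ?_
      filter_upwards [ae_restrict_mem measurableSet_Ioi] with x hx
      have hx0 : 0 < x := one_pos.trans hx
      rw [abs_of_pos hx0, Real.norm_of_nonneg (by positivity)]
      have e : x ^ (2 * p.order - 1) = x ^ (2 * p.order - 3) * x ^ 2 := by
        rw [← Real.rpow_natCast, ← Real.rpow_add hx0]; congr 1; push_cast; ring
      rw [div_le_iff₀ (by positivity), e]
      have := Real.rpow_nonneg hx0.le (2 * p.order - 3)
      nlinarith
  refine h.congr (Eventually.of_forall fun ξ => ?_)
  simp only [p.eta_sq, sq_abs]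

/-- The symbol `λ + ξ² + ℘`. -/
def memorySymbol (z : ℂ) (ξ : ℝ) : ℂ := z + ((ξ : ℂ) ^ 2 + p.wp)

/-- `z + ξ² + ℘` stays away from `0` uniformly in `ξ`. -/
def SymbolBound (z : ℂ) (c : ℝ) : Prop := ∀ ξ : ℝ, c * (1 + ξ ^ 2) ≤ ‖memorySymbol p z ξ‖

/-- The quadratic growth comes for free: with σ the symbol, ξ² ≤ |σ| + |z|, and the constant |z| + 1
is at most ((|z| + 1)/δ)|σ|. -/
lemma symbolBound_of_le {z : ℂ} {δ : ℝ} (hδ : 0 < δ) (h : ∀ ξ, δ ≤ ‖memorySymbol p z ξ‖) :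
    SymbolBound p z (1 + (‖z‖ + 1) / δ)⁻¹ := by
  intro ξ
  have h1 := h ξ
  have h2 : ξ ^ 2 ≤ ‖memorySymbol p z ξ‖ + ‖z‖ := by
    have e : ((ξ ^ 2 + p.wp : ℝ) : ℂ) = memorySymbol p z ξ - z := by
      simp [memorySymbol]
    have e2 := congrArg norm e
    rw [Complex.norm_real, Real.norm_of_nonneg (by have := p.wp_nonneg; positivity)] at e2
    have := norm_sub_le (memorySymbol p z ξ) z
    linarith [p.wp_nonneg]
  have h3 : ‖z‖ + 1 ≤ (‖z‖ + 1) / δ * ‖memorySymbol p z ξ‖ := by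
    rw [div_mul_eq_mul_div, le_div_iff₀ hδ]
    gcongr
  rw [inv_mul_le_iff₀ (by positivity)]
  linarith

lemma symbolBound_of_re_pos {z : ℂ} (hz : 0 < z.re) : ∃ c > 0, SymbolBound p z c :=
  ⟨_, by positivity, symbolBound_of_le p hz fun ξ => by
    refine le_trans ?_ (Complex.re_le_norm _)
    have e : (memorySymbol p z ξ).re = z.re + (ξ ^ 2 + p.wp) := by
      simp [memorySymbol, ← Complex.ofReal_pow]
    rw [e]
    have := p.wp_nonneg
    have := sq_nonneg ξ
    linarith⟩

lemma memorySymbol_im (z : ℂ) (ξ : ℝ) : (memorySymbol p z ξ).im = z.im := by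
  simp [memorySymbol, ← Complex.ofReal_pow]

lemma symbolBound_of_im_ne_zero {z : ℂ} (hz : z.im ≠ 0) : ∃ c > 0, SymbolBound p z c :=
  ⟨_, by positivity, symbolBound_of_le p (abs_pos.2 hz) fun ξ => by
    rw [← memorySymbol_im p z ξ]; exact Complex.abs_im_le_norm _⟩

variable {p}

lemma SymbolBound.pos {z : ℂ} {c : ℝ} (hc : 0 < c) (h : SymbolBound p z c) (ξ : ℝ) :
    0 < ‖memorySymbol p z ξ‖ := lt_of_lt_of_le (by positivity) (h ξ)

lemma SymbolBound.ne_zero {z : ℂ} {c : ℝ} (hc : 0 < c) (h : SymbolBound p z c) (ξ : ℝ) :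
    memorySymbol p z ξ ≠ 0 := norm_pos_iff.1 (h.pos hc ξ)

lemma measurable_memorySymbol (z : ℂ) : Measurable (memorySymbol p z) := by
  unfold memorySymbol; fun_prop

lemma measurable_eta_complex : Measurable (fun ξ => (p.eta ξ : ℂ)) :=
  Complex.measurable_ofReal.comp p.measurable_eta

lemma memLp_of_sq_le {f : ℝ → ℂ} {g : ℝ → ℝ} (hf : AEStronglyMeasurable f volume)
    (hg : Integrable g) (h : ∀ x, ‖f x‖ ^ 2 ≤ g x) : MemLp f 2 volume := by
  rw [memLp_two_iff_integrable_sq_norm hf]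
  refine Integrable.mono' hg (hf.norm.pow 2) (Eventually.of_forall fun x => ?_)
  rw [Real.norm_of_nonneg (by positivity)]
  exact h x

lemma SymbolBound.memLp_eta_div {z : ℂ} {c : ℝ} (hc : 0 < c) (h : SymbolBound p z c) :
    MemLp (fun ξ => (p.eta ξ : ℂ) / memorySymbol p z ξ) 2 volume := by
  refine memLp_of_sq_le (measurable_eta_complex.div
    (measurable_memorySymbol z)).aestronglyMeasurable
    (p.integrable_eta_sq.const_mul (c ^ 2)⁻¹) fun ξ => ?_
  rw [norm_div, div_pow, Complex.norm_real, Real.norm_eq_abs, sq_abs]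
  have h1 := h ξ
  have h2 : (c * (1 + ξ ^ 2)) ^ 2 ≤ ‖memorySymbol p z ξ‖ ^ 2 := by gcongr
  have h3 : c ^ 2 * (1 + ξ ^ 2) ≤ ‖memorySymbol p z ξ‖ ^ 2 := by
    refine le_trans ?_ h2
    rw [mul_pow]
    have : 0 ≤ ξ ^ 2 := sq_nonneg ξ
    gcongr
    nlinarith
  rw [inv_mul_eq_div, div_div, mul_comm (1 + ξ ^ 2)]
  gcongr

lemma SymbolBound.memLp_abs_eta_div {z : ℂ} {c : ℝ} (hc : 0 < c) (h : SymbolBound p z c) :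
    MemLp (fun ξ : ℝ => ((|ξ| : ℝ) : ℂ) * ((p.eta ξ : ℂ) / memorySymbol p z ξ)) 2 volume := by
  refine memLp_of_sq_le ((Complex.measurable_ofReal.comp measurable_abs).mul
    (measurable_eta_complex.div
    (measurable_memorySymbol z))).aestronglyMeasurable
    (p.integrable_eta_sq.const_mul (c ^ 2)⁻¹) fun ξ => ?_
  rw [norm_mul, norm_div, mul_pow, div_pow, Complex.norm_real, Complex.norm_real, Real.norm_eq_abs,
    Real.norm_eq_abs, sq_abs, sq_abs, sq_abs]
  have h1 := h ξ
  have h2 : (c * (1 + ξ ^ 2)) ^ 2 ≤ ‖memorySymbol p z ξ‖ ^ 2 := by gcongr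
  calc ξ ^ 2 * (p.eta ξ ^ 2 / ‖memorySymbol p z ξ‖ ^ 2)
      ≤ (1 + ξ ^ 2) * (p.eta ξ ^ 2 / (c * (1 + ξ ^ 2)) ^ 2) := by
        gcongr
        linarith
    _ = _ := by field_simp

lemma SymbolBound.integrable_eta_sq_div {z : ℂ} {c : ℝ} (hc : 0 < c) (h : SymbolBound p z c) :
    Integrable (fun ξ => (p.eta ξ : ℂ) ^ 2 / memorySymbol p z ξ) := by
  refine Integrable.mono' (p.integrable_eta_sq.const_mul c⁻¹) ((measurable_eta_complex.pow_const
    2).div (measurable_memorySymbol z)).aestronglyMeasurable (Eventually.of_forall fun ξ => ?_)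
  rw [norm_div, norm_pow, Complex.norm_real, Real.norm_eq_abs, sq_abs, inv_mul_eq_div, div_div,
    mul_comm (1 + ξ ^ 2)]
  have h1 := h ξ
  gcongr

lemma SymbolBound.memLp_div {z : ℂ} {c : ℝ} (hc : 0 < c) (h : SymbolBound p z c) {f : ℝ → ℂ}
    (hf : MemLp f 2 volume) : MemLp (fun ξ => f ξ / memorySymbol p z ξ) 2 volume := by
  refine hf.of_le_mul (c := c⁻¹)
    (hf.1.mul (measurable_memorySymbol z).inv.aestronglyMeasurable) (Eventually.of_forall fun ξ => ?_)
  rw [norm_div, inv_mul_eq_div]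
  have h1 := h ξ
  have : c ≤ ‖memorySymbol p z ξ‖ := by nlinarith [sq_nonneg ξ]
  gcongr

lemma SymbolBound.memLp_abs_div {z : ℂ} {c : ℝ} (hc : 0 < c) (h : SymbolBound p z c) {f : ℝ → ℂ}
    (hf : MemLp f 2 volume) :
    MemLp (fun ξ : ℝ => ((|ξ| : ℝ) : ℂ) * (f ξ / memorySymbol p z ξ)) 2 volume := by
  refine hf.of_le_mul (c := c⁻¹)
    ((Complex.measurable_ofReal.comp measurable_abs).aestronglyMeasurable.mul
      (hf.1.mul (measurable_memorySymbol z).inv.aestronglyMeasurable))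
    (Eventually.of_forall fun ξ => ?_)
  rw [norm_mul, norm_div, inv_mul_eq_div, Complex.norm_real, Real.norm_eq_abs, abs_abs]
  have h1 := h ξ
  have h2 : c * |ξ| ≤ ‖memorySymbol p z ξ‖ := by
    nlinarith [sq_abs ξ, sq_nonneg (|ξ| - 1), sq_nonneg (|ξ|)]
  rw [mul_div_assoc', div_le_div_iff₀ (h.pos hc ξ) hc]
  nlinarith [norm_nonneg (f ξ)]

/-! ### The transfer function of the damping. -/

variable (p) in
/-- `G(z) = ζ ∫ η² / (z + ξ² + ℘) dξ`. -/
def transferFun (z : ℂ) : ℂ := p.zeta * ∫ ξ, (p.eta ξ : ℂ) ^ 2 / memorySymbol p z ξ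

variable (p) in
/-- `ζ ∫ η f / (z + ξ² + ℘) dξ`. -/
def memoryInput (z : ℂ) (f : ℝ → ℂ) : ℂ := p.zeta * ∫ ξ, (p.eta ξ : ℂ) * (f ξ / memorySymbol p z ξ)

lemma SymbolBound.integrable_eta_mul {z : ℂ} {c : ℝ} (hc : 0 < c) (h : SymbolBound p z c)
    {f : ℝ → ℂ} (hf : MemLp f 2 volume) :
    Integrable (fun ξ => (p.eta ξ : ℂ) * (f ξ / memorySymbol p z ξ)) := by
  refine ((h.memLp_eta_div hc).integrable_mul hf).congr (Eventually.of_forall fun ξ => ?_)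
  simp only [Pi.mul_apply]; ring

/-- After elimination of ϑ the boundary coupling ζ ∫ ηϑ is affine in the trace b, with slope G(z).
-/
lemma SymbolBound.integrable_eta_solution {z : ℂ} {c : ℝ} (hc : 0 < c) (h : SymbolBound p z c)
    {f : ℝ → ℂ} (hf : MemLp f 2 volume) (b : ℂ) :
    Integrable (fun ξ => (p.eta ξ : ℂ) * ((f ξ + p.eta ξ * b) / memorySymbol p z ξ)) ∧
    p.zeta * ∫ ξ, (p.eta ξ : ℂ) * ((f ξ + p.eta ξ * b) / memorySymbol p z ξ)
      = memoryInput p z f + transferFun p z * b := by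
  have h1 := h.integrable_eta_mul hc hf
  have h2 := (h.integrable_eta_sq_div hc).mul_const b
  have e : (fun ξ => (p.eta ξ : ℂ) * (f ξ / memorySymbol p z ξ)
      + (p.eta ξ : ℂ) ^ 2 / memorySymbol p z ξ * b)
      = fun ξ => (p.eta ξ : ℂ) * ((f ξ + p.eta ξ * b) / memorySymbol p z ξ) := by
    funext ξ; ring
  rw [← e]
  refine ⟨h1.add h2, ?_⟩
  rw [integral_add h1 h2, integral_mul_const, memoryInput, transferFun]
  ring

/-- For real `r > 0` the transfer function is a nonnegative real number. -/
lemma transferFun_ofReal {r : ℝ} (hr : 0 < r) : ∃ g : ℝ, 0 ≤ g ∧ transferFun p r = g := by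
  refine ⟨p.zeta * ∫ ξ, p.eta ξ ^ 2 / (r + (ξ ^ 2 + p.wp)), ?_, ?_⟩
  · have := p.wp_nonneg
    have := p.zeta_pos.le
    exact mul_nonneg this (integral_nonneg fun ξ => by
      change 0 ≤ p.eta ξ ^ 2 / (r + (ξ ^ 2 + p.wp)); positivity)
  · rw [transferFun, Complex.ofReal_mul, ← integral_complex_ofReal]
    congr 1
    refine integral_congr_ae (Eventually.of_forall fun ξ => ?_)
    simp [memorySymbol]

lemma integrable_scaled {κ : ℝ} (hκ : 0 < κ) :
    Integrable (fun ξ : ℝ => p.eta ξ ^ 2 / (κ + ξ ^ 2)) := by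
  refine Integrable.mono' (p.integrable_eta_sq.const_mul (min κ 1)⁻¹)
    ((p.measurable_eta.pow_const 2).div (by fun_prop)).aestronglyMeasurable
    (Eventually.of_forall fun ξ => ?_)
  have hm : 0 < min κ 1 := lt_min hκ one_pos
  rw [Real.norm_of_nonneg (by positivity), inv_mul_eq_div, div_div]
  gcongr
  nlinarith [min_le_left κ 1, min_le_right κ 1, sq_nonneg ξ]

/-- Substitute ξ = √κ s: η² dξ contributes κ^α̃ and the denominator κ⁻¹. This power is the source of
the exponent 1 - α̃ in the resolvent growth. -/
lemma integral_scaled {κ : ℝ} (hκ : 0 < κ) :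
    ∫ ξ : ℝ, p.eta ξ ^ 2 / (κ + ξ ^ 2)
      = κ ^ (p.order - 1) * ∫ ξ : ℝ, p.eta ξ ^ 2 / (1 + ξ ^ 2) := by
  have h := Measure.integral_comp_mul_left (fun ξ : ℝ => p.eta ξ ^ 2 / (1 + ξ ^ 2))
    ((Real.sqrt κ)⁻¹)
  have hs : 0 < Real.sqrt κ := Real.sqrt_pos.2 hκ
  have hs2 : Real.sqrt κ ^ 2 = κ := Real.sq_sqrt hκ.le
  have e : ∀ ξ : ℝ, p.eta ξ ^ 2 / (κ + ξ ^ 2)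
      = κ ^ (p.order - 1) * (Real.sqrt κ)⁻¹ *
        (p.eta ((Real.sqrt κ)⁻¹ * ξ) ^ 2 / (1 + ((Real.sqrt κ)⁻¹ * ξ) ^ 2)) := by
    intro ξ
    rw [p.eta_sq, p.eta_sq, abs_mul, abs_of_pos (inv_pos.2 hs),
      Real.mul_rpow (inv_pos.2 hs).le (abs_nonneg _), Real.inv_rpow hs.le]
    have e1 : Real.sqrt κ ^ (2 * p.order - 1) * Real.sqrt κ = κ ^ (p.order - 1) * κ := by
      rw [Real.sqrt_eq_rpow, ← Real.rpow_mul hκ.le, ← Real.rpow_add hκ, ← Real.rpow_add_one hκ.ne']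
      congr 1; ring
    have h3 : 0 < Real.sqrt κ ^ (2 * p.order - 1) := Real.rpow_pos_of_pos hs _
    have h4 : (1 + ((Real.sqrt κ)⁻¹ * ξ) ^ 2) = (κ + ξ ^ 2) / κ := by
      rw [mul_pow, inv_pow, hs2]; field_simp
    rw [h4]
    have h5 : 0 < κ + ξ ^ 2 := by positivity
    have h6 : (Real.sqrt κ)⁻¹ * (Real.sqrt κ ^ (2 * p.order - 1))⁻¹ * (κ ^ (p.order - 1) * κ) = 1 := by
      rw [← e1]; field_simp
    rw [div_div_eq_mul_div]
    calc _ = (Real.sqrt κ)⁻¹ * (Real.sqrt κ ^ (2 * p.order - 1))⁻¹ * (κ ^ (p.order - 1) * κ) *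
          (|ξ| ^ (2 * p.order - 1) / (κ + ξ ^ 2)) := by rw [h6, one_mul]
      _ = _ := by ring
  simp_rw [e]
  rw [integral_const_mul, h, inv_inv, abs_of_pos hs, smul_eq_mul]
  field_simp

/-- Decay of the transfer function near the negative imaginary axis. -/
lemma exists_norm_transferFun_le (p : DampingParams) :
    ∃ C > 0, ∀ Y : ℝ, 4 ≤ Y → ∀ h : ℂ, ‖h‖ ≤ 1 →
      ‖transferFun p (-Complex.I * (Y + h))‖ ≤ C * Y ^ (p.order - 1) := by
  set I := ∫ ξ : ℝ, p.eta ξ ^ 2 / (1 + ξ ^ 2) with hI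
  have hI0 : 0 ≤ I := integral_nonneg fun ξ => by
    change 0 ≤ p.eta ξ ^ 2 / (1 + ξ ^ 2); positivity
  refine ⟨p.zeta * (4 * I) + 1, by have := p.zeta_pos; positivity, fun Y hY h hh => ?_⟩
  have hY0 : 0 < Y := by linarith
  -- The imaginary part has size at least Y - 1 and the real part is at least ξ² - 1. Their average
  -- exceeds (Y + ξ²)/4 as soon as Y ≥ 4.
  have hd : ∀ ξ : ℝ, (Y + ξ ^ 2) / 4 ≤ ‖memorySymbol p (-Complex.I * (Y + h)) ξ‖ := by
    intro ξ
    have e1 : (memorySymbol p (-Complex.I * (Y + h)) ξ).im = -(Y + h.re) := by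
      rw [memorySymbol_im]; simp
    have e2 : (memorySymbol p (-Complex.I * (Y + h)) ξ).re = h.im + (ξ ^ 2 + p.wp) := by
      simp [memorySymbol, ← Complex.ofReal_pow]
    have h1 := Complex.abs_im_le_norm (memorySymbol p (-Complex.I * (Y + h)) ξ)
    have h2 := Complex.re_le_norm (memorySymbol p (-Complex.I * (Y + h)) ξ)
    rw [e1, abs_neg] at h1
    rw [e2] at h2
    have h3 := (Complex.abs_re_le_norm h).trans hh
    have h4 := (Complex.abs_im_le_norm h).trans hh
    have h5 := le_abs_self (Y + h.re)
    rw [abs_le] at h3 h4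
    linarith [p.wp_nonneg]
  have hn : ‖∫ ξ, (p.eta ξ : ℂ) ^ 2 / memorySymbol p (-Complex.I * (Y + h)) ξ‖
      ≤ ∫ ξ : ℝ, 4 * (p.eta ξ ^ 2 / (Y + ξ ^ 2)) := by
    refine norm_integral_le_of_norm_le ((integrable_scaled hY0).const_mul 4)
      (Eventually.of_forall fun ξ => ?_)
    rw [norm_div, norm_pow, Complex.norm_real, Real.norm_eq_abs, sq_abs]
    have := hd ξ
    calc p.eta ξ ^ 2 / ‖memorySymbol p (-Complex.I * (Y + h)) ξ‖
        ≤ p.eta ξ ^ 2 / ((Y + ξ ^ 2) / 4) := by gcongr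
      _ = _ := by field_simp
  rw [integral_const_mul, integral_scaled hY0, ← hI] at hn
  rw [transferFun, norm_mul, Complex.norm_real, Real.norm_of_nonneg p.zeta_pos.le]
  have h6 := Real.rpow_nonneg hY0.le (p.order - 1)
  have h7 := p.zeta_pos.le
  calc _ ≤ p.zeta * (4 * (Y ^ (p.order - 1) * I)) := by gcongr
    _ ≤ _ := by nlinarith

/-- The transfer function is holomorphic off the real axis. -/
lemma differentiableAt_transferFun {z : ℂ} (hz : z.im ≠ 0) :
    DifferentiableAt ℂ (transferFun p) z := by
  -- The disc of radius |Im z|/2 stays away from the real axis, so one symbol bound holds on all of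
  -- it and dominates the differentiated integrand.
  set δ := |z.im| / 2 with hδ
  have hδ0 : 0 < δ := by have := abs_pos.2 hz; positivity
  set c := (1 + (‖z‖ + δ + 1) / δ)⁻¹ with hc
  have hc0 : 0 < c := by positivity
  have hb : ∀ x ∈ Metric.ball z δ, SymbolBound p x c := by
    intro x hx
    have hx' : ‖x - z‖ < δ := by rwa [Metric.mem_ball, dist_eq_norm] at hx
    have h1 : ∀ ξ, δ ≤ ‖memorySymbol p x ξ‖ := fun ξ => by
      refine le_trans ?_ (Complex.abs_im_le_norm _)
      rw [memorySymbol_im]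
      have h2 := (Complex.abs_im_le_norm (x - z)).trans hx'.le
      rw [Complex.sub_im] at h2
      have h3 := abs_sub_abs_le_abs_sub z.im x.im
      rw [abs_sub_comm] at h3
      linarith
    intro ξ
    refine le_trans ?_ (symbolBound_of_le p hδ0 h1 ξ)
    have h4 : ‖x‖ ≤ ‖z‖ + δ := by
      have := norm_add_le (x - z) z
      rw [sub_add_cancel] at this
      linarith
    rw [hc]
    gcongr
  have key := hasDerivAt_integral_of_dominated_loc_of_deriv_le (μ := volume) (𝕜 := ℂ)
    (F := fun x ξ => (p.eta ξ : ℂ) ^ 2 / memorySymbol p x ξ)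
    (F' := fun x ξ => -((p.eta ξ : ℂ) ^ 2) / memorySymbol p x ξ ^ 2)
    (bound := fun ξ => (c ^ 2)⁻¹ * (p.eta ξ ^ 2 / (1 + ξ ^ 2))) (x₀ := z)
    (Metric.ball_mem_nhds z hδ0)
    (Eventually.of_forall fun x => ((measurable_eta_complex.pow_const
      2).div (measurable_memorySymbol x)).aestronglyMeasurable)
    ((hb z (Metric.mem_ball_self hδ0)).integrable_eta_sq_div hc0)
    ((measurable_eta_complex.pow_const 2).neg.div
      ((measurable_memorySymbol z).pow_const 2)).aestronglyMeasurable
    (Eventually.of_forall fun ξ x hx => ?_)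
    (p.integrable_eta_sq.const_mul _)
    (Eventually.of_forall fun ξ x hx => ?_)
  · exact (key.2.const_mul (p.zeta : ℂ)).differentiableAt
  · rw [norm_div, norm_neg, norm_pow, norm_pow, Complex.norm_real, Real.norm_eq_abs, sq_abs,
      inv_mul_eq_div, div_div, mul_comm (1 + ξ ^ 2)]
    have h1 := hb x hx ξ
    have h2 : (c * (1 + ξ ^ 2)) ^ 2 ≤ ‖memorySymbol p x ξ‖ ^ 2 := by gcongr
    have h3 : c ^ 2 * (1 + ξ ^ 2) ≤ ‖memorySymbol p x ξ‖ ^ 2 := by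
      refine le_trans ?_ h2
      rw [mul_pow]
      have : 0 ≤ ξ ^ 2 := sq_nonneg ξ
      gcongr
      nlinarith
    gcongr
  · have hne := (hb x hx).ne_zero hc0 ξ
    have h1 : HasDerivAt (fun x => memorySymbol p x ξ) 1 x := (hasDerivAt_id x).add_const _
    have h2 := (hasDerivAt_const x ((p.eta ξ : ℂ) ^ 2)).div h1 hne
    exact h2.congr_deriv (by simp)

end Memory

/-! ### The system operator is maximal dissipative -/

section System

variable {τ : ℝ → ℝ} {p : DampingParams} {U V : StateSpace p} {u w : ℝ → ℂ}

lemma zeta_ne_zero (p : DampingParams) : ENNReal.ofReal p.zeta ≠ 0 := by simpa using p.zeta_pos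

lemma volume_le_weightMeasure (p : DampingParams) :
    volume = (ENNReal.ofReal p.zeta)⁻¹ • p.weightMeasure := by
  rw [DampingParams.weightMeasure, smul_smul, ENNReal.inv_mul_cancel (zeta_ne_zero p)
    ENNReal.ofReal_ne_top, one_smul]

lemma memLp_volume_of_weight {f : ℝ → ℂ} (h : MemLp f 2 p.weightMeasure) : MemLp f 2 volume := by
  rw [volume_le_weightMeasure p]
  exact h.smul_measure (ENNReal.inv_ne_top.2 (zeta_ne_zero p))

lemma memLp_weight_of_volume {f : ℝ → ℂ} (h : MemLp f 2 volume) : MemLp f 2 p.weightMeasure :=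
  h.smul_measure ENNReal.ofReal_ne_top

lemma memLp_snd (U : StateSpace p) : MemLp U.snd 2 volume :=
  memLp_volume_of_weight (Lp.memLp U.snd)

/-- The state with given components. -/
def mkState {f : ℝ → ℂ} (ψ : L2Unit) (hf : MemLp f 2 volume) : StateSpace p :=
  WithLp.toLp 2 (ψ, (memLp_weight_of_volume hf).toLp)

lemma mkState_snd {f : ℝ → ℂ} (ψ : L2Unit) (hf : MemLp f 2 volume) :
    ∀ᵐ ξ, (mkState (p := p) ψ hf).snd ξ = f ξ :=
  p.ae_iff.1 (MemLp.coeFn_toLp (memLp_weight_of_volume hf))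

lemma inner_eq (U V : StateSpace p) :
    inner ℂ U V = (∫ x in Ioo (0 : ℝ) 1, V.fst x * starRingEnd ℂ (U.fst x))
      + p.zeta * ∫ ξ, V.snd ξ * starRingEnd ℂ (U.snd ξ) := by
  have h1 : inner ℂ U.snd V.snd = p.zeta * ∫ ξ, V.snd ξ * starRingEnd ℂ (U.snd ξ) := by
    rw [L2.inner_def, integral_smul_measure, ENNReal.toReal_ofReal p.zeta_pos.le]
    rfl
  rw [← h1, ← integral_conj_mul_eq_inner]
  rfl

lemma IsImage.snd_eq_volume (h : IsImage τ p U V u w) :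
    ∀ᵐ ξ, V.snd ξ = memoryField p U.snd (u 1) ξ := p.ae_iff.1 h.snd_eq

lemma InDomain.integral_flux_mul (h : InDomain τ p U u w) :
    ∃ E : ℝ, ∫ x in Ioo (0 : ℝ) 1, w x * starRingEnd ℂ (deriv u x) = E := by
  refine ⟨∫ x in Ioo (0 : ℝ) 1, τ x * ‖deriv u x‖ ^ 2, ?_⟩
  rw [← integral_complex_ofReal]
  refine integral_congr_ae ?_
  filter_upwards [h.memH2.flux_eq] with x hx
  rw [hx, mul_assoc, Complex.mul_conj, Complex.normSq_eq_norm_sq]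
  push_cast; ring

/-- The energy identity. -/
lemma IsImage.re_inner (hτ : IsDegenerateCoeff τ) (h : IsImage τ p U V u w) :
    (inner ℂ U V).re = -(p.zeta * ∫ ξ, (ξ ^ 2 + p.wp) * ‖U.snd ξ‖ ^ 2) := by
  have hd := h.inDomain
  obtain ⟨E, hE⟩ := hd.integral_flux_mul
  have hg := green hτ hd.memW hd.memH2.flux_memH1 (hd.memH2.flux_zero hτ)
  rw [hE] at hg
  have h1 : ∫ x in Ioo (0 : ℝ) 1, V.fst x * starRingEnd ℂ (U.fst x)
      = Complex.I * (w 1 * starRingEnd ℂ (u 1) - E) := by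
    rw [← hg, add_sub_cancel_right, ← integral_const_mul]
    refine integral_congr_ae ?_
    filter_upwards [h.fst_eq, hd.repr] with x h1 h2
    rw [h1, h2]; ring
  have iabs := integrable_sq_norm hd.memLp_abs
  have i2 := integrable_sq_norm (memLp_snd U)
  have iD : Integrable (fun ξ : ℝ => (ξ ^ 2 + p.wp) * ‖U.snd ξ‖ ^ 2) := by
    refine (iabs.add (i2.const_mul p.wp)).congr (Eventually.of_forall fun ξ => ?_)
    simp only [Pi.add_apply, norm_mul, Complex.norm_real, Real.norm_eq_abs, abs_abs, mul_pow,
      sq_abs]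
    ring
  have i3 : Integrable (fun ξ : ℝ => -(((ξ ^ 2 + p.wp) * ‖U.snd ξ‖ ^ 2 : ℝ) : ℂ)) :=
    iD.ofReal.neg
  have i4 : Integrable (fun ξ : ℝ => u 1 * starRingEnd ℂ ((p.eta ξ : ℂ) * U.snd ξ)) :=
    (Complex.conjCLE.integrable_comp_iff.2 hd.integrable).const_mul _
  have h2 : ∫ ξ, V.snd ξ * starRingEnd ℂ (U.snd ξ)
      = -((∫ ξ, (ξ ^ 2 + p.wp) * ‖U.snd ξ‖ ^ 2 : ℝ) : ℂ)
        + u 1 * starRingEnd ℂ (∫ ξ, (p.eta ξ : ℂ) * U.snd ξ) := by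
    rw [← integral_conj, ← integral_complex_ofReal, ← integral_neg, ← integral_const_mul,
      ← integral_add i3 i4]
    refine integral_congr_ae ?_
    filter_upwards [h.snd_eq_volume] with ξ h1
    rw [h1, memoryField, map_mul, Complex.conj_ofReal]
    have : U.snd ξ * starRingEnd ℂ (U.snd ξ) = ((‖U.snd ξ‖ ^ 2 : ℝ) : ℂ) := by
      rw [Complex.mul_conj, Complex.normSq_eq_norm_sq]
    push_cast at this ⊢
    linear_combination -((ξ : ℂ) ^ 2 + p.wp) * this
  rw [inner_eq, h1, h2, hd.boundary]
  set J := ∫ ξ, (p.eta ξ : ℂ) * U.snd ξ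
  set D : ℝ := ∫ ξ, (ξ ^ 2 + p.wp) * ‖U.snd ξ‖ ^ 2
  -- The boundary condition is tuned so that the two coupling terms combine to ζ times the conjugate
  -- of J ū(1) minus J ū(1). This is purely imaginary, like iE, so only the dissipation contributes
  -- to the real part.
  have e : Complex.I * (Complex.I * p.zeta * J * starRingEnd ℂ (u 1) - E)
      + p.zeta * (-(D : ℂ) + u 1 * starRingEnd ℂ J)
      = ((-(p.zeta * D) : ℝ) : ℂ) - Complex.I * E
        + p.zeta * (starRingEnd ℂ (J * starRingEnd ℂ (u 1)) - J * starRingEnd ℂ (u 1)) := by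
    rw [map_mul, Complex.conj_conj]
    push_cast
    linear_combination (p.zeta * J * starRingEnd ℂ (u 1)) * Complex.I_mul_I
  rw [e]
  simp

lemma IsImage.integrable_dissipation (h : IsImage τ p U V u w) :
    Integrable (fun ξ : ℝ => ξ ^ 2 * ‖U.snd ξ‖ ^ 2) := by
  refine (integrable_sq_norm h.inDomain.memLp_abs).congr (Eventually.of_forall fun ξ => ?_)
  simp only [norm_mul, Complex.norm_real, Real.norm_eq_abs, abs_abs, mul_pow, sq_abs]

lemma re_inner_nonpos (hτ : IsDegenerateCoeff τ) (h : (U, V) ∈ (systemOperator τ p).graph) :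
    (inner ℂ U V).re ≤ 0 := by
  obtain ⟨u, w, h⟩ := mem_graph_systemOperator.1 h
  rw [h.re_inner hτ, neg_nonpos]
  exact mul_nonneg p.zeta_pos.le (integral_nonneg fun ξ => by
    have := p.wp_nonneg
    change 0 ≤ (ξ ^ 2 + p.wp) * ‖U.snd ξ‖ ^ 2
    positivity)

/-- Construction of elements of the domain from a solution of the elliptic problem. -/
lemma isImage_of_solution {z : ℂ} {c : ℝ} (hc : 0 < c) (hz : SymbolBound p z c) {f : ℝ → ℂ}
    (hf : MemLp f 2 volume) (hu : MemW τ u) (hw : MemH2Weighted τ u w)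
    (hb : w 1 = Complex.I * (memoryInput p z f + transferFun p z * u 1))
    (hU : U.fst =ᵐ[unitMeasure] u)
    (hU2 : ∀ᵐ ξ, U.snd ξ = (f ξ + p.eta ξ * u 1) / memorySymbol p z ξ)
    (hV : V.fst =ᵐ[unitMeasure] fun x => Complex.I * deriv w x)
    (hV2 : ∀ᵐ ξ, V.snd ξ = z * U.snd ξ - f ξ) : IsImage τ p U V u w := by
  obtain ⟨i1, i2⟩ := hz.integrable_eta_solution hc hf (u 1)
  have e1 : (fun ξ => (p.eta ξ : ℂ) * ((f ξ + p.eta ξ * u 1) / memorySymbol p z ξ)) =ᵐ[volume]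
      fun ξ => (p.eta ξ : ℂ) * U.snd ξ := by
    filter_upwards [hU2] with ξ h1
    rw [h1]
  have e2 : ∀ᵐ ξ, z * U.snd ξ - f ξ = memoryField p U.snd (u 1) ξ := by
    filter_upwards [hU2] with ξ h1
    have h2 : memorySymbol p z ξ * U.snd ξ = f ξ + p.eta ξ * u 1 := by
      rw [h1]; field_simp [hz.ne_zero hc ξ]
    rw [memorySymbol] at h2
    rw [memoryField]
    linear_combination h2
  refine ⟨⟨hU, hw, hu, i1.congr e1, ?_, ?_, ?_⟩, hV, ?_⟩
  · rw [hb, ← i2, integral_congr_ae e1]; ring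
  · exact (((memLp_snd U).const_mul z).sub hf).ae_eq e2
  · refine ((hz.memLp_abs_div hc hf).add ((hz.memLp_abs_eta_div hc).mul_const (u 1))).ae_eq ?_
    filter_upwards [hU2] with ξ h1
    rw [Pi.add_apply, h1]; ring
  · exact p.ae_iff.2 (by filter_upwards [hV2, e2] with ξ h1 h2 using h1.trans h2)

/-- The memory variable and the boundary condition are determined by the trace and the
right hand side of the resolvent equation. -/
lemma IsImage.memory_eq {z : ℂ} {c : ℝ} (hc : 0 < c) (hz : SymbolBound p z c)
    (h : IsImage τ p U V u w) :
    (∀ᵐ ξ, U.snd ξ = ((z • U - V).snd ξ + p.eta ξ * u 1) / memorySymbol p z ξ) ∧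
    w 1 = Complex.I * (memoryInput p z (z • U - V).snd + transferFun p z * u 1) := by
  have hsnd : ∀ᵐ ξ, (z • U - V).snd ξ = z * U.snd ξ - V.snd ξ := by
    filter_upwards [p.ae_iff.1 (Lp.coeFn_sub (z • U).snd V.snd), snd_smul_ae p z U] with ξ h1 h2
    rw [← h2]; exact h1
  have hU2 : ∀ᵐ ξ, U.snd ξ = ((z • U - V).snd ξ + p.eta ξ * u 1) / memorySymbol p z ξ := by
    filter_upwards [hsnd, h.snd_eq_volume] with ξ h1 h2
    rw [eq_div_iff (hz.ne_zero hc ξ), h1, h2, memoryField, memorySymbol]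
    ring
  refine ⟨hU2, ?_⟩
  rw [h.inDomain.boundary, mul_assoc,
    ← (hz.integrable_eta_solution hc (memLp_snd (z • U - V)) (u 1)).2]
  congr 2
  refine integral_congr_ae ?_
  filter_upwards [hU2] with ξ h1
  rw [← h1]

lemma FormSpace.isUnit_of_coercive {Q : Type} [NormedAddCommGroup Q] [InnerProductSpace ℂ Q]
    [CompleteSpace Q] (Φ : FormSpace τ Q) (B : Q →L[ℂ] Q) {a : ℝ} (ha : 0 < a)
    (h : ∀ v, a * (‖Φ.emb v‖ ^ 2 + ‖Φ.grad v‖ ^ 2) ≤ ‖inner ℂ (B v) v‖) : IsUnit B := by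
  obtain ⟨c, hc, hcv⟩ := Φ.coercive
  refine B.isUnit_of_forall_le_norm_inner_map (c := ⟨a * c, by positivity⟩)
    (by exact mul_pos ha hc) fun v => ?_
  refine le_trans ?_ (h v)
  have := hcv v
  change ‖v‖ ^ 2 * (a * c) ≤ _
  nlinarith

/-- Lax–Milgram for the reduced problem. Its form at v has real part r‖v‖² + g|v(1)|² with g = G(r)
≥ 0, and imaginary part ‖√τ vₓ‖². A weak solution has a genuine flux by `FormSpace.strong_form`, and
ϑ is then defined by division by the symbol. -/
lemma resolventSurj_systemOperator (hτ : IsDegenerateCoeff τ) {r : ℝ} (hr : 0 < r) :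
    ResolventSurj (systemOperator τ p) r := by
  obtain ⟨Q, _, _, _, ⟨Φ⟩⟩ := exists_formSpace hτ
  obtain ⟨g, hg0, hg⟩ := transferFun_ofReal (p := p) hr
  obtain ⟨c, hc, hz⟩ := symbolBound_of_re_pos p (z := (r : ℂ)) (by simpa using hr)
  intro F
  set B : Q →L[ℂ] Q := (r : ℂ) • (ContinuousLinearMap.adjoint Φ.emb).comp Φ.emb
    + Complex.I • (ContinuousLinearMap.adjoint Φ.grad).comp Φ.grad
    + (g : ℂ) • (ContinuousLinearMap.adjoint Φ.trace).comp Φ.trace with hB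
  have hBi : ∀ t v, inner ℂ t (B v) = r * inner ℂ (Φ.emb t) (Φ.emb v)
      + Complex.I * inner ℂ (Φ.grad t) (Φ.grad v)
      + g * (starRingEnd ℂ (Φ.trace t) * Φ.trace v) := by
    intro t v
    simp only [hB, add_apply, smul_apply, ContinuousLinearMap.comp_apply, inner_add_right,
      inner_smul_right, ContinuousLinearMap.adjoint_inner_right, RCLike.inner_apply]
    ring
  have hu : IsUnit B := by
    -- The modulus dominates both the real and the imaginary part, hence their mean; this is the
    -- factor 1/2.
    refine Φ.isUnit_of_coercive B (a := min r 1 / 2) (by positivity) fun v => ?_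
    have h1 : inner ℂ v (B v) = ((r * ‖Φ.emb v‖ ^ 2 + g * ‖Φ.trace v‖ ^ 2 : ℝ) : ℂ)
        + Complex.I * ((‖Φ.grad v‖ ^ 2 : ℝ) : ℂ) := by
      rw [hBi, inner_self_eq_norm_sq_to_K, inner_self_eq_norm_sq_to_K, mul_comm (starRingEnd ℂ _),
        Complex.mul_conj, Complex.normSq_eq_norm_sq]
      simp only [Complex.coe_algebraMap]
      push_cast; ring
    rw [norm_inner_symm, h1]
    set Z : ℂ := _ + _
    have hre : Z.re = r * ‖Φ.emb v‖ ^ 2 + g * ‖Φ.trace v‖ ^ 2 := by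
      simp only [Z, Complex.add_re, Complex.mul_re, Complex.ofReal_re, Complex.ofReal_im,
        Complex.I_re, Complex.I_im]; ring
    have him : Z.im = ‖Φ.grad v‖ ^ 2 := by
      simp only [Z, Complex.add_im, Complex.mul_im, Complex.ofReal_re, Complex.ofReal_im,
        Complex.I_re, Complex.I_im]; ring
    have h2 := Complex.re_le_norm Z
    have h3 := (le_abs_self _).trans (Complex.abs_im_le_norm Z)
    rw [hre] at h2
    rw [him] at h3
    have h4 : 0 ≤ g * ‖Φ.trace v‖ ^ 2 := by positivity
    have h5 : min r 1 * ‖Φ.emb v‖ ^ 2 ≤ r * ‖Φ.emb v‖ ^ 2 := by gcongr; exact min_le_left _ _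
    have h6 : min r 1 * ‖Φ.grad v‖ ^ 2 ≤ 1 * ‖Φ.grad v‖ ^ 2 := by gcongr; exact min_le_right _ _
    nlinarith
  set k := memoryInput p r F.snd with hk
  obtain ⟨v, hv⟩ := (ContinuousLinearMap.isUnit_iff_bijective.1 hu).2
    (ContinuousLinearMap.adjoint Φ.emb F.fst
      - k • ContinuousLinearMap.adjoint Φ.trace 1)
  have hweak : ∀ t, inner ℂ (Φ.grad t) (Φ.grad v)
      = inner ℂ (Φ.emb t) (-Complex.I • (F.fst - (r : ℂ) • Φ.emb v))
        + starRingEnd ℂ (Φ.trace t) * (Complex.I * (k + g * Φ.trace v)) := by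
    intro t
    have h1 := hBi t v
    rw [hv, inner_sub_right, inner_smul_right, ContinuousLinearMap.adjoint_inner_right,
      ContinuousLinearMap.adjoint_inner_right, RCLike.inner_apply, one_mul] at h1
    rw [inner_smul_right, inner_sub_right, inner_smul_right]
    linear_combination Complex.I * h1 + inner ℂ (Φ.grad t) (Φ.grad v) * Complex.I_mul_I
  obtain ⟨u, w, hW, hH2, hemb, htr, hwd, hw1⟩ := Φ.strong_form hτ hweak
  have hϑ : MemLp (fun ξ => (F.snd ξ + p.eta ξ * u 1) / memorySymbol p r ξ) 2 volume := by
    refine ((hz.memLp_div hc (memLp_snd F)).add ((hz.memLp_eta_div hc).mul_const (u 1))).ae_eq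
      (Eventually.of_forall fun ξ => ?_)
    simp only [Pi.add_apply]; ring
  set U : StateSpace p := mkState (Φ.emb v) hϑ with hU
  refine ⟨U, (r : ℂ) • U - F, mem_graph_systemOperator.2 ⟨u, w, ?_⟩, sub_sub_cancel _ _⟩
  refine isImage_of_solution hc hz (memLp_snd F) hW hH2 ?_ hemb (mkState_snd _ hϑ) ?_ ?_
  · rw [hw1, htr, hg]
  · filter_upwards [hwd, Lp.coeFn_sub ((r : ℂ) • U).fst F.fst, Lp.coeFn_smul (r : ℂ) U.fst,
      Lp.coeFn_smul (-Complex.I) (F.fst - (r : ℂ) • Φ.emb v),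
      Lp.coeFn_sub F.fst ((r : ℂ) • Φ.emb v), Lp.coeFn_smul (r : ℂ) (Φ.emb v)]
      with x h1 h2 h3 h4 h5 h6
    have h2' : ((r : ℂ) • U - F).fst x = r * Φ.emb v x - F.fst x := by
      refine h2.trans ?_
      rw [Pi.sub_apply]
      congr 1
    rw [h2', h1, h4, Pi.smul_apply, h5, Pi.sub_apply, h6, Pi.smul_apply, smul_eq_mul, smul_eq_mul]
    linear_combination -(F.fst x - r * Φ.emb v x) * Complex.I_mul_I
  · filter_upwards [p.ae_iff.1 (Lp.coeFn_sub ((r : ℂ) • U).snd F.snd), snd_smul_ae p r U]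
      with ξ h1 h2
    rw [← h2]; exact h1

theorem isMaximalDissipative_systemOperator (hτ : IsDegenerateCoeff τ) (p : DampingParams) :
    IsMaximalDissipative (systemOperator τ p) :=
  ⟨fun _ _ h => re_inner_nonpos hτ h, fun _ hr => resolventSurj_systemOperator hτ hr⟩

theorem exists_isGeneratedBy_systemOperator (hτ : IsDegenerateCoeff τ) (p : DampingParams) :
    ∃ S : NNReal → StateSpace p →L[ℂ] StateSpace p, IsGeneratedBy S (systemOperator τ p) := by
  have hA := isMaximalDissipative_systemOperator hτ p
  refine exists_isGeneratedBy hA.dense (fun r _ => ?_) hA.surj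
  simpa using hA.boundedBelow r

end System

/-! ### Trace estimate at high frequency -/

section Trace

variable {τ : ℝ → ℝ} {u w f : ℝ → ℂ}

lemma IsDegenerateCoeff.exists_bound (hτ : IsDegenerateCoeff τ) :
    ∃ T > 0, ∀ x ∈ Icc (0 : ℝ) 1, τ x ≤ T := by
  obtain ⟨C, hC⟩ := isCompact_Icc.exists_bound_of_continuousOn hτ.continuousOn
  exact ⟨max C 1, by positivity, fun x hx =>
    (le_abs_self _).trans ((hC x hx).trans (le_max_left _ _))⟩

lemma norm_integral_mul_conj_le {g : ℝ → ℂ} (hf : MemLp f 2 unitMeasure)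
    (hg : MemLp g 2 unitMeasure) :
    2 * ‖∫ x in Ioo (0 : ℝ) 1, f x * starRingEnd ℂ (g x)‖
      ≤ (∫ x in Ioo (0 : ℝ) 1, ‖f x‖ ^ 2) + ∫ x in Ioo (0 : ℝ) 1, ‖g x‖ ^ 2 := by
  rw [← integral_add (integrable_sq_norm hf) (integrable_sq_norm hg)]
  refine (mul_le_mul_of_nonneg_left (norm_integral_le_integral_norm _) zero_le_two).trans ?_
  rw [← integral_const_mul]
  refine integral_mono ((hf.integrable_mul (memLp_conj hg)).norm.const_mul 2)
    ((integrable_sq_norm hf).add (integrable_sq_norm hg)) fun x => ?_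
  simp only [norm_mul, RCLike.norm_conj]
  nlinarith [sq_nonneg (‖f x‖ - ‖g x‖)]

/-- Energy bound for solutions of `-wₓ - κ u = f`, `w = τ uₓ`. -/
lemma integral_sq_flux_le (hτ : IsDegenerateCoeff τ) {T : ℝ} (hT : ∀ x ∈ Icc (0 : ℝ) 1, τ x ≤ T)
    {κ : ℝ} (hu : MemW τ u) (hw : MemH2Weighted τ u w) (hf : MemLp f 2 unitMeasure)
    (he : ∀ᵐ x ∂unitMeasure, deriv w x = -κ * u x - f x) (hb : ‖w 1‖ ≤ ‖u 1‖) :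
    ∫ x in Ioo (0 : ℝ) 1, ‖w x‖ ^ 2 ≤ T * (‖u 1‖ ^ 2
      + κ * (∫ x in Ioo (0 : ℝ) 1, ‖u x‖ ^ 2) + ((∫ x in Ioo (0 : ℝ) 1, ‖f x‖ ^ 2)
        + ∫ x in Ioo (0 : ℝ) 1, ‖u x‖ ^ 2) / 2) := by
  have hg := green hτ hu hw.flux_memH1 (hw.flux_zero hτ)
  have iu := integrable_sq_norm hu.memH1.memLp
  have ifu := hf.integrable_mul (memLp_conj hu.memH1.memLp)
  have e1 : ∫ x in Ioo (0 : ℝ) 1, w x * starRingEnd ℂ (deriv u x)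
      = ((∫ x in Ioo (0 : ℝ) 1, ‖(Real.sqrt (τ x) : ℂ) * deriv u x‖ ^ 2 : ℝ) : ℂ) := by
    rw [← integral_complex_ofReal]
    refine integral_congr_ae ?_
    filter_upwards [hw.flux_eq, ae_restrict_mem measurableSet_Ioo] with x hx hx1
    rw [hx, mul_assoc, Complex.mul_conj, Complex.normSq_eq_norm_sq, norm_mul, mul_pow,
      Complex.norm_real, Real.norm_eq_abs, sq_abs,
      Real.sq_sqrt (hτ.pos x (Ioo_subset_Ioc_self hx1)).le]
    push_cast; ring
  have e2 : ∫ x in Ioo (0 : ℝ) 1, deriv w x * starRingEnd ℂ (u x)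
      = -((κ * ∫ x in Ioo (0 : ℝ) 1, ‖u x‖ ^ 2 : ℝ) : ℂ)
        - ∫ x in Ioo (0 : ℝ) 1, f x * starRingEnd ℂ (u x) := by
    rw [← integral_const_mul, ← integral_complex_ofReal, ← integral_neg]
    refine Eq.trans ?_ (integral_sub (iu.const_mul κ).ofReal.neg ifu)
    refine integral_congr_ae ?_
    filter_upwards [he] with x hx
    rw [hx]
    have : u x * starRingEnd ℂ (u x) = ((‖u x‖ ^ 2 : ℝ) : ℂ) := by
      rw [Complex.mul_conj, Complex.normSq_eq_norm_sq]
    push_cast at this ⊢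
    linear_combination -(κ : ℂ) * this
  rw [e1, e2] at hg
  set E := ∫ x in Ioo (0 : ℝ) 1, ‖(Real.sqrt (τ x) : ℂ) * deriv u x‖ ^ 2
  set N := ∫ x in Ioo (0 : ℝ) 1, ‖u x‖ ^ 2
  set J := ∫ x in Ioo (0 : ℝ) 1, f x * starRingEnd ℂ (u x)
  have hE : E ≤ ‖u 1‖ ^ 2 + κ * N + ((∫ x in Ioo (0 : ℝ) 1, ‖f x‖ ^ 2) + N) / 2 := by
    have h1 : (E : ℂ) = w 1 * starRingEnd ℂ (u 1) + ((κ * N : ℝ) : ℂ) + J := by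
      linear_combination hg
    have h2 : E = (w 1 * starRingEnd ℂ (u 1)).re + κ * N + J.re := by
      have := congrArg Complex.re h1
      rwa [Complex.add_re, Complex.add_re, Complex.ofReal_re, Complex.ofReal_re] at this
    have h3 : (w 1 * starRingEnd ℂ (u 1)).re ≤ ‖u 1‖ ^ 2 := by
      refine (Complex.re_le_norm _).trans ?_
      rw [norm_mul, RCLike.norm_conj, sq]
      gcongr
    have h4 := norm_integral_mul_conj_le hf hu.memH1.memLp
    have h5 := Complex.re_le_norm J
    linarith
  have hT0 : 0 ≤ T := (hτ.pos 1 ⟨one_pos, le_rfl⟩).le.trans (hT 1 ⟨zero_le_one, le_rfl⟩)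
  refine le_trans ?_ (mul_le_mul_of_nonneg_left hE hT0)
  rw [← integral_const_mul]
  refine integral_mono_of_nonneg (Eventually.of_forall fun x => by positivity)
    ((integrable_sq_norm hu.memH1.memLp_deriv).const_mul T) ?_
  filter_upwards [hw.flux_eq, ae_restrict_mem measurableSet_Ioo] with x hx hx1
  have h1 := hτ.pos x (Ioo_subset_Ioc_self hx1)
  have h2 := hT x (Ioo_subset_Icc_self hx1)
  rw [hx, norm_mul, norm_mul, mul_pow, mul_pow, Complex.norm_real, Complex.norm_real,
    Real.norm_eq_abs, Real.norm_eq_abs, sq_abs, sq_abs, Real.sq_sqrt h1.le, sq (τ x), mul_assoc]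
  gcongr

/-- Rellich-type estimate of the trace at `1`. -/
lemma exists_sq_trace_le (hτ : IsDegenerateCoeff τ) :
    ∃ C > 0, ∃ K ≥ 1, ∀ κ : ℝ, K ≤ κ → ∀ u w f : ℝ → ℂ, MemW τ u → MemH2Weighted τ u w →
      MemLp f 2 unitMeasure → (∀ᵐ x ∂unitMeasure, deriv w x = -κ * u x - f x) →
      ‖w 1‖ ≤ ‖u 1‖ →
      ‖u 1‖ ^ 2 ≤ C * ((∫ x in Ioo (0 : ℝ) 1, ‖u x‖ ^ 2) + ∫ x in Ioo (0 : ℝ) 1, ‖f x‖ ^ 2) := by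
  obtain ⟨T, hT0, hT⟩ := hτ.exists_bound
  have h1 := hτ.pos 1 ⟨one_pos, le_rfl⟩
  -- The threshold κ τ(1) ≥ 6T lets the term 3T|u(1)|² produced by the flux bound be absorbed into
  -- half of κ τ(1)|u(1)|².
  refine ⟨2 * (11 * T + 1) / τ 1, by positivity, max 1 (6 * T / τ 1), le_max_left _ _,
    fun κ hκ u w f hu hw hf he hb => ?_⟩
  have hκ1 : 1 ≤ κ := (le_max_left _ _).trans hκ
  have hκ2 : 6 * T ≤ κ * τ 1 := by
    have := (le_max_right _ _).trans hκ
    rwa [div_le_iff₀ h1] at this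
  set N := ∫ x in Ioo (0 : ℝ) 1, ‖u x‖ ^ 2 with hN
  set F := ∫ x in Ioo (0 : ℝ) 1, ‖f x‖ ^ 2 with hF
  set W := ∫ x in Ioo (0 : ℝ) 1, ‖w x‖ ^ 2 with hW
  have hN0 : 0 ≤ N := integral_nonneg fun _ => by positivity
  have hF0 : 0 ≤ F := integral_nonneg fun _ => by positivity
  have hWle := integral_sq_flux_le hτ hT hu hw hf he hb
  have wL2 : MemLp w 2 unitMeasure := by
    obtain ⟨C, hC⟩ := isCompact_Icc.exists_bound_of_continuousOn hw.flux_memH1.continuousOn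
    refine MemLp.of_bound (aestronglyMeasurable_of_continuousOn
      (hw.flux_memH1.continuousOn.mono Ioc_subset_Icc_self)) C ?_
    filter_upwards [ae_restrict_mem measurableSet_Ioo] with x hx using hC x (Ioo_subset_Icc_self hx)
  -- Rellich multiplier. The weight 2x - 1 vanishes at 1/2 and equals 1 at 1, so P(1) = ∫ P' over
  -- (1/2, 1) and the degenerate end point never enters.
  set P : ℝ → ℂ := fun x => ((2 * x - 1 : ℝ) : ℂ) *
    (w x * starRingEnd ℂ (w x) + κ * ((τ x : ℂ) * (u x * starRingEnd ℂ (u x)))) with hP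
  have half : (1 / 2 : ℝ) ∈ Ioo (0 : ℝ) 1 := by constructor <;> norm_num
  have aw : AbsolutelyContinuousOnInterval w (1 / 2) 1 :=
    hw.flux_memH1.absCont_mono (Ioo_subset_Icc_self half) ⟨zero_le_one, le_rfl⟩
  have au : AbsolutelyContinuousOnInterval u (1 / 2) 1 := hu.memH1.locAbsCont _ half
  have aτ : AbsolutelyContinuousOnInterval (fun x => (τ x : ℂ)) (1 / 2) 1 := by
    refine absCont_ofReal (ContDiffOn.absolutelyContinuousOnInterval (hτ.contDiffOn.mono ?_))
    rw [uIcc_of_le half.2.le]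
    exact fun x hx => ⟨half.1.trans_le hx.1, hx.2⟩
  have aP : AbsolutelyContinuousOnInterval P (1 / 2) 1 := by
    refine absCont_mul (absCont_ofReal ?_) ((absCont_mul aw (absCont_conj aw)).add
      (absCont_mul (absCont_const κ) (absCont_mul aτ (absCont_mul au (absCont_conj au)))))
    exact (ContDiff.contDiffOn (by fun_prop)).absolutelyContinuousOnInterval
  have hint := absCont_integral_deriv aP
  have hP0 : P (1 / 2) = 0 := by simp [hP]
  have hP1 : P 1 = ((‖w 1‖ ^ 2 + κ * (τ 1 * ‖u 1‖ ^ 2) : ℝ) : ℂ) := by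
    simp only [hP]
    rw [Complex.mul_conj, Complex.normSq_eq_norm_sq, Complex.mul_conj, Complex.normSq_eq_norm_sq]
    push_cast; ring
  rw [hP0, sub_zero, hP1] at hint
  have iw := integrable_sq_norm wL2
  have iu := integrable_sq_norm hu.memH1.memLp
  have iff' := integrable_sq_norm hf
  have hbound : ∀ᵐ x ∂unitMeasure, x ∈ Ioo (1 / 2 : ℝ) 1 →
      ‖deriv P x‖ ≤ 3 * ‖w x‖ ^ 2 + κ * (6 * T) * ‖u x‖ ^ 2 + ‖f x‖ ^ 2 := by
    filter_upwards [he, hw.flux_eq, hu.memH1.locAbsCont.ae_differentiableAt,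
      hw.flux_memH1.ae_differentiableAt, ae_restrict_mem measurableSet_Ioo] with x hx1 hx2 hx3 hx4
      hx hxh
    have d1 : HasDerivAt (fun x : ℝ => ((2 * x - 1 : ℝ) : ℂ)) 2 x := by
      have : HasDerivAt (fun x : ℝ => 2 * x - 1) 2 x := by
        simpa using ((hasDerivAt_id x).const_mul (2 : ℝ)).sub_const 1
      simpa using this.ofReal_comp
    have d2 : HasDerivAt (fun x : ℝ => (τ x : ℂ)) ((derivWithin τ (Icc 0 1) x : ℝ) : ℂ) x :=
      (hτ.hasDerivAt hx).ofReal_comp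
    have dw := hx4.hasDerivAt
    have du := hx3.hasDerivAt
    have dwc : HasDerivAt (fun x => starRingEnd ℂ (w x)) (starRingEnd ℂ (deriv w x)) x :=
      Complex.conjCLE.hasFDerivAt.comp_hasDerivAt x dw
    have duc : HasDerivAt (fun x => starRingEnd ℂ (u x)) (starRingEnd ℂ (deriv u x)) x :=
      Complex.conjCLE.hasFDerivAt.comp_hasDerivAt x du
    have dP := d1.mul ((dw.mul dwc).add ((d2.mul (du.mul duc)).const_mul (κ : ℂ)))
    -- Since w = τuₓ and wₓ = -κu - f, the cross terms between u and w of order κ cancel; this makes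
    -- the final bound uniform in κ.
    have eP : deriv P x = 2 * (w x * starRingEnd ℂ (w x) + κ * ((τ x : ℂ) * (u x * starRingEnd ℂ (u x))))
        + ((2 * x - 1 : ℝ) : ℂ) * (-(f x * starRingEnd ℂ (w x)) - w x * starRingEnd ℂ (f x)
          + κ * (((derivWithin τ (Icc 0 1) x : ℝ) : ℂ) * (u x * starRingEnd ℂ (u x)))) := by
      refine dP.deriv.trans ?_
      have hxc : starRingEnd ℂ (w x) = (τ x : ℂ) * starRingEnd ℂ (deriv u x) := by
        rw [hx2, map_mul, Complex.conj_ofReal]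
      have h3 : deriv w x = -(κ : ℂ) * u x - f x := hx1
      have h4 : starRingEnd ℂ (deriv w x) = -(κ : ℂ) * starRingEnd ℂ (u x) - starRingEnd ℂ (f x) := by
        rw [h3, map_sub, map_mul, map_neg, Complex.conj_ofReal]
      simp only [Pi.add_apply, Pi.mul_apply]
      rw [h4, h3]
      linear_combination (-((2 * x - 1 : ℝ) : ℂ) * κ * starRingEnd ℂ (u x)) * hx2
        - (((2 * x - 1 : ℝ) : ℂ) * κ * u x) * hxc
    rw [eP]
    have hτ0 := hτ.pos x (Ioo_subset_Ioc_self hx)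
    have hτT := hT x (Ioo_subset_Icc_self hx)
    -- From x|τ'| ≤ 2τ ≤ 2T and x > 1/2.
    have hτ' : |derivWithin τ (Icc 0 1) x| ≤ 4 * T := by
      have q1 := hτ.quotient_le (Ioo_subset_Ioc_self hx)
      have q2 : degeneracyIndex τ * τ x ≤ 2 * T :=
        mul_le_mul hτ.index_lt_two.le hτT hτ0.le zero_le_two
      nlinarith [abs_nonneg (derivWithin τ (Icc 0 1) x), hxh.1]
    have habs : |2 * x - 1| ≤ 1 := by rw [abs_le]; constructor <;> linarith [hx.1, hx.2]
    have n1 : ‖w x * starRingEnd ℂ (w x)‖ = ‖w x‖ ^ 2 := by rw [norm_mul, RCLike.norm_conj, sq]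
    have n2 : ‖u x * starRingEnd ℂ (u x)‖ = ‖u x‖ ^ 2 := by rw [norm_mul, RCLike.norm_conj, sq]
    have n3 : ‖f x * starRingEnd ℂ (w x)‖ = ‖f x‖ * ‖w x‖ := by rw [norm_mul, RCLike.norm_conj]
    have n4 : ‖w x * starRingEnd ℂ (f x)‖ = ‖f x‖ * ‖w x‖ := by
      rw [norm_mul, RCLike.norm_conj, mul_comm]
    have nκ : ‖(κ : ℂ)‖ = κ := by rw [Complex.norm_real, Real.norm_of_nonneg (by linarith)]
    have nτ : ‖(τ x : ℂ)‖ = τ x := by rw [Complex.norm_real, Real.norm_of_nonneg hτ0.le]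
    have nd : ‖((derivWithin τ (Icc 0 1) x : ℝ) : ℂ)‖ = |derivWithin τ (Icc 0 1) x| :=
      Complex.norm_real _
    have b1 : ‖2 * (w x * starRingEnd ℂ (w x) + κ * ((τ x : ℂ) * (u x * starRingEnd ℂ (u x))))‖
        ≤ 2 * (‖w x‖ ^ 2 + κ * (T * ‖u x‖ ^ 2)) := by
      rw [norm_mul, Complex.norm_ofNat]
      gcongr
      refine (norm_add_le _ _).trans ?_
      rw [n1, norm_mul, norm_mul, nκ, nτ, n2]
      gcongr
    have b2 : ‖-(f x * starRingEnd ℂ (w x)) - w x * starRingEnd ℂ (f x)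
          + κ * (((derivWithin τ (Icc 0 1) x : ℝ) : ℂ) * (u x * starRingEnd ℂ (u x)))‖
        ≤ ‖f x‖ * ‖w x‖ + ‖f x‖ * ‖w x‖ + κ * (4 * T * ‖u x‖ ^ 2) := by
      refine (norm_add_le _ _).trans (add_le_add ((norm_sub_le _ _).trans_eq ?_) ?_)
      · rw [norm_neg, n3, n4]
      · rw [norm_mul, norm_mul, nκ, nd, n2]; gcongr
    refine (norm_add_le _ _).trans ((add_le_add
      (d := ‖f x‖ * ‖w x‖ + ‖f x‖ * ‖w x‖ + κ * (4 * T * ‖u x‖ ^ 2)) b1 ?_).trans ?_)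
    · rw [norm_mul, Complex.norm_real, Real.norm_eq_abs]
      exact (mul_le_mul habs b2 (norm_nonneg _) zero_le_one).trans_eq (one_mul _)
    · nlinarith [sq_nonneg (‖f x‖ - ‖w x‖)]
  have hs : Ioo (1 / 2 : ℝ) 1 ⊆ Ioo 0 1 := Ioo_subset_Ioo half.1.le le_rfl
  have i12 : Integrable (fun x => 3 * ‖w x‖ ^ 2 + κ * (6 * T) * ‖u x‖ ^ 2) unitMeasure :=
    (iw.const_mul 3).add (iu.const_mul _)
  have hi3 : Integrable (fun x => 3 * ‖w x‖ ^ 2 + κ * (6 * T) * ‖u x‖ ^ 2 + ‖f x‖ ^ 2) unitMeasure :=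
    i12.add iff'
  have hmain : ‖((‖w 1‖ ^ 2 + κ * (τ 1 * ‖u 1‖ ^ 2) : ℝ) : ℂ)‖
      ≤ 3 * W + κ * (6 * T) * N + F := by
    rw [← hint, intervalIntegral.integral_of_le half.2.le, integral_Ioc_eq_integral_Ioo]
    have e : 3 * W + κ * (6 * T) * N + F
        = ∫ x in Ioo (0 : ℝ) 1, (3 * ‖w x‖ ^ 2 + κ * (6 * T) * ‖u x‖ ^ 2 + ‖f x‖ ^ 2) := by
      rw [hW, hN, hF, ← integral_const_mul, ← integral_const_mul,
        ← integral_add (iw.const_mul 3) (iu.const_mul _),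
        ← integral_add i12 iff']
    rw [e]
    refine le_trans (norm_integral_le_of_norm_le (hi3.mono_measure (Measure.restrict_mono hs le_rfl))
      ?_) (setIntegral_mono_set hi3 (Eventually.of_forall fun x => ?_) hs.eventuallyLE)
    · filter_upwards [ae_restrict_of_ae_restrict_of_subset hs hbound,
        ae_restrict_mem measurableSet_Ioo] with x h1 h2 using h1 h2
    · change 0 ≤ 3 * ‖w x‖ ^ 2 + κ * (6 * T) * ‖u x‖ ^ 2 + ‖f x‖ ^ 2
      positivity
  rw [Complex.norm_real, Real.norm_of_nonneg (by positivity)] at hmain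
  rw [div_mul_eq_mul_div, le_div_iff₀ h1]
  have hu0 : 0 ≤ ‖u 1‖ ^ 2 := by positivity
  have hw0 : 0 ≤ ‖w 1‖ ^ 2 := by positivity
  have k1 : 3 * W ≤ 3 * (T * (‖u 1‖ ^ 2 + κ * N + (F + N) / 2)) := by linarith
  have k2 : 6 * T * ‖u 1‖ ^ 2 ≤ κ * τ 1 * ‖u 1‖ ^ 2 := by gcongr
  have k3 : κ * (τ 1 * ‖u 1‖ ^ 2) ≤ 2 * (3 * T * (κ * N + (F + N) / 2) + κ * (6 * T) * N + F) := by
    linarith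
  have k4 : 3 * T * (κ * N + (F + N) / 2) + κ * (6 * T) * N + F
      ≤ κ * ((11 * T + 1) * (N + F)) := by
    have m1 : T * N ≤ κ * (T * N) := le_mul_of_one_le_left (by positivity) hκ1
    have m2 : T * F ≤ κ * (T * F) := le_mul_of_one_le_left (by positivity) hκ1
    have m3 : F ≤ κ * F := le_mul_of_one_le_left hF0 hκ1
    have m4 : 0 ≤ κ * N := by positivity
    have m5 : 0 ≤ κ * (T * F) := by positivity
    have m6 : 0 ≤ κ * (T * N) := by positivity
    linarith
  have k5 : κ * (τ 1 * ‖u 1‖ ^ 2) ≤ κ * (2 * (11 * T + 1) * (N + F)) := by linarith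
  have := le_of_mul_le_mul_left k5 (by linarith)
  linarith

end Trace

/-! ### The semigroup is not exponentially stable -/

section SelfAdjoint

variable {H : Type*} [NormedAddCommGroup H] [InnerProductSpace ℂ H] [CompleteSpace H]

/-- The square is coercive, because ⟨S²f, f⟩ = ‖Sf‖² ≥ c²‖f‖². So S² is invertible, and with it S.
-/
lemma isUnit_of_isSelfAdjoint_of_le {S : H →L[ℂ] H} (hS : IsSelfAdjoint S) {c : ℝ} (hc : 0 < c)
    (h : ∀ f, c * ‖f‖ ≤ ‖S f‖) : IsUnit S := by
  have h2 : IsUnit (S * S) := by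
    refine (S * S).isUnit_of_forall_le_norm_inner_map (c := ⟨c ^ 2, by positivity⟩)
      (by exact pow_pos hc 2) fun f => ?_
    have h1 : inner ℂ (S (S f)) f = inner ℂ (S f) (S f) := by
      conv_lhs => rw [← hS.adjoint_eq]
      rw [ContinuousLinearMap.adjoint_inner_left, hS.adjoint_eq]
    change ‖f‖ ^ 2 * c ^ 2 ≤ ‖inner ℂ (S (S f)) f‖
    rw [h1, inner_self_eq_norm_sq_to_K]
    simp only [Complex.coe_algebraMap, norm_pow, Complex.norm_real, norm_norm]
    have := h f
    calc ‖f‖ ^ 2 * c ^ 2 = (c * ‖f‖) ^ 2 := by ring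
      _ ≤ ‖S f‖ ^ 2 := by gcongr
  exact ((Commute.refl S).isUnit_mul_iff.1 h2).1

/-- An injective nonnegative operator whose spectrum avoids an interval `(0, t₀)` is invertible. -/
lemma isUnit_of_spectral_gap {T : H →L[ℂ] H} (hT : IsSelfAdjoint T)
    (hpos : ∀ f, 0 ≤ (inner ℂ (T f) f).re) (hinj : Function.Injective T) {t₀ : ℝ} (ht₀ : 0 < t₀)
    (hgap : ∀ t ∈ Ioo 0 t₀, ∃ c > 0, ∀ f, c * ‖f‖ ≤ ‖T f - (t : ℂ) • f‖) : IsUnit T := by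
  have hsa : ∀ t : ℝ, IsSelfAdjoint (T - algebraMap ℝ (H →L[ℂ] H) t) := fun t =>
    hT.sub (IsSelfAdjoint.algebraMap _ (IsSelfAdjoint.all t))
  have happ : ∀ (t : ℝ) f, (T - algebraMap ℝ (H →L[ℂ] H) t) f = T f - (t : ℂ) • f := fun t f => by
    rw [Algebra.algebraMap_eq_smul_one]
    simp
  -- Negative t are excluded by nonnegativity of T, positive t < t₀ by the gap.
  have hspec : ∀ t ∈ spectrum ℝ T, |t| < t₀ → t = 0 := by
    intro t ht hlt
    by_contra h0
    have hu : IsUnit (T - algebraMap ℝ (H →L[ℂ] H) t) := by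
      rcases lt_or_gt_of_ne h0 with hn | hp
      · refine isUnit_of_isSelfAdjoint_of_le (hsa t) (neg_pos.2 hn) fun f => ?_
        rw [happ]
        rcases (norm_nonneg f).eq_or_lt with hf | hf
        · rw [← hf, mul_zero]; exact norm_nonneg _
        · have h1 : -t * ‖f‖ ^ 2 ≤ (inner ℂ (T f - (t : ℂ) • f) f).re := by
            rw [inner_sub_left, inner_smul_left, Complex.conj_ofReal, inner_self_eq_norm_sq_to_K,
              Complex.sub_re, Complex.re_ofReal_mul]
            have : (((‖f‖ : ℂ)) ^ 2).re = ‖f‖ ^ 2 := by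
              rw [← Complex.ofReal_pow, Complex.ofReal_re]
            simp only [Complex.coe_algebraMap]
            rw [this]
            linarith [hpos f]
          have h2 := (Complex.re_le_norm _).trans
            (norm_inner_le_norm (𝕜 := ℂ) (T f - (t : ℂ) • f) f)
          have h3 : (-t * ‖f‖) * ‖f‖ ≤ ‖T f - (t : ℂ) • f‖ * ‖f‖ := by nlinarith
          exact le_of_mul_le_mul_right h3 hf
      · obtain ⟨c, hc, hcf⟩ := hgap t ⟨hp, (le_abs_self t).trans_lt hlt⟩
        refine isUnit_of_isSelfAdjoint_of_le (hsa t) hc fun f => ?_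
        rw [happ]; exact hcf f
    refine ht ?_
    change IsUnit (algebraMap ℝ (H →L[ℂ] H) t - T)
    rw [← neg_sub]; exact hu.neg
  -- A bump at 0 that vanishes for |x| ≥ t₀: x g(x) = 0 on the spectrum, so T g(T) = 0 and g(T) = 0
  -- by injectivity. If 0 were in the spectrum, then g(0) = 1 would be in the spectrum of g(T) = 0.
  set g : ℝ → ℝ := fun x => max 0 (1 - |x| / t₀) with hg
  have hgc : Continuous g := by fun_prop
  have h0 : cfc (fun x => x * g x) T = 0 := by
    rw [← cfc_zero ℝ T]
    refine cfc_congr fun x hx => ?_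
    by_cases hx0 : |x| < t₀
    · simp [hspec x hx hx0]
    · have : g x = 0 := by
        refine max_eq_left ?_
        rw [sub_nonpos, le_div_iff₀ ht₀]; linarith
      simp [this]
  have h1 : T * cfc g T = 0 := by
    rw [← h0, cfc_mul (fun x : ℝ => x) g T, cfc_id' ℝ T]
  have h2 : cfc g T = 0 := by
    ext f
    have := congrArg (fun S : H →L[ℂ] H => S f) h1
    exact hinj (by simpa using this)
  rw [← spectrum.zero_notMem_iff ℝ]
  intro hz
  have h3 : g 0 ∈ spectrum ℝ (cfc g T) := by
    rw [cfc_map_spectrum g T]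
    exact ⟨0, hz, rfl⟩
  have : Nontrivial (H →L[ℂ] H) := by
    by_contra hn
    rw [not_nontrivial_iff_subsingleton] at hn
    exact hz (isUnit_of_subsingleton _)
  rw [h2, spectrum.zero_eq] at h3
  simp [hg] at h3

end SelfAdjoint

/-! ### Comparison with the Neumann problem. -/

section Neumann

variable {τ : ℝ → ℝ} {p : DampingParams}

lemma deriv_eq_zero_of_ae {u : ℝ → ℂ} (hc : ContinuousOn u (Ioc 0 1)) (h : u =ᵐ[unitMeasure] 0) :
    ∀ x ∈ Ioo (0 : ℝ) 1, deriv u x = 0 := fun x hx => by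
  have : u =ᶠ[𝓝 x] fun _ => 0 := by
    filter_upwards [Ioo_mem_nhds hx.1 hx.2] with y hy
      using eq_zero_of_ae hc h y (Ioo_subset_Ioc_self hy)
  rw [this.deriv_eq, deriv_const]

/-- The resolvent at `1` of the Neumann realisation of `u ↦ -(τ uₓ)ₓ`. -/
lemma exists_neumannResolvent (hτ : IsDegenerateCoeff τ) :
    ∃ T : L2Unit →L[ℂ] L2Unit, IsSelfAdjoint T ∧ (∀ f, 0 ≤ (inner ℂ (T f) f).re) ∧
      Function.Injective T ∧ ∀ f, ∃ u w, MemW τ u ∧ MemH2Weighted τ u w ∧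
        T f =ᵐ[unitMeasure] u ∧ (∀ᵐ x ∂unitMeasure, deriv w x = T f x - f x) ∧ w 1 = 0 := by
  obtain ⟨Q, _, _, _, ⟨Φ⟩⟩ := exists_formSpace hτ
  set S : Q →L[ℂ] Q := (ContinuousLinearMap.adjoint Φ.emb).comp Φ.emb
    + (ContinuousLinearMap.adjoint Φ.grad).comp Φ.grad with hS
  have hSi : ∀ t v, inner ℂ t (S v) = inner ℂ (Φ.emb t) (Φ.emb v)
      + inner ℂ (Φ.grad t) (Φ.grad v) := fun t v => by
    simp only [hS, add_apply, ContinuousLinearMap.comp_apply, inner_add_right,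
      ContinuousLinearMap.adjoint_inner_right]
  have hSv : ∀ v, inner ℂ (S v) v = ((‖Φ.emb v‖ ^ 2 + ‖Φ.grad v‖ ^ 2 : ℝ) : ℂ) := fun v => by
    rw [← inner_conj_symm, hSi, inner_self_eq_norm_sq_to_K, inner_self_eq_norm_sq_to_K]
    simp only [Complex.coe_algebraMap, map_add, map_pow, Complex.conj_ofReal]
    push_cast; ring
  have hu : IsUnit S := by
    refine Φ.isUnit_of_coercive S one_pos fun v => ?_
    rw [hSv, Complex.norm_real, one_mul]
    exact le_abs_self _
  obtain ⟨S', hS'⟩ := hu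
  set R : Q →L[ℂ] Q := ((S'⁻¹ : (Q →L[ℂ] Q)ˣ) : Q →L[ℂ] Q) with hR
  have hSR : ∀ v, S (R v) = v := fun v => by
    have h1 : S * R = 1 := by rw [← hS', hR, Units.mul_inv]
    exact congrArg (fun B : Q →L[ℂ] Q => B v) h1
  -- Here R inverts the operator of the form ⟨u, v⟩ + ⟨√τ uₓ, √τ vₓ⟩. Having no boundary term, this
  -- form encodes the Neumann condition at 1.
  set T : L2Unit →L[ℂ] L2Unit := Φ.emb.comp (R.comp (ContinuousLinearMap.adjoint Φ.emb)) with hT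
  set V : L2Unit → Q := fun f => R (ContinuousLinearMap.adjoint Φ.emb f) with hV
  have hTV : ∀ f, T f = Φ.emb (V f) := fun f => rfl
  have hweak : ∀ f t, inner ℂ (Φ.emb t) f
      = inner ℂ (Φ.emb t) (Φ.emb (V f)) + inner ℂ (Φ.grad t) (Φ.grad (V f)) := fun f t => by
    rw [← hSi, hV, hSR, ContinuousLinearMap.adjoint_inner_right]
  have hstrong : ∀ f, ∃ u w, MemW τ u ∧ MemH2Weighted τ u w ∧
        T f =ᵐ[unitMeasure] u ∧ (∀ᵐ x ∂unitMeasure, deriv w x = T f x - f x) ∧ w 1 = 0 := by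
    intro f
    obtain ⟨u, w, h1, h2, h3, h4, h5, h6⟩ := Φ.strong_form hτ (v := V f) (f := f - T f) (c := 0)
      (fun t => by rw [inner_sub_right, hweak f t, hTV]; ring)
    refine ⟨u, w, h1, h2, h3, ?_, h6⟩
    filter_upwards [h5, Lp.coeFn_sub f (T f)] with x h7 h8
    rw [h7, h8, Pi.sub_apply, neg_sub]
  refine ⟨T, ?_, fun f => ?_, ?_, hstrong⟩
  · rw [ContinuousLinearMap.isSelfAdjoint_iff_isSymmetric]
    intro f g
    change inner ℂ (T f) g = inner ℂ f (T g)
    rw [← inner_conj_symm f, hTV, hTV, hweak g, hweak f, map_add, inner_conj_symm,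
      inner_conj_symm]
  · rw [hTV, hweak, inner_self_eq_norm_sq_to_K, inner_self_eq_norm_sq_to_K]
    simp only [Complex.coe_algebraMap, Complex.add_re, ← Complex.ofReal_pow, Complex.ofReal_re]
    positivity
  · rw [injective_iff_map_eq_zero]
    intro f hf
    obtain ⟨u, w, h1, h2, h3, h4, -⟩ := hstrong f
    have hu0 : u =ᵐ[unitMeasure] 0 := by
      rw [hf] at h3
      exact h3.symm.trans (Lp.coeFn_zero _ _ _)
    have hw0 : w =ᵐ[unitMeasure] 0 := by
      filter_upwards [h2.flux_eq, ae_restrict_mem measurableSet_Ioo] with x h5 h6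
      rw [h5, deriv_eq_zero_of_ae h1.memH1.locAbsCont.continuousOn hu0 x h6, mul_zero]; rfl
    refine Lp.ext ?_
    filter_upwards [h4, hu0, h3, ae_restrict_mem measurableSet_Ioo, Lp.coeFn_zero ℂ 2 unitMeasure]
      with x h5 h6 h7 h8 h9
    rw [h7, h6, deriv_eq_zero_of_ae (h2.flux_memH1.continuousOn.mono Ioc_subset_Icc_self) hw0 x h8,
      Pi.zero_apply, zero_sub, eq_comm, neg_eq_zero] at h5
    rw [h5, h9]; rfl

lemma tendsto_transferFun (p : DampingParams) :
    Tendsto (fun κ : ℝ => ‖transferFun p (-Complex.I * κ)‖) atTop (𝓝 0) := by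
  obtain ⟨C, hC, h⟩ := exists_norm_transferFun_le p
  have h1 : Tendsto (fun κ : ℝ => C * κ ^ (p.order - 1)) atTop (𝓝 0) := by
    have := (tendsto_rpow_neg_atTop (y := 1 - p.order) (by linarith [p.order_lt_one])).const_mul C
    simpa using this
  refine squeeze_zero' (Eventually.of_forall fun _ => norm_nonneg _) ?_ h1
  filter_upwards [eventually_ge_atTop 4] with κ hκ
  simpa using h κ hκ 0 (by simp)

lemma integral_sq_smul_le (φ : L2Unit) {f : ℝ → ℂ} {a : ℂ} (h : ∀ᵐ x ∂unitMeasure, f x = a * φ x) :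
    ∫ x in Ioo (0 : ℝ) 1, ‖f x‖ ^ 2 = (‖a‖ * ‖φ‖) ^ 2 := by
  rw [mul_pow, sq_norm_L2, ← integral_const_mul]
  refine integral_congr_ae ?_
  filter_upwards [h] with x hx
  rw [hx, norm_mul, mul_pow]

/-- Comparison of the Neumann problem with the resolvent of the damped system. -/
lemma norm_le_of_boundedBelow (hτ : IsDegenerateCoeff τ) {c C κ : ℝ} (hc : 0 < c) (hC : 0 < C)
    (hκ : 0 < κ) (hb : BoundedBelow (systemOperator τ p) (Complex.I * ((-κ : ℝ) : ℂ)) c)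
    (htr : ∀ u w f : ℝ → ℂ, MemW τ u → MemH2Weighted τ u w →
      MemLp f 2 unitMeasure → (∀ᵐ x ∂unitMeasure, deriv w x = -κ * u x - f x) →
      ‖w 1‖ ≤ ‖u 1‖ →
      ‖u 1‖ ^ 2 ≤ C * ((∫ x in Ioo (0 : ℝ) 1, ‖u x‖ ^ 2) + ∫ x in Ioo (0 : ℝ) 1, ‖f x‖ ^ 2))
    (hG : ‖transferFun p (-Complex.I * κ)‖ ≤ 1)
    (hG' : ‖transferFun p (-Complex.I * κ)‖ * (C * (c⁻¹ + 1)) ≤ 1 / 2)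
    {φ r : L2Unit} {a z : ℝ → ℂ} (ha : MemW τ a) (hz : MemH2Weighted τ a z)
    (hφ : φ =ᵐ[unitMeasure] a) (hza : ∀ᵐ x ∂unitMeasure, deriv z x = -κ * φ x - r x)
    (hz1 : z 1 = 0) :
    ‖φ‖ ≤ (2 * c⁻¹ + 1) * ‖r‖ := by
  have hA := isMaximalDissipative_systemOperator hτ p
  have hreq : Complex.I * ((-κ : ℝ) : ℂ) = -Complex.I * κ := by push_cast; ring
  set G := transferFun p (-Complex.I * κ) with hGd
  have him : (-Complex.I * κ : ℂ).im ≠ 0 := by simp [hκ.ne']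
  obtain ⟨d, hd, hsym⟩ := symbolBound_of_im_ne_zero p him
  -- The damped system is driven by φ itself, with no memory input, so its boundary condition is
  -- exactly w(1) = i G u(1).
  obtain ⟨U, V, hUV, hF⟩ := hA.surj_of_boundedBelow hc (by simp) hb
    (WithLp.toLp 2 (φ, (0 : Lp ℂ 2 p.weightMeasure)))
  have hUb := hb U V hUV
  rw [hreq] at hF hUb
  obtain ⟨u, w, hI⟩ := mem_graph_systemOperator.1 hUV
  obtain ⟨-, hw1⟩ := hI.memory_eq hd hsym
  have hin0 : memoryInput p (-Complex.I * κ) ((-Complex.I * (κ : ℂ)) • U - V).snd = 0 := by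
    rw [hF, memoryInput]
    have : ∫ ξ, (p.eta ξ : ℂ) * ((WithLp.toLp 2 (φ, (0 : Lp ℂ 2 p.weightMeasure))).snd ξ
        / memorySymbol p (-Complex.I * κ) ξ) = ∫ _ : ℝ, (0 : ℂ) := by
      refine integral_congr_ae ?_
      filter_upwards [p.ae_iff.1 (Lp.coeFn_zero ℂ 2 p.weightMeasure)] with ξ hξ
      have : (WithLp.toLp 2 (φ, (0 : Lp ℂ 2 p.weightMeasure))).snd ξ = 0 := hξ
      rw [this]; simp
    rw [this]; simp
  rw [hin0, zero_add, ← hGd] at hw1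
  set ψ : L2Unit := U.fst with hψ
  have hψb : c * ‖ψ‖ ≤ ‖φ‖ := by
    have h1 : ‖(WithLp.toLp 2 (φ, (0 : Lp ℂ 2 p.weightMeasure)) : StateSpace p)‖ = ‖φ‖ := by
      refine (pow_left_inj₀ (norm_nonneg _) (norm_nonneg _) two_ne_zero).1 ?_
      rw [WithLp.prod_norm_sq_eq_of_L2]; simp
    have h2 : ‖ψ‖ ≤ ‖U‖ := by
      refine (pow_le_pow_iff_left₀ (norm_nonneg _) (norm_nonneg _) two_ne_zero).1 ?_
      rw [WithLp.prod_norm_sq_eq_of_L2]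
      exact le_add_of_nonneg_right (by positivity)
    rw [hF, h1] at hUb
    exact (mul_le_mul_of_nonneg_left h2 hc.le).trans hUb
  have hwd : ∀ᵐ x ∂unitMeasure, deriv w x = -κ * ψ x + Complex.I * φ x := by
    have h1 : (-Complex.I * (κ : ℂ)) • ψ - V.fst = φ :=
      congrArg (fun X : StateSpace p => X.fst) hF
    filter_upwards [hI.fst_eq, Lp.coeFn_sub ((-Complex.I * (κ : ℂ)) • ψ) V.fst,
      Lp.coeFn_smul (-Complex.I * (κ : ℂ)) ψ] with x h2 h3 h4
    rw [h1, Pi.sub_apply, h4, Pi.smul_apply, smul_eq_mul, h2] at h3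
    linear_combination -Complex.I * h3 + (deriv w x + κ * ψ x) * Complex.I_mul_I
  have hrepr : ψ =ᵐ[unitMeasure] u := hI.inDomain.repr
  have hu1 : ‖u 1‖ ^ 2 ≤ C * ((c⁻¹ + 1) * ‖φ‖) ^ 2 := by
    refine (htr u w (fun x => -Complex.I * φ x) hI.inDomain.memW hI.inDomain.memH2
      ((Lp.memLp φ).const_mul _) ?_ ?_).trans ?_
    · filter_upwards [hwd, hrepr] with x h1 h2
      rw [h1, h2]; ring
    · rw [hw1, norm_mul, norm_mul, Complex.norm_I, one_mul]
      exact mul_le_of_le_one_left (norm_nonneg _) hG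
    · rw [integral_sq_smul_le ψ (a := 1) (by filter_upwards [hrepr] with x hx; rw [hx, one_mul]),
        integral_sq_smul_le φ (a := -Complex.I) (Eventually.of_forall fun _ => rfl)]
      simp only [norm_neg, Complex.norm_I, norm_one, one_mul]
      have h1 : ‖ψ‖ ≤ c⁻¹ * ‖φ‖ := by rwa [le_inv_mul_iff₀ hc]
      have h2 : ‖ψ‖ ^ 2 ≤ (c⁻¹ * ‖φ‖) ^ 2 := by gcongr
      have h3 : 0 ≤ c⁻¹ * ‖φ‖ * ‖φ‖ := by positivity
      gcongr
      nlinarith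
  have ha1 : ‖a 1‖ ^ 2 ≤ C * (‖φ‖ + ‖r‖) ^ 2 := by
    refine (htr a z r ha hz (Lp.memLp r) ?_ ?_).trans ?_
    · filter_upwards [hza, hφ] with x h1 h2
      rw [h1, h2]
    · rw [hz1, norm_zero]; exact norm_nonneg _
    · rw [integral_sq_smul_le φ (a := 1) (by filter_upwards [hφ] with x hx; rw [hx, one_mul]),
        integral_sq_smul_le r (a := 1) (Eventually.of_forall fun _ => (one_mul _).symm)]
      simp only [norm_one, one_mul]
      have h3 : 0 ≤ ‖φ‖ * ‖r‖ := by positivity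
      gcongr
      nlinarith
  -- Green's formula
  have hg1 := green hτ ha hI.inDomain.memH2.flux_memH1 (hI.inDomain.memH2.flux_zero hτ)
  have hg2 := green hτ hI.inDomain.memW hz.flux_memH1 (hz.flux_zero hτ)
  have e1 : ∫ x in Ioo (0 : ℝ) 1, deriv w x * starRingEnd ℂ (a x)
      = -κ * inner ℂ φ ψ + Complex.I * inner ℂ φ φ := by
    rw [← inner_smul_right, ← inner_smul_right, ← inner_add_right, integral_conj_mul_eq_inner]
    refine integral_congr_ae ?_
    filter_upwards [hwd, hφ, Lp.coeFn_add ((-κ : ℂ) • ψ) (Complex.I • φ),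
      Lp.coeFn_smul (-κ : ℂ) ψ, Lp.coeFn_smul Complex.I φ] with x h1 h2 h3 h4 h5
    rw [h1, h3, Pi.add_apply, h4, h5, Pi.smul_apply, Pi.smul_apply, smul_eq_mul, smul_eq_mul, ← h2]
  have e2 : ∫ x in Ioo (0 : ℝ) 1, deriv z x * starRingEnd ℂ (u x)
      = -κ * inner ℂ ψ φ - inner ℂ ψ r := by
    rw [← inner_smul_right, ← inner_sub_right, integral_conj_mul_eq_inner]
    refine integral_congr_ae ?_
    filter_upwards [hza, hrepr, Lp.coeFn_sub ((-κ : ℂ) • φ) r,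
      Lp.coeFn_smul (-κ : ℂ) φ] with x h1 h2 h3 h4
    rw [h1, h3, Pi.sub_apply, h4, Pi.smul_apply, smul_eq_mul, ← h2]
  have e3 : ∫ x in Ioo (0 : ℝ) 1, z x * starRingEnd ℂ (deriv u x)
      = starRingEnd ℂ (∫ x in Ioo (0 : ℝ) 1, w x * starRingEnd ℂ (deriv a x)) := by
    rw [← integral_conj]
    refine integral_congr_ae ?_
    filter_upwards [hz.flux_eq, hI.inDomain.memH2.flux_eq] with x h1 h2
    rw [h1, h2, map_mul, map_mul, Complex.conj_ofReal, Complex.conj_conj]; ring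
  rw [e1, hw1] at hg1
  rw [e2, e3, hz1, zero_mul] at hg2
  have hg3 := congrArg (starRingEnd ℂ) hg2
  simp only [map_add, map_sub, map_mul, map_neg, map_zero, Complex.conj_ofReal, Complex.conj_conj,
    inner_conj_symm] at hg3
  -- Testing each solution against the other cancels the energy and the κ terms. What is left is
  -- ‖φ‖², the residual r, and a boundary term carrying the small factor G.
  have key : Complex.I * inner ℂ φ φ = -inner ℂ r ψ + Complex.I * (G * u 1) * starRingEnd ℂ (a 1) := by
    linear_combination hg1 - hg3
  have hn := congrArg norm key
  rw [norm_mul, Complex.norm_I, one_mul, inner_self_eq_norm_sq_to_K] at hn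
  simp only [Complex.coe_algebraMap, norm_pow, Complex.norm_real, norm_norm] at hn
  have hn2 : ‖φ‖ ^ 2 ≤ ‖r‖ * ‖ψ‖ + ‖G‖ * (‖u 1‖ * ‖a 1‖) := by
    rw [hn]
    refine (norm_add_le _ _).trans (add_le_add ?_ (le_of_eq ?_))
    · rw [norm_neg]; exact norm_inner_le_norm _ _
    · rw [norm_mul, norm_mul, norm_mul, Complex.norm_I, RCLike.norm_conj]; ring
  have hua : ‖u 1‖ * ‖a 1‖ ≤ C * (((c⁻¹ + 1) * ‖φ‖) * (‖φ‖ + ‖r‖)) := by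
    refine (pow_le_pow_iff_left₀ (by positivity) (by positivity) two_ne_zero).1 ?_
    calc (‖u 1‖ * ‖a 1‖) ^ 2 = ‖u 1‖ ^ 2 * ‖a 1‖ ^ 2 := by ring
      _ ≤ (C * ((c⁻¹ + 1) * ‖φ‖) ^ 2) * (C * (‖φ‖ + ‖r‖) ^ 2) := by gcongr
      _ = _ := by ring
  have hψ' : ‖ψ‖ ≤ c⁻¹ * ‖φ‖ := by rwa [le_inv_mul_iff₀ hc]
  -- The smallness condition on G makes the boundary term at most ½‖φ‖(‖φ‖ + ‖r‖), and its first
  -- half is absorbed.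
  have hfin : ‖φ‖ * ‖φ‖ ≤ (‖r‖ * c⁻¹ + 1 / 2 * (‖φ‖ + ‖r‖)) * ‖φ‖ := by
    have h1 : ‖r‖ * ‖ψ‖ ≤ ‖r‖ * (c⁻¹ * ‖φ‖) := by gcongr
    have h2 : ‖G‖ * (‖u 1‖ * ‖a 1‖) ≤ ‖G‖ * (C * (((c⁻¹ + 1) * ‖φ‖) * (‖φ‖ + ‖r‖))) := by gcongr
    have h3 : ‖G‖ * (C * (c⁻¹ + 1)) * (‖φ‖ * (‖φ‖ + ‖r‖)) ≤ 1 / 2 * (‖φ‖ * (‖φ‖ + ‖r‖)) := by gcongr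
    nlinarith
  rcases (norm_nonneg φ).eq_or_lt with h0 | h0
  · rw [← h0]; positivity
  · have := le_of_mul_le_mul_right hfin h0
    linarith

/-- The indicator function of `(1/2, 1)` has no representative that is continuous on `(0,1]`. -/
lemma not_continuous_indicator {u : ℝ → ℂ} (hc : ContinuousOn u (Ioc 0 1))
    (h : ∀ᵐ x ∂unitMeasure, u x = (Ioo (1 / 2 : ℝ) 1).indicator (fun _ => (1 : ℂ)) x) : False := by
  have hhalf : (1 / 2 : ℝ) ∈ Ioc (0 : ℝ) 1 := by constructor <;> norm_num
  have hcont : ContinuousAt u (1 / 2) :=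
    hc.continuousAt (Ioc_mem_nhds (by norm_num) (by norm_num))
  have h1 : EqOn u (fun _ => 1) (Ioo (1 / 2 : ℝ) 1) := by
    refine Measure.eqOn_open_of_ae_eq (μ := volume) ?_ isOpen_Ioo
      (hc.mono fun x hx => ⟨by linarith [hx.1], hx.2.le⟩) continuousOn_const
    filter_upwards [ae_restrict_of_ae_restrict_of_subset (Ioo_subset_Ioo (by norm_num) le_rfl) h,
      ae_restrict_mem measurableSet_Ioo] with x hx hx1
    rw [hx, indicator_of_mem hx1]
  have h2 : EqOn u (fun _ => 0) (Ioo 0 (1 / 2 : ℝ)) := by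
    refine Measure.eqOn_open_of_ae_eq (μ := volume) ?_ isOpen_Ioo
      (hc.mono fun x hx => ⟨hx.1, by linarith [hx.2]⟩) continuousOn_const
    filter_upwards [ae_restrict_of_ae_restrict_of_subset (Ioo_subset_Ioo le_rfl (by norm_num)) h,
      ae_restrict_mem measurableSet_Ioo] with x hx hx1
    rw [hx, indicator_of_notMem (fun hh => by linarith [hh.1, hx1.2])]
  have t1 : Tendsto u (𝓝[>] (1 / 2)) (𝓝 1) := by
    refine tendsto_const_nhds.congr' ?_
    filter_upwards [Ioo_mem_nhdsGT (show (1 / 2 : ℝ) < 1 by norm_num)] with x hx using (h1 hx).symm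
  have t2 : Tendsto u (𝓝[<] (1 / 2)) (𝓝 0) := by
    refine tendsto_const_nhds.congr' ?_
    filter_upwards [Ioo_mem_nhdsLT (show (0 : ℝ) < 1 / 2 by norm_num)] with x hx using (h2 hx).symm
  have e1 := tendsto_nhds_unique t1 (hcont.mono_left nhdsWithin_le_nhds)
  have e2 := tendsto_nhds_unique t2 (hcont.mono_left nhdsWithin_le_nhds)
  exact one_ne_zero (e1.trans e2.symm)

/-- A uniform resolvent bound on the axis would leave the Neumann operator without large spectrum,
hence bounded, so its resolvent T would be onto L². But every T f has a representative continuous on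
(0,1]. -/
theorem not_exponentiallyStable (hτ : IsDegenerateCoeff τ)
    {S : NNReal → StateSpace p →L[ℂ] StateSpace p} (hS : IsGeneratedBy S (systemOperator τ p)) :
    ¬ ExponentiallyStable S := by
  intro hE
  obtain ⟨c, hc, hb⟩ := hE.exists_boundedBelow hS
  obtain ⟨C, hC, K, hK, htr⟩ := exists_sq_trace_le hτ
  obtain ⟨T, hT, hpos, hinj, hrep⟩ := exists_neumannResolvent hτ
  have hD : 0 < C * (c⁻¹ + 1) := by positivity
  have hev : ∀ᶠ κ : ℝ in atTop, K ≤ κ ∧ ‖transferFun p (-Complex.I * κ)‖ ≤ 1 ∧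
      ‖transferFun p (-Complex.I * κ)‖ * (C * (c⁻¹ + 1)) ≤ 1 / 2 := by
    filter_upwards [eventually_ge_atTop K, (tendsto_transferFun p).eventually_le_const one_pos,
      (tendsto_transferFun p).eventually_le_const (u := 1 / 2 / (C * (c⁻¹ + 1))) (by positivity)]
      with κ h1 h2 h3
    exact ⟨h1, h2, by rwa [le_div_iff₀ hD] at h3⟩
  obtain ⟨N, hN⟩ := eventually_atTop.1 hev
  have hunit : IsUnit T := by
    -- A value t of T corresponds to the Neumann parameter κ = 1/t - 1, so large κ means small t.
    refine isUnit_of_spectral_gap hT hpos hinj (t₀ := 1 / (1 + max N 1)) (by positivity)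
      fun t ht => ?_
    have ht0 := ht.1
    set κ : ℝ := 1 / t - 1 with hκ
    have hNκ : max N 1 ≤ κ := by
      have h1 := ht.2.le
      rw [le_div_iff₀ (by positivity)] at h1
      rw [hκ, le_sub_iff_add_le, le_div_iff₀ ht0]; linarith
    have hκ1 : 1 ≤ κ := (le_max_right _ _).trans hNκ
    obtain ⟨k1, k2, k3⟩ := hN κ ((le_max_left _ _).trans hNκ)
    have htk : t * (1 + κ) = 1 := by rw [hκ]; field_simp; ring
    -- With e = T f - t f one has f = (1 + κ)(T f - e), and T f solves the Neumann equation at κ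
    -- with residual -(1 + κ)e. The comparison estimate then bounds ‖f‖ by M‖e‖.
    set M : ℝ := (1 + κ) * ((2 * c⁻¹ + 1) * (1 + κ) + 1) with hM
    have hM0 : 0 < M := by positivity
    refine ⟨M⁻¹, by positivity, fun f => ?_⟩
    rw [inv_mul_le_iff₀ hM0]
    set e : L2Unit := T f - (t : ℂ) • f with he
    have hf : f = ((1 + κ : ℝ) : ℂ) • (T f - e) := by
      rw [he, sub_sub_cancel, smul_smul, ← Complex.ofReal_mul, mul_comm, htk, Complex.ofReal_one,
        one_smul]
    obtain ⟨a, z, q1, q2, q3, q4, q5⟩ := hrep f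
    have hφ : ‖T f‖ ≤ (2 * c⁻¹ + 1) * ‖(-(1 + κ : ℝ) : ℂ) • e‖ := by
      refine norm_le_of_boundedBelow hτ hc hC (by linarith) (hb (-κ)) (fun u w f' => htr κ k1 u w f')
        k2 k3 q1 q2 q3 ?_ q5
      have hfx : ∀ᵐ x ∂unitMeasure, f x = ((1 + κ : ℝ) : ℂ) * (T f x - e x) := by
        filter_upwards [Lp.coeFn_smul ((1 + κ : ℝ) : ℂ) (T f - e), Lp.coeFn_sub (T f) e]
          with x h1 h2
        rw [← hf, Pi.smul_apply, h2] at h1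
        exact h1
      filter_upwards [q4, hfx, Lp.coeFn_smul (-(1 + κ : ℝ) : ℂ) e] with x h1 h2 h3
      rw [h1, h3, h2, Pi.smul_apply, smul_eq_mul]; push_cast; ring
    have hk : ‖(-(1 + κ : ℝ) : ℂ)‖ = 1 + κ := by
      rw [norm_neg, Complex.norm_real, Real.norm_of_nonneg (by linarith)]
    rw [norm_smul, hk] at hφ
    have hff : ‖f‖ = (1 + κ) * ‖T f - e‖ := by
      conv_lhs => rw [hf]
      rw [norm_smul, Complex.norm_real, Real.norm_of_nonneg (by linarith)]
    rw [hff, hM, mul_assoc]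
    refine mul_le_mul_of_nonneg_left ((norm_sub_le _ _).trans ?_) (by linarith)
    linarith
  have hχ : MemLp ((Ioo (1 / 2 : ℝ) 1).indicator fun _ => (1 : ℂ)) 2 unitMeasure :=
    (memLp_const 1).indicator measurableSet_Ioo
  obtain ⟨f, hf⟩ := (ContinuousLinearMap.isUnit_iff_bijective.1 hunit).2 hχ.toLp
  obtain ⟨u, w, h1, -, h2, -, -⟩ := hrep f
  refine not_continuous_indicator h1.memH1.locAbsCont.continuousOn ?_
  rw [hf] at h2
  filter_upwards [h2, hχ.coeFn_toLp] with x h3 h4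
  rw [← h3, h4]

end Neumann

/-! ### Entire solutions of the eigenvalue equation for power coefficients -/

section PowerSeries

/-- A power series with coefficients bounded by `1 / k!` is differentiable term by term. -/
lemma hasDerivAt_tsum_pow {a : ℕ → ℂ} (ha : ∀ k, ‖a k‖ ≤ 1 / (k.factorial : ℝ)) (z : ℂ) :
    HasDerivAt (fun z => ∑' k, a k * z ^ k) (∑' k : ℕ, ((k : ℂ) + 1) * a (k + 1) * z ^ k) z := by
  set R := ‖z‖ + 1 with hR
  have hR0 : 0 ≤ R := by positivity
  have hu : Summable fun k : ℕ => (1 / (k.factorial : ℝ)) * (k * R ^ (k - 1)) := by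
    rw [← summable_nat_add_iff 1]
    refine (Real.summable_pow_div_factorial R).congr fun k => ?_
    rw [Nat.factorial_succ, Nat.add_sub_cancel]
    push_cast
    field_simp
  have hbound : ∀ (k : ℕ) y, y ∈ Metric.ball (0 : ℂ) R →
      ‖a k * (k * y ^ (k - 1))‖ ≤ (1 / (k.factorial : ℝ)) * (k * R ^ (k - 1)) := by
    intro k y hy
    rw [mem_ball_zero_iff] at hy
    rw [norm_mul, norm_mul, norm_pow, Complex.norm_natCast]
    gcongr
    exact ha k
  have hz : z ∈ Metric.ball (0 : ℂ) R := by rw [mem_ball_zero_iff, hR]; linarith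
  have h := hasDerivAt_tsum_of_isPreconnected (g := fun k z => a k * z ^ k)
    (g' := fun k z => a k * (k * z ^ (k - 1))) hu Metric.isOpen_ball
    (convex_ball (0 : ℂ) R).isPreconnected
    (fun k y _ => (hasDerivAt_pow k y).const_mul (a k)) hbound
    (Metric.mem_ball_self (by rw [hR]; positivity))
    (summable_of_ne_finset_zero (s := {0}) fun k hk => by
      rw [Finset.mem_singleton] at hk
      simp [hk]) hz
  have hs : Summable fun k : ℕ => a k * (k * z ^ (k - 1)) :=
    Summable.of_norm_bounded hu fun k => hbound k z hz
  rw [hs.tsum_eq_zero_add] at h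
  simp only [Nat.cast_zero, zero_mul, mul_zero, zero_add, Nat.add_sub_cancel] at h
  refine h.congr_deriv (tsum_congr fun k => ?_)
  push_cast; ring

lemma summable_tsum_pow {a : ℕ → ℂ} (ha : ∀ k, ‖a k‖ ≤ 1 / (k.factorial : ℝ)) (z : ℂ) :
    Summable fun k => a k * z ^ k := by
  refine Summable.of_norm_bounded (Real.summable_pow_div_factorial ‖z‖) fun k => ?_
  rw [norm_mul, norm_pow, div_eq_mul_one_div, mul_comm]
  gcongr
  exact ha k

/-- Coefficients of the solution of `m y f' + p f = g`, `g' = -f / m`. -/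
def besselCoeff (p m : ℝ) : ℕ → ℝ
  | 0 => 1
  | k + 1 => -besselCoeff p m k / ((p + m * (k + 1)) * (m * (k + 1)))

variable {p m : ℝ}

/-- The second bound concerns the coefficients (p + mk)aₖ of the flux function: the extra factor
cancels one denominator of the recursion, and the other still supplies the factorial. -/
lemma abs_besselCoeff_le (hp : 0 < p) (hm : 1 ≤ m) (k : ℕ) :
    |besselCoeff p m k| ≤ 1 / (k.factorial : ℝ) ∧
      |(p + m * (k + 1)) * besselCoeff p m (k + 1)| ≤ 1 / ((k + 1).factorial : ℝ) := by
  have hs : ∀ k : ℕ, |besselCoeff p m k| ≤ 1 / (k.factorial : ℝ) →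
      |(p + m * (k + 1)) * besselCoeff p m (k + 1)| ≤ 1 / ((k + 1).factorial : ℝ) := by
    intro k hk
    have e : (p + m * (k + 1)) * besselCoeff p m (k + 1) = -besselCoeff p m k / (m * (k + 1)) := by
      rw [besselCoeff]; field_simp
    rw [e, abs_div, abs_neg, abs_of_pos (show 0 < m * (k + 1) by positivity), Nat.factorial_succ]
    push_cast
    rw [mul_comm ((k : ℝ) + 1), ← div_div, ← div_div]
    refine div_le_div_of_nonneg_right ?_ (by positivity)
    exact (div_le_self (abs_nonneg _) hm).trans hk
  have h1 : |besselCoeff p m k| ≤ 1 / (k.factorial : ℝ) := by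
    induction k with
    | zero => simp [besselCoeff]
    | succ k ih =>
      refine le_trans ?_ (hs k ih)
      rw [abs_mul]
      refine le_mul_of_one_le_left (abs_nonneg _) ((le_abs_self _).trans' ?_)
      nlinarith [(Nat.cast_nonneg k : (0 : ℝ) ≤ k)]
  exact ⟨h1, hs k h1⟩

/-- The pair of entire functions describing the solutions of `(x ^ α uₓ)ₓ = -z u`. -/
structure IsBesselPair (p m : ℝ) (f g : ℂ → ℂ) : Prop where
  differentiable : Differentiable ℂ f
  flux : ∀ z, m * z * deriv f z + p * f z = g z
  hasDerivAt : ∀ z, HasDerivAt g (-f z / m) z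
  zero : f 0 = 1
  im_left : ∀ x : ℝ, (f x).im = 0
  im_right : ∀ x : ℝ, (g x).im = 0

/-- Comparing coefficients, m z f' + p f = g means bₖ = (p + mk)aₖ, and g' = -f/m means (k + 1)bₖ₊₁
= -aₖ/m. Together they are the recursion for `besselCoeff`. -/
lemma exists_isBesselPair (hp : 0 < p) (hp1 : p ≤ 1) (hm : 1 ≤ m) :
    ∃ f g, IsBesselPair p m f g := by
  set a : ℕ → ℂ := fun k => (besselCoeff p m k : ℂ) with ha
  set b : ℕ → ℂ := fun k => (((p + m * k) * besselCoeff p m k : ℝ) : ℂ) with hb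
  have ha1 : ∀ k, ‖a k‖ ≤ 1 / (k.factorial : ℝ) := fun k => by
    rw [ha, Complex.norm_real]; exact (abs_besselCoeff_le hp hm k).1
  have hb1 : ∀ k, ‖b k‖ ≤ 1 / (k.factorial : ℝ) := fun k => by
    rw [hb, Complex.norm_real, Real.norm_eq_abs]
    cases k with
    | zero => simpa [besselCoeff, abs_of_pos hp] using hp1
    | succ k => simpa using (abs_besselCoeff_le hp hm k).2
  have him : ∀ (d : ℕ → ℝ) (x : ℝ), (∑' k, (d k : ℂ) * (x : ℂ) ^ k).im = 0 := fun d x => by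
    have : ∑' k, (d k : ℂ) * (x : ℂ) ^ k = ((∑' k, d k * x ^ k : ℝ) : ℂ) := by
      rw [Complex.ofReal_tsum]; push_cast; rfl
    rw [this, Complex.ofReal_im]
  have hm0 : (m : ℂ) ≠ 0 := by exact_mod_cast (by linarith : m ≠ 0)
  refine ⟨fun z => ∑' k, a k * z ^ k, fun z => ∑' k, b k * z ^ k,
    fun z => (hasDerivAt_tsum_pow ha1 z).differentiableAt, fun z => ?_, fun z => ?_, ?_,
    him _, him _⟩
  · have hs2 : Summable fun k => (b k - p * a k) * z ^ k := by
      refine ((summable_tsum_pow hb1 z).sub ((summable_tsum_pow ha1 z).mul_left (p : ℂ))).congr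
        fun k => ?_
      ring
    have h0 : b 0 - p * a 0 = 0 := by simp [hb, ha]
    have e : ∑' k, (b k - p * a k) * z ^ k = m * z * ∑' k : ℕ, ((k : ℂ) + 1) * a (k + 1) * z ^ k := by
      rw [hs2.tsum_eq_zero_add, h0, zero_mul, zero_add, ← tsum_mul_left]
      refine tsum_congr fun k => ?_
      simp only [hb, ha]
      push_cast; ring
    rw [(hasDerivAt_tsum_pow ha1 z).deriv, ← e, ← tsum_mul_left,
      ← hs2.tsum_add ((summable_tsum_pow ha1 z).mul_left (p : ℂ))]
    refine tsum_congr fun k => ?_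
    ring
  · convert hasDerivAt_tsum_pow hb1 z using 1
    rw [neg_div, ← neg_div, div_eq_inv_mul, ← tsum_neg, ← tsum_mul_left]
    refine tsum_congr fun k => ?_
    simp only [hb, ha, besselCoeff]
    have h2 : ((k : ℂ) + 1) ≠ 0 := by exact_mod_cast k.succ_ne_zero
    have h3 : ((p : ℂ) + m * (k + 1)) ≠ 0 := by
      have : p + m * ((k : ℝ) + 1) ≠ 0 := by positivity
      exact_mod_cast this
    push_cast
    field_simp
  · rw [tsum_eq_single 0 fun k hk => by simp [hk]]
    simp [ha, besselCoeff]

/-- The flux function cannot stay positive. -/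
lemma not_forall_flux_pos (hp : 0 < p) (hpm : p < m) {f g : ℝ → ℝ} {x₀ : ℝ} (hx₀ : 0 < x₀)
    (hg : ∀ x, 0 < x → HasDerivAt g (-f x / m) x)
    (hf : ∀ x, 0 < x → HasDerivAt f ((g x - p * f x) / (m * x)) x) (hpos : ∀ x, x₀ ≤ x → 0 < g x) :
    False := by
  have hm : 0 < m := hp.trans hpm
  set ν := p / m with hν
  have hν0 : 0 < ν := by positivity
  have hν1 : ν < 1 := by rw [hν, div_lt_one hm]; exact hpm
  -- The integrating factor x^ν with ν = p/m turns m x f' + p f = g into a statement of monotonicity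
  -- of x^ν f while g > 0.
  have hd : ∀ x, 0 < x → HasDerivAt (fun x => x ^ ν * f x) (x ^ (ν - 1) * g x / m) x := by
    intro x hx
    refine ((Real.hasDerivAt_rpow_const (p := ν) (Or.inl hx.ne')).mul (hf x hx)).congr_deriv ?_
    rw [Real.rpow_sub_one hx.ne', hν]
    field_simp
    ring
  have hpow : ∀ (s : ℝ), s ≠ 0 → ∀ x, 0 < x → HasDerivAt (fun x => x ^ s / s) (x ^ (s - 1)) x :=
    fun s hs x hx => by
      refine ((Real.hasDerivAt_rpow_const (p := s) (Or.inl hx.ne')).div_const s).congr_deriv ?_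
      field_simp
  have hmono : ∀ (h h' : ℝ → ℝ) (y : ℝ), x₀ ≤ y → (∀ x, 0 < x → HasDerivAt h (h' x) x) →
      (∀ x, y ≤ x → 0 ≤ h' x) → ∀ x, y ≤ x → h y ≤ h x := by
    intro h h' y hy hh hn x hx
    refine monotoneOn_of_hasDerivWithinAt_nonneg (D := Ici y) (f' := h') (convex_Ici y)
      (fun t ht => (hh t (hx₀.trans_le (hy.trans ht))).continuousAt.continuousWithinAt)
      (fun t ht => ?_) (fun t ht => ?_) self_mem_Ici hx hx
    · rw [interior_Ici] at ht
      exact (hh t (hx₀.trans_le (hy.trans (le_of_lt ht)))).hasDerivWithinAt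
    · rw [interior_Ici] at ht
      exact hn t (le_of_lt ht)
  have hincr := fun y hy => hmono _ _ y hy hd fun x hx => by
    have h1 := hpos x (le_trans hy hx)
    have h2 : 0 < x := hx₀.trans_le (le_trans hy hx)
    positivity
  -- If f is positive once, then f ≥ c x^(-ν) from there on, so g' ≤ -(c/m) x^(-ν) with ν < 1 and g
  -- tends to -∞. Otherwise f ≤ 0, so g increases, stays above g(x₀), and x^ν f tends to +∞; both
  -- are impossible.
  by_cases hc : ∃ x₁, x₀ ≤ x₁ ∧ 0 < f x₁
  · obtain ⟨x₁, hx₁, hfx⟩ := hc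
    have hx₁0 : 0 < x₁ := hx₀.trans_le hx₁
    set c := x₁ ^ ν * f x₁ with hcdef
    have hc0 : 0 < c := by positivity
    have hle := hmono (fun x => -(g x + c / m * (x ^ (1 - ν) / (1 - ν)))) 
      (fun x => -(-f x / m + c / m * x ^ (1 - ν - 1))) x₁ hx₁
      (fun x hx => ((hg x hx).add ((hpow (1 - ν) (by linarith) x hx).const_mul _)).neg)
      (fun x hx => by
        have h2 : 0 < x := hx₁0.trans_le hx
        have h3 := hincr x₁ hx₁ x hx
        have h4 : x ^ (1 - ν - 1) = (x ^ ν)⁻¹ := by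
          rw [← Real.rpow_neg h2.le]; congr 1; ring
        have h5 : c * (x ^ ν)⁻¹ ≤ f x := by
          rw [mul_inv_le_iff₀ (by positivity), mul_comm]; exact h3
        have h6 : -(-f x / m + c / m * x ^ (1 - ν - 1)) = (f x - c * (x ^ ν)⁻¹) / m := by
          rw [h4]; ring
        rw [h6]
        exact div_nonneg (by linarith) hm.le)
    have ht : Tendsto (fun x : ℝ => c / m * (x ^ (1 - ν) / (1 - ν))) atTop atTop :=
      ((tendsto_rpow_atTop (by linarith)).atTop_div_const (by linarith)).const_mul_atTop
        (by positivity)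
    obtain ⟨x, hx1, hx2⟩ := ((eventually_ge_atTop x₁).and
      (ht.eventually_gt_atTop (g x₁ + c / m * (x₁ ^ (1 - ν) / (1 - ν))))).exists
    have h1 := hle x hx1
    have h2 := hpos x (hx₁.trans hx1)
    linarith
  · push Not at hc
    have hg0 := hpos x₀ le_rfl
    have hgle := hmono g (fun x => -f x / m) x₀ le_rfl hg fun x hx =>
      div_nonneg (neg_nonneg.2 (hc x hx)) hm.le
    have hle := hmono (fun x => x ^ ν * f x - g x₀ / m * (x ^ ν / ν))
      (fun x => x ^ (ν - 1) * g x / m - g x₀ / m * x ^ (ν - 1)) x₀ le_rfl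
      (fun x hx => (hd x hx).sub ((hpow ν hν0.ne' x hx).const_mul _))
      (fun x hx => by
        have h2 : 0 < x := hx₀.trans_le hx
        have h3 : x ^ (ν - 1) * g x / m - g x₀ / m * x ^ (ν - 1)
            = x ^ (ν - 1) * (g x - g x₀) / m := by ring
        rw [h3]
        have := hgle x hx
        exact div_nonneg (mul_nonneg (by positivity) (by linarith)) hm.le)
    have ht : Tendsto (fun x : ℝ => g x₀ / m * (x ^ ν / ν)) atTop atTop :=
      ((tendsto_rpow_atTop hν0).atTop_div_const hν0).const_mul_atTop (by positivity)
    obtain ⟨x, hx1, hx2⟩ := ((eventually_ge_atTop x₀).and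
      (ht.eventually_gt_atTop (-(x₀ ^ ν * f x₀ - g x₀ / m * (x₀ ^ ν / ν))))).exists
    have h1 := hle x hx1
    have h2 := hc x hx1
    have h3 : 0 < x := hx₀.trans_le hx1
    have h4 : x ^ ν * f x ≤ 0 := mul_nonpos_of_nonneg_of_nonpos (by positivity) h2
    linarith

/-! ### Zeros of the flux function and of the characteristic function. -/

variable {f g : ℂ → ℂ}

lemma IsBesselPair.deriv_eq (h : IsBesselPair p m f g) (hm : m ≠ 0) {z : ℂ} (hz : z ≠ 0) :
    deriv f z = (g z - p * f z) / (m * z) := by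
  have hm' : (m : ℂ) ≠ 0 := by exact_mod_cast hm
  rw [eq_div_iff (mul_ne_zero hm' hz), ← h.flux z]; ring

/-- On the real axis both functions are real. Without zeros beyond N, g would keep one sign there,
and both signs are excluded by `not_forall_flux_pos` applied to (f, g) or (-f, -g). -/
lemma IsBesselPair.exists_flux_zero (h : IsBesselPair p m f g) (hp : 0 < p) (hpm : p < m) (N : ℝ) :
    ∃ Y : ℝ, N ≤ Y ∧ g Y = 0 := by
  have hm : 0 < m := hp.trans hpm
  by_contra hcon
  push Not at hcon
  set x₀ := max N 1 with hx₀
  have hx₀0 : 0 < x₀ := by positivity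
  set fr : ℝ → ℝ := fun x => (f x).re with hfr
  set gr : ℝ → ℝ := fun x => (g x).re with hgr
  have hfr' : ∀ x : ℝ, f x = fr x := fun x =>
    Complex.ext (Complex.ofReal_re _).symm (by rw [h.im_left, Complex.ofReal_im])
  have hgr' : ∀ x : ℝ, g x = gr x := fun x =>
    Complex.ext (Complex.ofReal_re _).symm (by rw [h.im_right, Complex.ofReal_im])
  have hgd : ∀ x, HasDerivAt gr (-fr x / m) x := fun x => by
    convert (h.hasDerivAt (x : ℂ)).real_of_complex using 1
    rw [hfr', ← Complex.ofReal_neg, ← Complex.ofReal_div, Complex.ofReal_re]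
  have hfd : ∀ x, 0 < x → HasDerivAt fr ((gr x - p * fr x) / (m * x)) x := fun x hx => by
    convert ((h.differentiable (x : ℂ)).hasDerivAt).real_of_complex using 1
    rw [h.deriv_eq hm.ne' (by exact_mod_cast hx.ne'), hfr', hgr', ← Complex.ofReal_mul,
      ← Complex.ofReal_mul, ← Complex.ofReal_sub, ← Complex.ofReal_div, Complex.ofReal_re]
  have hne : ∀ x, x₀ ≤ x → gr x ≠ 0 := fun x hx h0 =>
    hcon x ((le_max_left _ _).trans hx) (by rw [hgr', h0, Complex.ofReal_zero])
  have hcont : ContinuousOn gr (Ici x₀) := fun x _ => (hgd x).continuousAt.continuousWithinAt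
  have hsign : (∀ x, x₀ ≤ x → 0 < gr x) ∨ ∀ x, x₀ ≤ x → gr x < 0 := by
    by_contra hs
    push Not at hs
    obtain ⟨⟨x, hx, hx'⟩, y, hy, hy'⟩ := hs
    obtain ⟨t, ht, ht'⟩ := (isPreconnected_Ici.image gr hcont).Icc_subset
      (mem_image_of_mem _ hx) (mem_image_of_mem _ hy) ⟨hx', hy'⟩
    exact hne t ht ht'
  rcases hsign with hs | hs
  · exact not_forall_flux_pos hp hpm hx₀0 (fun x _ => hgd x) hfd hs
  · refine not_forall_flux_pos (f := fun x => -fr x) (g := fun x => -gr x) hp hpm hx₀0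
      (fun x _ => ?_) (fun x hx => ?_) fun x hx => neg_pos.2 (hs x hx)
    · exact (hgd x).neg.congr_deriv (by ring)
    · exact (hfd x hx).neg.congr_deriv (by ring)

/-- Behaviour of the pair near a large zero of the flux function. -/
lemma IsBesselPair.near_zero (h : IsBesselPair p m f g) (hp : 0 < p) (hp1 : p ≤ 1) (hm : 1 ≤ m)
    {Y : ℝ} (hY : 16 ≤ Y) (h0 : g Y = 0) :
    f Y ≠ 0 ∧ ∀ t : ℂ, ‖t‖ ≤ 1 → ‖f (Y + t) - f Y‖ ≤ 1 / 2 * ‖f Y‖ ∧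
      ‖g (Y + t) + f Y * t / m‖ ≤ 1 / 2 * ‖f Y‖ * ‖t‖ / m := by
  have hm0 : 0 < m := by linarith
  have hY0 : (0 : ℝ) < Y := by linarith
  have hnm : ‖(m : ℂ)‖ = m := by rw [Complex.norm_real, Real.norm_of_nonneg hm0.le]
  set D := Metric.closedBall (Y : ℂ) 1 with hD
  have hDc : Convex ℝ D := convex_closedBall _ _
  have hYD : (Y : ℂ) ∈ D := Metric.mem_closedBall_self zero_le_one
  -- With M = max |f| on the unit disc about Y, the equations bootstrap: g(Y) = 0 and g' = -f/m give
  -- |g| ≤ M. Then |f'| = |g - pf|/|mz| ≤ 2M/8, so f varies by at most M/4 and M is comparable to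
  -- |f(Y)|.
  obtain ⟨z₀, hz₀, hmax⟩ := (isCompact_closedBall (Y : ℂ) 1).exists_isMaxOn ⟨_, hYD⟩
    h.differentiable.continuous.norm.continuousOn
  set M := ‖f z₀‖ with hM
  have hM0 : 0 ≤ M := norm_nonneg _
  have hfM : ∀ z ∈ D, ‖f z‖ ≤ M := fun z hz => hmax hz
  have hgM : ∀ z ∈ D, ‖g z‖ ≤ M := fun z hz => by
    have h1 := hDc.norm_image_sub_le_of_norm_hasDerivWithin_le (C := M)
      (fun x _ => (h.hasDerivAt x).hasDerivWithinAt) (fun x hx => by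
        rw [norm_div, norm_neg, hnm, div_le_iff₀ hm0]
        nlinarith [hfM x hx]) hYD hz
    rw [h0, sub_zero] at h1
    refine h1.trans (mul_le_of_le_one_right hM0 ?_)
    rwa [hD, mem_closedBall_iff_norm] at hz
  have hzn : ∀ z ∈ D, Y / 2 ≤ ‖z‖ := fun z hz => by
    rw [hD, mem_closedBall_iff_norm] at hz
    have h1 : ‖(Y : ℂ)‖ = Y := by rw [Complex.norm_real, Real.norm_of_nonneg hY0.le]
    have h2 := norm_sub_norm_le (Y : ℂ) z
    rw [norm_sub_rev] at h2
    linarith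
  have hfd : ∀ z ∈ D, ‖deriv f z‖ ≤ 1 / 4 * M := fun z hz => by
    have h1 := hzn z hz
    have h2 : z ≠ 0 := norm_pos_iff.1 (by linarith)
    rw [h.deriv_eq hm0.ne' h2, norm_div, norm_mul, hnm, div_le_iff₀ (by positivity)]
    have h3 : ‖g z - p * f z‖ ≤ M + 1 * M := by
      refine (norm_sub_le _ _).trans (add_le_add (hgM z hz) ?_)
      rw [norm_mul, Complex.norm_real, Real.norm_of_nonneg hp.le]
      gcongr
      exact hfM z hz
    have h4 : 8 ≤ m * ‖z‖ := by nlinarith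
    nlinarith
  have hfdiff : ∀ z ∈ D, ‖f z - f Y‖ ≤ 1 / 4 * M := fun z hz => by
    refine (hDc.norm_image_sub_le_of_norm_hasDerivWithin_le (C := 1 / 4 * M)
      (fun x _ => (h.differentiable x).hasDerivAt.hasDerivWithinAt) hfd hYD hz).trans
      (mul_le_of_le_one_right (by positivity) ?_)
    rwa [hD, mem_closedBall_iff_norm] at hz
  have hMle : M ≤ 2 * ‖f Y‖ := by
    have h1 := hfdiff z₀ hz₀
    have h2 := norm_sub_norm_le (f z₀) (f Y)
    linarith
  have hfh : ∀ z ∈ D, ‖f z - f Y‖ ≤ 1 / 2 * ‖f Y‖ := fun z hz => by linarith [hfdiff z hz]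
  -- If f(Y) = 0, then f vanishes on the whole disc, hence identically, against f(0) = 1.
  refine ⟨fun hf0 => ?_, fun t ht => ?_⟩
  · have h1 : f =ᶠ[𝓝 (Y : ℂ)] fun _ => 0 := by
      filter_upwards [Metric.closedBall_mem_nhds (Y : ℂ) one_pos] with z hz
      have := hfh z hz
      rw [hf0, norm_zero, mul_zero, sub_zero] at this
      exact norm_le_zero_iff.1 this
    have h2 := AnalyticOnNhd.eq_of_eventuallyEq (fun z _ => h.differentiable.analyticAt z)
      (fun z _ => analyticAt_const) h1
    have h3 := h.zero
    rw [h2] at h3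
    exact zero_ne_one h3
  · have htD : (Y : ℂ) + t ∈ D := by rw [hD, mem_closedBall_iff_norm, add_sub_cancel_left]; exact ht
    refine ⟨hfh _ htD, ?_⟩
    have h1 := hDc.norm_image_sub_le_of_norm_hasDerivWithin_le (C := 1 / 2 * ‖f Y‖ / m)
      (f := fun z => g z + f Y * (z - Y) / m) (f' := fun z => -f z / m + f Y / m)
      (fun x _ => by
        have e := (((hasDerivAt_id x).sub_const (Y : ℂ)).const_mul (f Y)).div_const (m : ℂ)
        rw [mul_one] at e
        exact ((h.hasDerivAt x).add e).hasDerivWithinAt) (fun x hx => by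
        have : -f x / m + f Y / m = -(f x - f Y) / m := by ring
        rw [this, norm_div, norm_neg, hnm]
        gcongr
        exact hfh x hx) hYD htD
    simp only [add_sub_cancel_left, sub_self, mul_zero, zero_div, h0, add_zero, sub_zero] at h1
    exact h1.trans_eq (by ring)

/-- Zeros of the characteristic function of the damped system near the zeros of the flux function. -/
lemma IsBesselPair.exists_characteristic_zero (h : IsBesselPair p m f g) (hp : 0 < p) (hp1 : p ≤ 1)
    (hm : 1 ≤ m) {Y Γ : ℝ} (hY : 16 ≤ Y) (h0 : g Y = 0) {G : ℂ → ℂ} (hΓ : 0 < Γ)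
    (hΓ1 : 8 * m * Γ ≤ 1) (hG : ∀ t : ℂ, ‖t‖ ≤ 1 → ‖G (Y + t)‖ ≤ Γ)
    (hGd : ∀ t : ℂ, ‖t‖ ≤ 1 → DifferentiableAt ℂ G (Y + t)) :
    ∃ t : ℂ, ‖t‖ ≤ 8 * m * Γ ∧ f (Y + t) ≠ 0 ∧ g (Y + t) = G (Y + t) * f (Y + t) := by
  obtain ⟨ha, hnear⟩ := h.near_zero hp hp1 hm hY h0
  have hm0 : 0 < m := by linarith
  have hnm : ‖(m : ℂ)‖ = m := by rw [Complex.norm_real, Real.norm_of_nonneg hm0.le]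
  have hb : 0 < ‖f Y‖ := norm_pos_iff.2 ha
  have hf1 : ∀ t : ℂ, ‖t‖ ≤ 1 → ‖f (Y + t)‖ ≤ 3 / 2 * ‖f Y‖ ∧ f (Y + t) ≠ 0 := fun t ht => by
    have h1 := (hnear t ht).1
    have h2 := norm_sub_norm_le (f (Y + t)) (f Y)
    refine ⟨by linarith, fun h3 => ?_⟩
    rw [h3, zero_sub, norm_neg] at h1
    linarith
  -- The radius is chosen so that on |t| = r the linear term f(Y)t/m has size 8Γ|f(Y)|. Its error is
  -- at most 4Γ|f(Y)| and the perturbation Gf at most (3/2)Γ|f(Y)|, leaving |B| ≥ (5/2)Γ|f(Y)|. At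
  -- the centre |B| ≤ Γ|f(Y)|. Without a zero, 1/B would violate the maximum principle.
  set r := 8 * m * Γ with hr
  have hr0 : 0 < r := by positivity
  set B : ℂ → ℂ := fun t => g (Y + t) - G (Y + t) * f (Y + t) with hB
  by_contra hcon
  have hB0 : ∀ t : ℂ, ‖t‖ ≤ r → B t ≠ 0 := fun t ht hBt =>
    hcon ⟨t, ht, (hf1 t (ht.trans hΓ1)).2, sub_eq_zero.1 hBt⟩
  have hBd : ∀ t : ℂ, ‖t‖ ≤ 1 → DifferentiableAt ℂ B t := fun t ht => by
    have e : DifferentiableAt ℂ (fun t : ℂ => (Y : ℂ) + t) t := by fun_prop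
    have d1 : DifferentiableAt ℂ (fun t : ℂ => g (Y + t)) t :=
      DifferentiableAt.comp t (h.hasDerivAt _).differentiableAt e
    have d2 : DifferentiableAt ℂ (fun t : ℂ => f (Y + t)) t :=
      DifferentiableAt.comp t (h.differentiable _) e
    have d3 : DifferentiableAt ℂ (fun t : ℂ => G (Y + t)) t :=
      DifferentiableAt.comp t (hGd t ht) e
    exact d1.sub (d3.mul d2)
  have hdc : DiffContOnCl ℂ (fun t => (B t)⁻¹) (Metric.ball (0 : ℂ) r) := by
    refine DifferentiableOn.diffContOnCl fun t ht => ?_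
    rw [closure_ball _ hr0.ne', mem_closedBall_zero_iff] at ht
    exact ((hBd t (ht.trans hΓ1)).inv (hB0 t ht)).differentiableWithinAt
  have hfr : ∀ t ∈ frontier (Metric.ball (0 : ℂ) r), ‖(B t)⁻¹‖ ≤ (5 / 2 * Γ * ‖f Y‖)⁻¹ := by
    intro t ht
    rw [frontier_ball _ hr0.ne', mem_sphere_zero_iff_norm] at ht
    have ht1 : ‖t‖ ≤ 1 := ht.le.trans hΓ1
    rw [norm_inv]
    refine inv_anti₀ (by positivity) ?_
    have h1 := (hnear t ht1).2
    have h2 : ‖G (Y + t) * f (Y + t)‖ ≤ Γ * (3 / 2 * ‖f Y‖) := by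
      rw [norm_mul]
      gcongr
      · exact hG t ht1
      · exact (hf1 t ht1).1
    have h3 : ‖f Y * t / m‖ = 8 * Γ * ‖f Y‖ := by
      rw [norm_div, norm_mul, ht, hnm, hr]; field_simp
    have h4 : 1 / 2 * ‖f Y‖ * ‖t‖ / m = 4 * Γ * ‖f Y‖ := by
      rw [ht, hr]; field_simp; norm_num
    rw [h4] at h1
    have h5 : f Y * t / m = (g (Y + t) + f Y * t / m) - G (Y + t) * f (Y + t) - B t := by
      simp only [hB]; ring
    have h6 := (norm_sub_le (g (Y + t) + f Y * t / m - G (Y + t) * f (Y + t)) (B t))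
    rw [← h5, h3] at h6
    have h7 := norm_sub_le (g (Y + t) + f Y * t / m) (G (Y + t) * f (Y + t))
    linarith
  have hmax := Complex.norm_le_of_forall_mem_frontier_norm_le Metric.isBounded_ball hdc hfr
    (subset_closure (Metric.mem_ball_self hr0))
  have hB00 : ‖B 0‖ ≤ Γ * ‖f Y‖ := by
    have h1 := hG 0 (by simp)
    simp only [hB, add_zero, h0, zero_sub, norm_neg, norm_mul] at h1 ⊢
    gcongr
  have hpos : 0 < ‖B 0‖ := norm_pos_iff.2 (hB0 0 (by simpa using hr0.le))
  rw [norm_inv, inv_le_inv₀ hpos (by positivity)] at hmax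
  nlinarith [mul_pos hΓ hb]

end PowerSeries

/-! ### Eigenvalues for power coefficients -/

section Eigenvalues

variable {α : ℝ} {f g : ℂ → ℂ} {p : DampingParams}

/-- The solution `x ^ (1 - α) f(z x ^ (2 - α))` of `(x ^ α uₓ)ₓ = -z u`. -/
def powerSolution (α : ℝ) (f : ℂ → ℂ) (z : ℂ) (x : ℝ) : ℂ :=
  ((x ^ (1 - α) : ℝ) : ℂ) * f (z * ((x ^ (2 - α) : ℝ) : ℂ))

/-- The flux `g(z x ^ (2 - α))` of `powerSolution`. -/
def powerFlux (α : ℝ) (g : ℂ → ℂ) (z : ℂ) (x : ℝ) : ℂ :=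
  g (z * ((x ^ (2 - α) : ℝ) : ℂ))

lemma IsBesselPair.hasDerivAt_powerSolution (h : IsBesselPair (1 - α) (2 - α) f g) (z : ℂ) {x : ℝ}
    (hx : 0 < x) :
    HasDerivAt (powerSolution α f z) (((x ^ α : ℝ) : ℂ)⁻¹ * powerFlux α g z x) x := by
  have d1 := (Real.hasDerivAt_rpow_const (p := 1 - α) (Or.inl hx.ne')).ofReal_comp
  have d2 := (Real.hasDerivAt_rpow_const (p := 2 - α) (Or.inl hx.ne')).ofReal_comp
  have d3 := (h.differentiable (z * ((x ^ (2 - α) : ℝ) : ℂ))).hasDerivAt.comp x (d2.const_mul z)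
  refine (d1.mul d3).congr_deriv ?_
  rw [powerFlux, ← h.flux]
  simp only [Function.comp_apply]
  generalize f (z * ((x ^ (2 - α) : ℝ) : ℂ)) = A
  generalize deriv f (z * ((x ^ (2 - α) : ℝ) : ℂ)) = B
  have hX : x ^ α ≠ 0 := (Real.rpow_pos_of_pos hx α).ne'
  have e1 : x ^ (1 - α) = x / x ^ α := by rw [Real.rpow_sub hx, Real.rpow_one]
  have e2 : x ^ (2 - α) = x ^ 2 / x ^ α := by rw [Real.rpow_sub hx, Real.rpow_two]
  have e3 : x ^ (1 - α - 1) = 1 / x ^ α := by rw [Real.rpow_sub_one hx.ne', e1]; field_simp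
  have e4 : x ^ (2 - α - 1) = x / x ^ α := by rw [Real.rpow_sub_one hx.ne', e2]; field_simp
  rw [e3, e4, e1, e2]
  have hX' : ((x ^ α : ℝ) : ℂ) ≠ 0 := by exact_mod_cast hX
  push_cast
  field_simp
  ring

lemma IsBesselPair.hasDerivAt_powerFlux (h : IsBesselPair (1 - α) (2 - α) f g) (hα : α < 1) (z : ℂ)
    {x : ℝ} (hx : 0 < x) : HasDerivAt (powerFlux α g z) (-z * powerSolution α f z x) x := by
  have d2 := (Real.hasDerivAt_rpow_const (p := 2 - α) (Or.inl hx.ne')).ofReal_comp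
  refine ((h.hasDerivAt (z * ((x ^ (2 - α) : ℝ) : ℂ))).comp x (d2.const_mul z)).congr_deriv ?_
  have hm : ((2 - α : ℝ) : ℂ) ≠ 0 := by exact_mod_cast (by linarith : 2 - α ≠ 0)
  rw [powerSolution, show 2 - α - 1 = 1 - α by ring, Complex.ofReal_mul]
  field_simp

lemma IsBesselPair.contDiff_powerFlux (h : IsBesselPair (1 - α) (2 - α) f g) (hα : α < 1) (z : ℂ) :
    ContDiff ℝ 1 (powerFlux α g z) := by
  have hg : ContDiff ℂ 1 g :=
    Differentiable.contDiff fun z => (h.hasDerivAt z).differentiableAt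
  have hx : ContDiff ℝ 1 fun x : ℝ => z * ((x ^ (2 - α) : ℝ) : ℂ) :=
    contDiff_const.mul (Complex.ofRealCLM.contDiff.comp
      (Real.contDiff_rpow_const_of_le (by norm_num; linarith)))
  exact (hg.restrict_scalars ℝ).comp hx

lemma IsBesselPair.continuous_powerSolution (h : IsBesselPair (1 - α) (2 - α) f g) (hα : α < 1)
    (z : ℂ) : Continuous (powerSolution α f z) :=
  (Complex.continuous_ofReal.comp (Real.continuous_rpow_const (by linarith))).mul
    (h.differentiable.continuous.comp (continuous_const.mul
      (Complex.continuous_ofReal.comp (Real.continuous_rpow_const (by linarith)))))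

lemma memLp_of_continuous {u : ℝ → ℂ} (hu : Continuous u) : MemLp u 2 unitMeasure := by
  obtain ⟨C, hC⟩ := isCompact_Icc.exists_bound_of_continuousOn (hu.continuousOn (s := Icc 0 1))
  refine MemLp.of_bound hu.aestronglyMeasurable C ?_
  filter_upwards [ae_restrict_mem measurableSet_Ioo] with x hx using hC x (Ioo_subset_Icc_self hx)

/-- The factor x^(1-α) provides the Dirichlet condition at 0, and the flux is C¹ because 2 - α > 1.
Then √τ uₓ = τ^(-1/2) w is square integrable since α < 1. -/
lemma IsBesselPair.memH2Weighted (h : IsBesselPair (1 - α) (2 - α) f g) (hα0 : 0 < α) (hα : α < 1)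
    (z : ℂ) :
    MemW (fun x : ℝ => x ^ α) (powerSolution α f z) ∧
      MemH2Weighted (fun x : ℝ => x ^ α) (powerSolution α f z) (powerFlux α g z) := by
  have hτ := isDegenerateCoeff_rpow hα0 hα
  have hidx := degeneracyIndex_rpow hα0
  have hwc := h.contDiff_powerFlux hα z
  have hwH1 : MemH1 (powerFlux α g z) :=
    ⟨hwc.contDiffOn.absolutelyContinuousOnInterval, memLp_of_continuous (hwc.continuous_deriv le_rfl)⟩
  have hflux : ∀ x ∈ Ioc (0 : ℝ) 1,
      powerFlux α g z x = ((x ^ α : ℝ) : ℂ) * deriv (powerSolution α f z) x := fun x hx => by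
    have hX : ((x ^ α : ℝ) : ℂ) ≠ 0 := by exact_mod_cast (Real.rpow_pos_of_pos hx.1 α).ne'
    rw [(h.hasDerivAt_powerSolution z hx.1).deriv, mul_inv_cancel_left₀ hX]
  have hH1 : MemH1Weighted (fun x : ℝ => x ^ α) (powerSolution α f z) := by
    refine ⟨memLp_of_continuous (h.continuous_powerSolution hα z), fun ε hε => ?_, ?_⟩
    · refine ContDiffOn.absolutelyContinuousOnInterval fun x hx => ?_
      rw [uIcc_of_le hε.2.le] at hx
      have hx0 : x ≠ 0 := (hε.1.trans_le hx.1).ne'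
      have e : ∀ s : ℝ, ContDiffAt ℝ 1 (fun x : ℝ => ((x ^ s : ℝ) : ℂ)) x := fun s =>
        Complex.ofRealCLM.contDiff.contDiffAt.comp x (Real.contDiffAt_rpow_const_of_ne hx0)
      have hf : ContDiff ℂ 1 f := h.differentiable.contDiff
      exact ((e _).mul ((hf.restrict_scalars ℝ).contDiffAt.comp x
        (contDiffAt_const.mul (e _)))).contDiffWithinAt
    · refine (hwH1.memLp_invSqrt_mul hτ fun h1 => by rw [hidx] at h1; linarith).ae_eq ?_
      filter_upwards [ae_restrict_mem measurableSet_Ioo] with x hx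
      have h2 := sqrt_mul_invSqrt hτ (Ioo_subset_Ioc_self hx)
      have h3 : invSqrt (fun x : ℝ => x ^ α) x * x ^ α = Real.sqrt (x ^ α) := by
        have hX := Real.mul_self_sqrt (Real.rpow_pos_of_pos hx.1 α).le
        linear_combination -invSqrt (fun x : ℝ => x ^ α) x * hX + Real.sqrt (x ^ α) * h2
      rw [hflux x (Ioo_subset_Ioc_self hx), ← mul_assoc, ← Complex.ofReal_mul, h3]
  refine ⟨⟨hH1, fun _ => ?_⟩, hH1, ?_, hwH1⟩
  · have h0 : powerSolution α f z 0 = 0 := by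
      rw [powerSolution, Real.zero_rpow (by linarith), Complex.ofReal_zero, zero_mul]
    have := (h.continuous_powerSolution hα z).tendsto 0
    rw [h0] at this
    exact this.mono_left nhdsWithin_le_nhds
  · filter_upwards [ae_restrict_mem measurableSet_Ioo] with x hx
      using hflux x (Ioo_subset_Ioc_self hx)

/-- For λ = -iz and zero data the reduced boundary condition w(1) = i G(λ) u(1) is the
characteristic equation, as u(1) = f(z) and w(1) = g(z). The trace f(z) ≠ 0 makes the eigenvector
nonzero. -/
lemma IsBesselPair.exists_eigenvector (h : IsBesselPair (1 - α) (2 - α) f g) (hα0 : 0 < α)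
    (hα : α < 1) {z : ℂ} (hz : z.re ≠ 0)
    (hchar : g z = Complex.I * transferFun p (-Complex.I * z) * f z) (hfz : f z ≠ 0) :
    ∃ U : StateSpace p, U ≠ 0 ∧
      (U, (-Complex.I * z) • U) ∈ (systemOperator (fun x : ℝ => x ^ α) p).graph := by
  have him : (-Complex.I * z).im ≠ 0 := by simpa using hz
  obtain ⟨c, hc, hsym⟩ := symbolBound_of_im_ne_zero p him
  obtain ⟨hW, hH2⟩ := h.memH2Weighted hα0 hα z
  have hu1 : powerSolution α f z 1 = f z := by simp [powerSolution]
  have hw1 : powerFlux α g z 1 = g z := by simp [powerFlux]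
  have hϑ : MemLp (fun ξ => ((0 : ℂ) + p.eta ξ * powerSolution α f z 1)
      / memorySymbol p (-Complex.I * z) ξ) 2 volume := by
    refine ((hsym.memLp_eta_div hc).mul_const (powerSolution α f z 1)).ae_eq
      (Eventually.of_forall fun ξ => ?_)
    simp only []; ring
  have hψ := hW.memH1.memLp
  set U : StateSpace p := mkState hψ.toLp hϑ with hU
  have hfst : U.fst =ᵐ[unitMeasure] powerSolution α f z := hψ.coeFn_toLp
  refine ⟨U, fun h0 => ?_, mem_graph_systemOperator.2 ⟨_, _,
    isImage_of_solution (f := fun _ => 0) hc hsym MemLp.zero hW hH2 ?_ hfst (mkState_snd _ hϑ)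
      ?_ ?_⟩⟩
  · have h1 : powerSolution α f z =ᵐ[unitMeasure] 0 := by
      rw [h0] at hfst
      exact hfst.symm.trans (Lp.coeFn_zero _ _ _)
    have h2 := eq_zero_of_ae hW.memH1.locAbsCont.continuousOn h1 1 ⟨one_pos, le_rfl⟩
    exact hfz (hu1.symm.trans h2)
  · rw [hw1, hu1, hchar, memoryInput]
    simp only [zero_div, mul_zero, integral_zero, zero_add]
    ring
  · filter_upwards [hfst, Lp.coeFn_smul (-Complex.I * z) U.fst, ae_restrict_mem measurableSet_Ioo]
      with x h1 h2 hx
    refine h2.trans ?_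
    rw [(h.hasDerivAt_powerFlux hα z hx.1).deriv, Pi.smul_apply, h1, smul_eq_mul]
    ring
  · filter_upwards [snd_smul_ae p (-Complex.I * z) U] with ξ h1
    rw [h1, sub_zero]

end Eigenvalues

/-! ### The imaginary axis for power coefficients -/

section ImaginaryAxis

variable {α : ℝ} {p : DampingParams}

/-- Energy growth for `w = x ^ α uₓ`, `wₓ = μ u + f`. -/
lemma exists_energy_le (hα : α < 1) (μ : ℝ) :
    ∃ C > 0, ∀ u w f : ℝ → ℂ, MemH2Weighted (fun x : ℝ => x ^ α) u w → MemLp f 2 unitMeasure →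
      (∀ᵐ x ∂unitMeasure, deriv w x = μ * u x + f x) →
      ∫ x in Ioo (0 : ℝ) 1, ‖u x‖ ^ 2
        ≤ C * (‖u 1‖ ^ 2 + ‖w 1‖ ^ 2 + ∫ x in Ioo (0 : ℝ) 1, ‖f x‖ ^ 2) := by
  set b : ℝ := |μ| + 1 with hb
  have hb0 : 0 < b := by positivity
  -- E is the integral over (x, 1) of b + y^(-α), a bound for the logarithmic growth rate of |u|² +
  -- |w|². It is bounded because α < 1, so the Grönwall factor e^E stays finite down to 0.
  set E : ℝ → ℝ := fun x => b * (1 - x) + (1 - x ^ (1 - α)) / (1 - α) with hE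
  have h1α : 0 < 1 - α := by linarith
  have hE1 : E 1 = 0 := by simp [hE]
  have hE0 : ∀ x ∈ Ioo (0 : ℝ) 1, 0 ≤ E x ∧ E x ≤ b + 1 / (1 - α) := fun x hx => by
    have h1 : x ^ (1 - α) ≤ 1 := Real.rpow_le_one hx.1.le hx.2.le h1α.le
    have h2 : 0 ≤ x ^ (1 - α) := Real.rpow_nonneg hx.1.le _
    constructor
    · exact add_nonneg (mul_nonneg hb0.le (by linarith [hx.2])) (div_nonneg (by linarith) h1α.le)
    · refine add_le_add (mul_le_of_le_one_right hb0.le (by linarith [hx.1])) ?_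
      gcongr; linarith
  have hEd : ∀ x, 0 < x → HasDerivAt E (-(b + (x ^ α)⁻¹)) x := fun x hx => by
    have d1 := ((hasDerivAt_id x).const_sub 1).const_mul b
    have d2 := ((Real.hasDerivAt_rpow_const (p := 1 - α) (Or.inl hx.ne')).const_sub 1).div_const
      (1 - α)
    refine (d1.add d2).congr_deriv ?_
    rw [show 1 - α - 1 = -α by ring, Real.rpow_neg hx.le]
    field_simp
    ring
  refine ⟨Real.exp (b + 1 / (1 - α)), by positivity, fun u w f hu hf he => ?_⟩
  set A := ‖u 1‖ ^ 2 + ‖w 1‖ ^ 2 + ∫ x in Ioo (0 : ℝ) 1, ‖f x‖ ^ 2 with hA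
  have iff' := integrable_sq_norm hf
  have hA0 : 0 ≤ A := add_nonneg (by positivity) (integral_nonneg fun _ => by positivity)
  set P : ℝ → ℂ := fun x => ((Real.exp (-E x) : ℝ) : ℂ) *
    (u x * starRingEnd ℂ (u x) + w x * starRingEnd ℂ (w x)) with hP
  have hPre : ∀ x, (P x).re = Real.exp (-E x) * (‖u x‖ ^ 2 + ‖w x‖ ^ 2) := fun x => by
    simp only [hP]
    rw [Complex.re_ofReal_mul, Complex.mul_conj, Complex.mul_conj, Complex.normSq_eq_norm_sq,
      Complex.normSq_eq_norm_sq, ← Complex.ofReal_add, Complex.ofReal_re]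
  -- The weight contributes (b + x^(-α))(|u|² + |w|²), which dominates the coupling terms from uₓ =
  -- x^(-α) w and wₓ = μu + f up to |f|².
  have hder : ∀ᵐ x ∂unitMeasure, -‖f x‖ ^ 2 ≤ (deriv P x).re := by
    filter_upwards [he, hu.flux_eq, hu.memH1.locAbsCont.ae_differentiableAt,
      hu.flux_memH1.ae_differentiableAt, ae_restrict_mem measurableSet_Ioo] with x h1 h2 h3 h4 hx
    have hX : 0 < x ^ α := Real.rpow_pos_of_pos hx.1 α
    have hX' : ((x ^ α : ℝ) : ℂ) ≠ 0 := by exact_mod_cast hX.ne'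
    have hu' : deriv u x = (((x ^ α)⁻¹ : ℝ) : ℂ) * w x := by
      rw [h2]; push_cast; field_simp
    have d1 : HasDerivAt (fun y => ((Real.exp (-E y) : ℝ) : ℂ))
        ((Real.exp (-E x) * (b + (x ^ α)⁻¹) : ℝ) : ℂ) x :=
      (((hEd x hx.1).neg.exp).congr_deriv (by rw [neg_neg]; rfl)).ofReal_comp
    have duc : HasDerivAt (fun x => starRingEnd ℂ (u x)) (starRingEnd ℂ (deriv u x)) x :=
      Complex.conjCLE.hasFDerivAt.comp_hasDerivAt x h3.hasDerivAt
    have dwc : HasDerivAt (fun x => starRingEnd ℂ (w x)) (starRingEnd ℂ (deriv w x)) x :=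
      Complex.conjCLE.hasFDerivAt.comp_hasDerivAt x h4.hasDerivAt
    have dP := d1.mul ((h3.hasDerivAt.mul duc).add (h4.hasDerivAt.mul dwc))
    have eP : deriv P x = ((Real.exp (-E x) : ℝ) : ℂ) * (((b + (x ^ α)⁻¹ : ℝ) : ℂ) *
        (u x * starRingEnd ℂ (u x) + w x * starRingEnd ℂ (w x))
        + (deriv u x * starRingEnd ℂ (u x) + u x * starRingEnd ℂ (deriv u x)
        + (deriv w x * starRingEnd ℂ (w x) + w x * starRingEnd ℂ (deriv w x)))) := by
      refine dP.deriv.trans ?_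
      simp only [Pi.add_apply, Pi.mul_apply]
      push_cast; ring
    have hre : ∀ a c : ℂ, -(2 * (‖a‖ * ‖c‖)) ≤ (a * starRingEnd ℂ c + c * starRingEnd ℂ a).re := by
      intro a c
      have e : c * starRingEnd ℂ a = starRingEnd ℂ (a * starRingEnd ℂ c) := by
        rw [map_mul, Complex.conj_conj, mul_comm]
      rw [e, Complex.add_re, Complex.conj_re]
      have := (abs_le.1 (Complex.abs_re_le_norm (a * starRingEnd ℂ c))).1
      rw [norm_mul, RCLike.norm_conj] at this
      linarith
    have k1 := hre (deriv u x) (u x)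
    have k2 := hre (deriv w x) (w x)
    have n1 : ‖deriv u x‖ = (x ^ α)⁻¹ * ‖w x‖ := by
      rw [hu', norm_mul, Complex.norm_real, Real.norm_of_nonneg (by positivity)]
    have n2 : ‖deriv w x‖ ≤ |μ| * ‖u x‖ + ‖f x‖ := by
      rw [h1]
      refine (norm_add_le _ _).trans (add_le_add (le_of_eq ?_) le_rfl)
      rw [norm_mul, Complex.norm_real, Real.norm_eq_abs]
    have hc : ∀ v : ℂ, v * starRingEnd ℂ v = ((‖v‖ ^ 2 : ℝ) : ℂ) := fun v => by
      rw [Complex.mul_conj, Complex.normSq_eq_norm_sq]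
    rw [eP, Complex.re_ofReal_mul, Complex.add_re, Complex.re_ofReal_mul, hc, hc,
      ← Complex.ofReal_add, Complex.ofReal_re, Complex.add_re]
    set X := (x ^ α)⁻¹ with hXd
    have hX0 : 0 < X := by positivity
    have m1 : 2 * (‖deriv u x‖ * ‖u x‖) ≤ X * (‖u x‖ ^ 2 + ‖w x‖ ^ 2) := by
      rw [n1]
      nlinarith [mul_nonneg hX0.le (sq_nonneg (‖u x‖ - ‖w x‖))]
    have m2 : 2 * (‖deriv w x‖ * ‖w x‖) ≤ b * (‖u x‖ ^ 2 + ‖w x‖ ^ 2) + ‖f x‖ ^ 2 := by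
      have q1 : ‖deriv w x‖ * ‖w x‖ ≤ (|μ| * ‖u x‖ + ‖f x‖) * ‖w x‖ := by gcongr
      rw [hb]
      nlinarith [mul_nonneg (abs_nonneg μ) (sq_nonneg (‖u x‖ - ‖w x‖)),
        sq_nonneg (‖f x‖ - ‖w x‖), sq_nonneg ‖u x‖]
    have hexp : Real.exp (-E x) ≤ 1 := Real.exp_le_one_iff.2 (neg_nonpos.2 (hE0 x hx).1)
    have m3 : -‖f x‖ ^ 2 ≤ (b + X) * (‖u x‖ ^ 2 + ‖w x‖ ^ 2)
        + ((deriv u x * starRingEnd ℂ (u x) + u x * starRingEnd ℂ (deriv u x)).re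
        + (deriv w x * starRingEnd ℂ (w x) + w x * starRingEnd ℂ (deriv w x)).re) := by linarith
    calc -‖f x‖ ^ 2 ≤ Real.exp (-E x) * -‖f x‖ ^ 2 := by
          nlinarith [sq_nonneg ‖f x‖, Real.exp_pos (-E x)]
      _ ≤ _ := by gcongr
  have hpt : ∀ x ∈ Ioo (0 : ℝ) 1, ‖u x‖ ^ 2 ≤ Real.exp (b + 1 / (1 - α)) * A := by
    intro x hx
    have au : AbsolutelyContinuousOnInterval u x 1 := hu.memH1.locAbsCont x hx
    have aw : AbsolutelyContinuousOnInterval w x 1 :=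
      hu.flux_memH1.absCont_mono (Ioo_subset_Icc_self hx) ⟨zero_le_one, le_rfl⟩
    have aE : AbsolutelyContinuousOnInterval (fun x => Real.exp (-E x)) x 1 := by
      refine ContDiffOn.absolutelyContinuousOnInterval fun y hy => ?_
      rw [uIcc_of_le hx.2.le] at hy
      have hy0 : y ≠ 0 := (hx.1.trans_le hy.1).ne'
      have : ContDiffAt ℝ 1 E y :=
        (contDiffAt_const.mul (contDiffAt_const.sub contDiffAt_id)).add
          ((contDiffAt_const.sub (Real.contDiffAt_rpow_const_of_ne hy0)).div_const _)
      exact (this.neg.exp).contDiffWithinAt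
    have aP : AbsolutelyContinuousOnInterval P x 1 :=
      absCont_mul (absCont_ofReal aE) ((absCont_mul au (absCont_conj au)).add
        (absCont_mul aw (absCont_conj aw)))
    have hs : Ioo x 1 ⊆ Ioo 0 1 := Ioo_subset_Ioo hx.1.le le_rfl
    have hint := absCont_integral_deriv aP
    have hi : IntegrableOn (deriv P) (Ioo x 1) := by
      rw [← intervalIntegrable_iff_integrableOn_Ioo_of_le hx.2.le]
      exact absCont_intervalIntegrable_deriv aP
    rw [intervalIntegral.integral_of_le hx.2.le, integral_Ioc_eq_integral_Ioo] at hint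
    have h1 : ∫ y in Ioo x 1, (deriv P y).re = (P 1).re - (P x).re := by
      rw [← Complex.sub_re, ← hint]
      exact integral_re hi
    have h2 : ∫ y in Ioo x 1, -‖f y‖ ^ 2 ≤ ∫ y in Ioo x 1, (deriv P y).re :=
      integral_mono_ae (iff'.mono_measure (Measure.restrict_mono hs le_rfl)).neg hi.re
        (ae_restrict_of_ae_restrict_of_subset hs hder)
    have h3 : ∫ y in Ioo x 1, ‖f y‖ ^ 2 ≤ ∫ y in Ioo (0 : ℝ) 1, ‖f y‖ ^ 2 :=
      setIntegral_mono_set iff' (Eventually.of_forall fun _ => by positivity) hs.eventuallyLE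
    rw [integral_neg] at h2
    rw [h1, hPre, hPre, hE1, neg_zero, Real.exp_zero, one_mul] at h2
    have h4 : Real.exp (-E x) * (‖u x‖ ^ 2 + ‖w x‖ ^ 2) ≤ A := by rw [hA]; linarith
    have h5 : Real.exp (-E x) * ‖u x‖ ^ 2 ≤ A :=
      (mul_le_mul_of_nonneg_left (le_add_of_nonneg_right (by positivity))
        (Real.exp_pos _).le).trans h4
    rw [Real.exp_neg, inv_mul_le_iff₀ (Real.exp_pos _)] at h5
    refine h5.trans ?_
    gcongr
    exact (hE0 x hx).2
  refine (setIntegral_mono_on (integrable_sq_norm hu.memH1.memLp) (integrable_const _)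
    measurableSet_Ioo hpt).trans_eq ?_
  simp

/-- On a window away from 0 and infinity, η is bounded below uniformly in the order, since 2α̃ - 1 >
-1. -/
lemma half_le_eta_sq (p : DampingParams) {ξ : ℝ} (hξ : ξ ∈ Icc (1 : ℝ) 2) : 1 / 2 ≤ p.eta ξ ^ 2 := by
  have h0 : 0 < ξ := by linarith [hξ.1]
  rw [p.eta_sq, abs_of_pos h0]
  calc (1 / 2 : ℝ) ≤ ξ ^ (-1 : ℝ) := by
        rw [Real.rpow_neg_one, one_div]; exact inv_anti₀ h0 hξ.2
    _ ≤ ξ ^ (2 * p.order - 1) :=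
        Real.rpow_le_rpow_of_exponent_le hξ.1 (by linarith [p.order_pos])

/-- Observability of the trace from the memory variable. -/
lemma exists_sq_trace_le_memory (p : DampingParams) (z : ℂ) :
    ∃ C > 0, ∀ (ϑ f : ℝ → ℂ) (b : ℂ), Integrable (fun ξ : ℝ => ξ ^ 2 * ‖ϑ ξ‖ ^ 2) →
      Integrable (fun ξ => ‖f ξ‖ ^ 2) →
      (∀ᵐ ξ, memorySymbol p z ξ * ϑ ξ = f ξ + p.eta ξ * b) →
      ‖b‖ ^ 2 ≤ C * ((∫ ξ : ℝ, ξ ^ 2 * ‖ϑ ξ‖ ^ 2) + ∫ ξ, ‖f ξ‖ ^ 2) := by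
  -- S bounds the symbol on the window 1 ≤ ξ ≤ 2. There the trace is read off pointwise from ηb =
  -- (symbol)ϑ - f, then averaged over a set of measure 1.
  set S : ℝ := ‖z‖ + 4 + p.wp with hS
  have hS0 : 0 < S := by have := p.wp_nonneg; positivity
  refine ⟨4 * (S ^ 2 + 1), by positivity, fun ϑ f b i1 i2 he => ?_⟩
  have hi : Integrable fun ξ : ℝ => 4 * (S ^ 2 + 1) * (ξ ^ 2 * ‖ϑ ξ‖ ^ 2 + ‖f ξ‖ ^ 2) :=
    (i1.add i2).const_mul _
  have h1 : ∫ _ in Icc (1 : ℝ) 2, ‖b‖ ^ 2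
      ≤ ∫ ξ in Icc (1 : ℝ) 2, 4 * (S ^ 2 + 1) * (ξ ^ 2 * ‖ϑ ξ‖ ^ 2 + ‖f ξ‖ ^ 2) := by
    refine setIntegral_mono_on_ae (integrable_const _) hi.integrableOn measurableSet_Icc ?_
    filter_upwards [he] with ξ h hξ
    have hη := half_le_eta_sq p hξ
    have hsym : ‖memorySymbol p z ξ‖ ≤ S := by
      rw [memorySymbol, hS]
      have e : ‖((ξ : ℂ)) ^ 2‖ ≤ 4 := by
        rw [norm_pow, Complex.norm_real, Real.norm_eq_abs, sq_abs]; nlinarith [hξ.1, hξ.2]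
      have e' : ‖(p.wp : ℂ)‖ = p.wp := by
        rw [Complex.norm_real, Real.norm_of_nonneg p.wp_nonneg]
      have e1 := norm_add_le z ((ξ : ℂ) ^ 2 + p.wp)
      have e2 := norm_add_le ((ξ : ℂ) ^ 2) p.wp
      linarith
    have h2 : ‖(p.eta ξ : ℂ) * b‖ ≤ S * ‖ϑ ξ‖ + ‖f ξ‖ := by
      have : (p.eta ξ : ℂ) * b = memorySymbol p z ξ * ϑ ξ - f ξ := by rw [h]; ring
      rw [this]
      refine (norm_sub_le _ _).trans ?_
      rw [norm_mul]
      gcongr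
    have h3 : p.eta ξ ^ 2 * ‖b‖ ^ 2 ≤ (S * ‖ϑ ξ‖ + ‖f ξ‖) ^ 2 := by
      rw [norm_mul, Complex.norm_real, Real.norm_of_nonneg (p.eta_nonneg ξ)] at h2
      rw [← mul_pow]
      gcongr
      exact mul_nonneg (p.eta_nonneg ξ) (norm_nonneg _)
    have h4 : 1 / 2 * ‖b‖ ^ 2 ≤ p.eta ξ ^ 2 * ‖b‖ ^ 2 := by gcongr
    have h5 : ‖ϑ ξ‖ ^ 2 ≤ ξ ^ 2 * ‖ϑ ξ‖ ^ 2 :=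
      le_mul_of_one_le_left (by positivity) (by nlinarith [hξ.1])
    have h6 : S ^ 2 * ‖ϑ ξ‖ ^ 2 ≤ S ^ 2 * (ξ ^ 2 * ‖ϑ ξ‖ ^ 2) := by gcongr
    have h7 : 0 ≤ S ^ 2 * ‖f ξ‖ ^ 2 := by positivity
    have h8 : 0 ≤ ξ ^ 2 * ‖ϑ ξ‖ ^ 2 := by positivity
    nlinarith [sq_nonneg (S * ‖ϑ ξ‖ - ‖f ξ‖)]
  have h2 : ∫ ξ in Icc (1 : ℝ) 2, 4 * (S ^ 2 + 1) * (ξ ^ 2 * ‖ϑ ξ‖ ^ 2 + ‖f ξ‖ ^ 2)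
      ≤ 4 * (S ^ 2 + 1) * ((∫ ξ : ℝ, ξ ^ 2 * ‖ϑ ξ‖ ^ 2) + ∫ ξ, ‖f ξ‖ ^ 2) :=
    (setIntegral_le_integral hi (Eventually.of_forall fun ξ => by
      change 0 ≤ 4 * (S ^ 2 + 1) * (ξ ^ 2 * ‖ϑ ξ‖ ^ 2 + ‖f ξ‖ ^ 2)
      positivity)).trans_eq (by rw [integral_const_mul, integral_add i1 i2])
  rw [setIntegral_const] at h1
  norm_num at h1
  exact h1.trans h2

lemma SymbolBound.sq_norm_memoryInput_le {z : ℂ} {c : ℝ} (hc : 0 < c) (h : SymbolBound p z c)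
    {f : ℝ → ℂ} (hf : MemLp f 2 volume) :
    ‖memoryInput p z f‖ ^ 2
      ≤ p.zeta ^ 2 * ((∫ ξ, ‖(p.eta ξ : ℂ) / memorySymbol p z ξ‖ ^ 2) * ∫ ξ, ‖f ξ‖ ^ 2) := by
  rw [memoryInput, norm_mul, Complex.norm_real, Real.norm_of_nonneg p.zeta_pos.le, mul_pow]
  refine mul_le_mul_of_nonneg_left ?_ (by positivity)
  refine le_trans (le_of_eq ?_) (sq_norm_integral_mul_le (h.memLp_eta_div hc) hf)
  congr 2
  refine integral_congr_ae (Eventually.of_forall fun ξ => ?_)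
  simp only []; ring

lemma SymbolBound.integral_sq_solution_le {z : ℂ} {c : ℝ} (hc : 0 < c) (h : SymbolBound p z c)
    {f ϑ : ℝ → ℂ} (hf : MemLp f 2 volume) (hϑ : MemLp ϑ 2 volume) {b : ℂ}
    (he : ∀ᵐ ξ, ϑ ξ = (f ξ + p.eta ξ * b) / memorySymbol p z ξ) :
    ∫ ξ, ‖ϑ ξ‖ ^ 2 ≤ 2 * (c⁻¹) ^ 2 * (∫ ξ, ‖f ξ‖ ^ 2)
      + 2 * (∫ ξ, ‖(p.eta ξ : ℂ) / memorySymbol p z ξ‖ ^ 2) * ‖b‖ ^ 2 := by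
  have i1 := (integrable_sq_norm hf).const_mul (2 * (c⁻¹) ^ 2)
  have i2 := ((integrable_sq_norm (h.memLp_eta_div hc)).const_mul 2).mul_const (‖b‖ ^ 2)
  rw [← integral_const_mul, ← integral_const_mul, ← integral_mul_const, ← integral_add i1 i2]
  refine integral_mono_ae (integrable_sq_norm hϑ) (i1.add i2) ?_
  filter_upwards [he] with ξ hξ
  have e1 : ‖ϑ ξ‖ ≤ c⁻¹ * ‖f ξ‖ + ‖(p.eta ξ : ℂ) / memorySymbol p z ξ‖ * ‖b‖ := by
    have : ϑ ξ = f ξ / memorySymbol p z ξ + (p.eta ξ : ℂ) / memorySymbol p z ξ * b := by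
      rw [hξ]; ring
    rw [this]
    refine (norm_add_le _ _).trans (add_le_add ?_ (norm_mul_le _ _))
    rw [norm_div, div_eq_mul_inv, mul_comm]
    refine mul_le_mul_of_nonneg_right (inv_anti₀ hc ?_) (norm_nonneg _)
    exact (le_mul_of_one_le_right hc.le (by linarith [sq_nonneg ξ])).trans (h ξ)
  calc ‖ϑ ξ‖ ^ 2 ≤ (c⁻¹ * ‖f ξ‖ + ‖(p.eta ξ : ℂ) / memorySymbol p z ξ‖ * ‖b‖) ^ 2 := by gcongr
    _ ≤ 2 * ((c⁻¹ * ‖f ξ‖) ^ 2 + (‖(p.eta ξ : ℂ) / memorySymbol p z ξ‖ * ‖b‖) ^ 2) := add_sq_le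
    _ = _ := by ring

/-- The dissipation is controlled by the right hand side of the resolvent equation. -/
lemma IsImage.dissipation_le {τ : ℝ → ℝ} (hτ : IsDegenerateCoeff τ) {U V : StateSpace p}
    {u w : ℝ → ℂ} (h : IsImage τ p U V u w) (μ : ℝ) :
    p.zeta * ∫ ξ : ℝ, ξ ^ 2 * ‖U.snd ξ‖ ^ 2 ≤ ‖U‖ * ‖(Complex.I * (μ : ℂ)) • U - V‖ := by
  have e1 := h.re_inner hτ
  have e2 : (inner ℂ U ((Complex.I * (μ : ℂ)) • U - V)).re = -(inner ℂ U V).re := by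
    rw [inner_sub_right, inner_smul_right, inner_self_eq_norm_sq_to_K, Complex.sub_re]
    have : (Complex.I * (μ : ℂ) * ((‖U‖ : ℂ)) ^ 2).re = 0 := by
      rw [mul_assoc, ← Complex.ofReal_pow, ← Complex.ofReal_mul, Complex.re_mul_ofReal]
      simp
    simp only [Complex.coe_algebraMap]
    rw [this, zero_sub]
  have e3 := (Complex.re_le_norm _).trans
    (norm_inner_le_norm (𝕜 := ℂ) U ((Complex.I * (μ : ℂ)) • U - V))
  rw [e2, e1, neg_neg] at e3
  refine le_trans (mul_le_mul_of_nonneg_left ?_ p.zeta_pos.le) e3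
  have i1 := h.integrable_dissipation
  have i2 : Integrable fun ξ : ℝ => (ξ ^ 2 + p.wp) * ‖U.snd ξ‖ ^ 2 := by
    refine (i1.add ((integrable_sq_norm (memLp_snd U)).const_mul p.wp)).congr
      (Eventually.of_forall fun ξ => ?_)
    simp only [Pi.add_apply]; ring
  refine integral_mono i1 i2 fun ξ => ?_
  have := p.wp_nonneg
  change ξ ^ 2 * ‖U.snd ξ‖ ^ 2 ≤ (ξ ^ 2 + p.wp) * ‖U.snd ξ‖ ^ 2
  gcongr
  linarith

lemma IsImage.deriv_flux_eq {τ : ℝ → ℝ} {U V : StateSpace p} {u w : ℝ → ℂ}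
    (h : IsImage τ p U V u w) (μ : ℝ) :
    ∀ᵐ x ∂unitMeasure, deriv w x
      = μ * u x + Complex.I * ((Complex.I * (μ : ℂ)) • U - V).fst x := by
  filter_upwards [h.fst_eq, Lp.coeFn_sub ((Complex.I * (μ : ℂ)) • U.fst) V.fst,
    Lp.coeFn_smul (Complex.I * (μ : ℂ)) U.fst, h.inDomain.repr] with x k1 k2 k3 k4
  have k5 : ((Complex.I * (μ : ℂ)) • U - V).fst x
      = Complex.I * μ * u x - Complex.I * deriv w x := by
    refine k2.trans ?_
    rw [Pi.sub_apply, k3, Pi.smul_apply, smul_eq_mul, k1, k4]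
  rw [k5]
  linear_combination (-(μ * u x) + deriv w x) * Complex.I_mul_I

/-- With x = ‖U‖ and y = ‖(iμ - 𝓐)U‖, this turns an estimate containing the dissipation bound xy
into a linear one. -/
lemma le_mul_of_sq_le {x y K : ℝ} (hx : 0 ≤ x) (hy : 0 ≤ y) (hK : 0 < K)
    (h : x ^ 2 ≤ K * (x * y + y ^ 2)) : x ≤ (1 + 2 * K) * y := by
  by_contra hcon
  push Not at hcon
  have hx0 : 0 < x := lt_of_le_of_lt (by positivity) hcon
  have hyx : y ≤ x := (le_mul_of_one_le_left hy (by linarith)).trans hcon.le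
  have h1 : K * (x * y + y ^ 2) ≤ x * (2 * K * y) := by
    have : y ^ 2 ≤ x * y := by rw [sq]; gcongr
    nlinarith
  have h2 : x * x ≤ x * (2 * K * y) := by rw [← sq]; exact h.trans h1
  have := le_of_mul_le_mul_left h2 hx0
  linarith

/-- A priori estimate at nonzero points of the imaginary axis. -/
lemma exists_boundedBelow_rpow (hα0 : 0 < α) (hα : α < 1) (p : DampingParams) {μ : ℝ} (hμ : μ ≠ 0) :
    ∃ c > 0, BoundedBelow (systemOperator (fun x : ℝ => x ^ α) p) (Complex.I * μ) c := by
  have hτ := isDegenerateCoeff_rpow hα0 hα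
  have him : (Complex.I * (μ : ℂ)).im ≠ 0 := by simpa using hμ
  obtain ⟨c, hc, hsym⟩ := symbolBound_of_im_ne_zero p him
  obtain ⟨C₁, hC₁, h₁⟩ := exists_energy_le hα μ
  obtain ⟨C₂, hC₂, h₂⟩ := exists_sq_trace_le_memory p (Complex.I * μ)
  obtain ⟨ζ, hζ⟩ : ∃ ζ, ζ = p.zeta := ⟨_, rfl⟩
  have hζ0 : 0 < ζ := hζ ▸ p.zeta_pos
  obtain ⟨L, hL⟩ : ∃ L, L = ∫ ξ, ‖(p.eta ξ : ℂ) / memorySymbol p (Complex.I * μ) ξ‖ ^ 2 := ⟨_, rfl⟩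
  have hL0 : 0 ≤ L := hL ▸ integral_nonneg fun _ => by positivity
  obtain ⟨G, hG⟩ : ∃ G, G = ‖transferFun p (Complex.I * μ)‖ := ⟨_, rfl⟩
  have hD0 : 0 < C₁ * (1 + 2 * G ^ 2) + ζ * (2 * L) := by positivity
  have hD'0 : 0 < C₁ * (2 * ζ * L + 1) + 2 * (c⁻¹) ^ 2 := by positivity
  -- The aim is ‖U‖² ≤ D|u(1)|² + D'‖F‖², where F = (iμ - 𝓐)U: D and D' add up what ψ contributes
  -- through the energy estimate and ϑ through the explicit formula.
  obtain ⟨D, hD⟩ : ∃ D, D = C₁ * (1 + 2 * G ^ 2) + ζ * (2 * L) := ⟨_, rfl⟩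
  obtain ⟨D', hD'⟩ : ∃ D', D' = C₁ * (2 * ζ * L + 1) + 2 * (c⁻¹) ^ 2 := ⟨_, rfl⟩
  rw [← hD] at hD0
  rw [← hD'] at hD'0
  have hK0 : 0 < D * (C₂ / ζ) + D' := by positivity
  refine ⟨(1 + 2 * (D * (C₂ / ζ) + D'))⁻¹, by positivity, fun U V hUV => ?_⟩
  obtain ⟨u, w, hI⟩ := mem_graph_systemOperator.1 hUV
  obtain ⟨hϑ, hw1⟩ := hI.memory_eq hc hsym
  have hdis := hI.dissipation_le hτ μ
  have hwd := hI.deriv_flux_eq μ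
  generalize (Complex.I * (μ : ℂ)) • U - V = F at hϑ hw1 hdis hwd ⊢
  have hFs := memLp_snd F
  have hFn := norm_sq_eq p F
  have hUn := norm_sq_eq p U
  -- Chain of control: the right hand side controls the dissipation, the dissipation controls the
  -- trace u(1), and the trace with the boundary condition controls u and ϑ.
  have htr := h₂ U.snd F.snd (u 1) hI.integrable_dissipation (integrable_sq_norm hFs) (by
    filter_upwards [hϑ] with ξ h
    rw [h]; field_simp [hsym.ne_zero hc ξ])
  have hin := hsym.sq_norm_memoryInput_le hc hFs
  have hmem := hsym.integral_sq_solution_le hc hFs (memLp_snd U) hϑ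
  have hψ := h₁ u w (fun x => Complex.I * F.fst x) hI.inDomain.memH2
    ((Lp.memLp F.fst).const_mul _) hwd
  have e1 : ∫ x in Ioo (0 : ℝ) 1, ‖U.fst x‖ ^ 2 = ∫ x in Ioo (0 : ℝ) 1, ‖u x‖ ^ 2 :=
    integral_congr_ae (by filter_upwards [hI.inDomain.repr] with x k; rw [k])
  simp only [norm_mul, Complex.norm_I, one_mul] at hψ
  have hf10 : 0 ≤ ∫ x in Ioo (0 : ℝ) 1, ‖F.fst x‖ ^ 2 := integral_nonneg fun _ => by positivity
  have hf20 : 0 ≤ ∫ ξ, ‖F.snd ξ‖ ^ 2 := integral_nonneg fun _ => by positivity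
  have hw1b : ‖w 1‖ ≤ ‖memoryInput p (Complex.I * μ) F.snd‖ + G * ‖u 1‖ := by
    rw [hw1, norm_mul, Complex.norm_I, one_mul, hG, ← norm_mul]
    exact norm_add_le _ _
  rw [← hζ] at hdis hFn hUn hin
  rw [← hL] at hin hmem
  rw [e1] at hUn
  generalize (∫ x in Ioo (0 : ℝ) 1, ‖F.fst x‖ ^ 2) = f₁ at hFn hψ hf10
  generalize (∫ ξ, ‖F.snd ξ‖ ^ 2) = f₂ at hFn htr hin hmem hf20
  generalize (∫ ξ : ℝ, ξ ^ 2 * ‖U.snd ξ‖ ^ 2) = d at hdis htr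
  generalize (∫ ξ, ‖U.snd ξ‖ ^ 2) = θ at hUn hmem
  generalize (∫ x in Ioo (0 : ℝ) 1, ‖u x‖ ^ 2) = y at hUn hψ
  generalize ‖memoryInput p (Complex.I * μ) F.snd‖ = k at hin hw1b
  have hf2F : ζ * f₂ ≤ ‖F‖ ^ 2 := by linarith
  have hf1F : f₁ ≤ ‖F‖ ^ 2 := by
    have := mul_nonneg hζ0.le hf20
    linarith
  have hw2 : ‖w 1‖ ^ 2 ≤ 2 * ζ * L * ‖F‖ ^ 2 + 2 * G ^ 2 * ‖u 1‖ ^ 2 := by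
    have t1 : 2 * ζ * L * (ζ * f₂) ≤ 2 * ζ * L * ‖F‖ ^ 2 := by gcongr
    calc ‖w 1‖ ^ 2 ≤ (k + G * ‖u 1‖) ^ 2 := by gcongr
      _ ≤ 2 * (k ^ 2 + (G * ‖u 1‖) ^ 2) := add_sq_le
      _ ≤ 2 * (ζ ^ 2 * (L * f₂) + (G * ‖u 1‖) ^ 2) := by gcongr
      _ = 2 * ζ * L * (ζ * f₂) + 2 * G ^ 2 * ‖u 1‖ ^ 2 := by ring
      _ ≤ _ := by gcongr
  have htr2 : ‖u 1‖ ^ 2 ≤ C₂ / ζ * (‖U‖ * ‖F‖ + ‖F‖ ^ 2) := by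
    rw [div_mul_eq_mul_div, le_div_iff₀ hζ0]
    calc ‖u 1‖ ^ 2 * ζ ≤ C₂ * (d + f₂) * ζ := by gcongr
      _ = C₂ * (ζ * d + ζ * f₂) := by ring
      _ ≤ _ := by gcongr
  have hy : y ≤ C₁ * ((1 + 2 * G ^ 2) * ‖u 1‖ ^ 2 + (2 * ζ * L + 1) * ‖F‖ ^ 2) := by
    refine hψ.trans (mul_le_mul_of_nonneg_left ?_ hC₁.le)
    linarith
  have hθ : ζ * θ ≤ 2 * (c⁻¹) ^ 2 * ‖F‖ ^ 2 + ζ * (2 * L) * ‖u 1‖ ^ 2 := by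
    have t2 : 2 * (c⁻¹) ^ 2 * (ζ * f₂) ≤ 2 * (c⁻¹) ^ 2 * ‖F‖ ^ 2 := by gcongr
    calc ζ * θ ≤ ζ * (2 * (c⁻¹) ^ 2 * f₂ + 2 * L * ‖u 1‖ ^ 2) := by gcongr
      _ = 2 * (c⁻¹) ^ 2 * (ζ * f₂) + ζ * (2 * L) * ‖u 1‖ ^ 2 := by ring
      _ ≤ _ := by gcongr
  have hmain : ‖U‖ ^ 2 ≤ D * ‖u 1‖ ^ 2 + D' * ‖F‖ ^ 2 := by
    rw [hUn, hD, hD']; linarith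
  rw [inv_mul_le_iff₀ (by positivity)]
  refine le_mul_of_sq_le (norm_nonneg _) (norm_nonneg _) hK0 ?_
  have t1 : D * ‖u 1‖ ^ 2 ≤ D * (C₂ / ζ * (‖U‖ * ‖F‖ + ‖F‖ ^ 2)) := by gcongr
  have t2 : 0 ≤ D' * (‖U‖ * ‖F‖) := by positivity
  linarith

end ImaginaryAxis

/-! ### Growth of the resolvent along the imaginary parts of the eigenvalues -/

section Growth

variable {α : ℝ} {p : DampingParams}

/-- At a large zero Y of the flux function the perturbation i G(-iz) has size at most Γ = C Y^(α̃-1)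
on the unit disc about Y, so `IsBesselPair.exists_characteristic_zero` moves the zero by O(Γ). -/
lemma exists_eigenvalue_near (hα0 : 0 < α) (hα : α < 1) (p : DampingParams) :
    ∃ C > 0, ∀ N : ℝ, ∃ Y : ℝ, N ≤ Y ∧ 1 ≤ Y ∧ ∃ t : ℂ, ‖t‖ ≤ 1 ∧ ‖t‖ ≤ C * Y ^ (p.order - 1) ∧
      ∃ U : StateSpace p, U ≠ 0 ∧
        (U, (-Complex.I * (Y + t)) • U) ∈ (systemOperator (fun x : ℝ => x ^ α) p).graph := by
  have hp0 : 0 < 1 - α := by linarith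
  have hm1 : 1 ≤ 2 - α := by linarith
  obtain ⟨f, g, h⟩ := exists_isBesselPair hp0 (by linarith) hm1
  obtain ⟨C, hC, hG⟩ := exists_norm_transferFun_le p
  have hm0 : 0 < 2 - α := by linarith
  refine ⟨8 * (2 - α) * C, by positivity, fun N => ?_⟩
  have ht : Tendsto (fun Y : ℝ => 8 * (2 - α) * (C * Y ^ (p.order - 1))) atTop (𝓝 0) := by
    have := ((tendsto_rpow_neg_atTop (y := 1 - p.order)
      (by linarith [p.order_lt_one])).const_mul C).const_mul (8 * (2 - α))
    simpa using this
  obtain ⟨N', hN'⟩ := eventually_atTop.1 (ht.eventually_le_const one_pos)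
  obtain ⟨Y, hY, hY0⟩ := h.exists_flux_zero hp0 (by linarith) (max N (max N' 16))
  have hY1 : N ≤ Y := (le_max_left _ _).trans hY
  have hY2 : N' ≤ Y := ((le_max_left _ _).trans (le_max_right _ _)).trans hY
  have hY3 : 16 ≤ Y := ((le_max_right _ _).trans (le_max_right _ _)).trans hY
  have hYpos : 0 < Y := by linarith
  have hre : ∀ t : ℂ, ‖t‖ ≤ 1 → ((Y : ℂ) + t).re ≠ 0 := fun t ht => by
    have h1 := (abs_le.1 ((Complex.abs_re_le_norm t).trans ht)).1
    rw [Complex.add_re, Complex.ofReal_re]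
    linarith
  obtain ⟨t, ht1, hft, hgt⟩ := h.exists_characteristic_zero hp0 (by linarith) hm1 hY3 hY0
    (Γ := C * Y ^ (p.order - 1)) (G := fun z => Complex.I * transferFun p (-Complex.I * z))
    (by positivity) (hN' Y hY2)
    (fun t ht => by
      rw [norm_mul, Complex.norm_I, one_mul]
      exact hG Y (by linarith) t ht)
    (fun t ht => by
      have e : DifferentiableAt ℂ (transferFun p) (-Complex.I * (Y + t)) :=
        differentiableAt_transferFun (by
          rw [neg_mul, Complex.neg_im, Complex.I_mul_im]
          exact neg_ne_zero.2 (hre t ht))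
      exact (DifferentiableAt.comp ((Y : ℂ) + t) e (by fun_prop)).const_mul _)
  have ht2 : ‖t‖ ≤ 1 := ht1.trans (hN' Y hY2)
  exact ⟨Y, hY1, by linarith, t, ht2, by rw [mul_assoc]; exact ht1,
    h.exists_eigenvector hα0 hα (hre t ht2) hgt hft⟩

lemma isEigenvalue_of_mem_graph {X : Type*} [NormedAddCommGroup X] [NormedSpace ℂ X]
    {A : X →ₗ.[ℂ] X} {z : ℂ} {U : X} (hU : U ≠ 0) (h : (U, z • U) ∈ A.graph) : IsEigenvalue A z := by
  obtain ⟨v, hv1, hv2⟩ := (LinearPMap.mem_graph_iff A).1 h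
  simp only at hv1 hv2
  exact ⟨v, by rwa [hv1], by rw [hv2, hv1]⟩

/-- For an eigenvector U at λ, (i Im λ - 𝓐)U = -(Re λ)U, so the resolvent at i Im λ has norm at
least 1/|Re λ|. Only the upper bound |Re λ| ≤ C Y^(α̃-1) is needed, together with |λ| ≤ 2Y. -/
lemma exists_eigenvalue_growth (hα0 : 0 < α) (hα : α < 1) (p : DampingParams) :
    ∃ c > 0, ∀ N : ℝ, ∃ z : ℂ, IsEigenvalue (systemOperator (fun x : ℝ => x ^ α) p) z ∧
      z.im < -N ∧ |z.re| * N ≤ 1 ∧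
      ∃ R : StateSpace p →L[ℂ] StateSpace p,
        IsResolvent (systemOperator (fun x : ℝ => x ^ α) p) (Complex.I * z.im) R ∧
        c * ‖z‖ ^ (1 - p.order) ≤ ‖R‖ := by
  obtain ⟨C, hC, h⟩ := exists_eigenvalue_near hα0 hα p
  have hA := isMaximalDissipative_systemOperator (isDegenerateCoeff_rpow hα0 hα) p
  have hs : 0 < 1 - p.order := by linarith [p.order_lt_one]
  refine ⟨(2 * C)⁻¹, by positivity, fun N => ?_⟩
  have ht : Tendsto (fun Y : ℝ => C * Y ^ (p.order - 1) * N) atTop (𝓝 0) := by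
    have := ((tendsto_rpow_neg_atTop hs).const_mul C).mul_const N
    simpa using this
  obtain ⟨N', hN'⟩ := eventually_atTop.1 (ht.eventually_le_const one_pos)
  obtain ⟨Y, hY, hY1, t, ht1, htC, U, hU0, hU⟩ := h (max (max 0 N + 2) N')
  have hYN : max 0 N + 2 ≤ Y := (le_max_left _ _).trans hY
  have hYpos : 0 < Y := by linarith
  set z : ℂ := -Complex.I * (Y + t) with hz
  have hzre : z.re = t.im := by simp [hz]
  have hzim : z.im = -(Y + t.re) := by simp [hz]
  have hti : |t.im| ≤ ‖t‖ := Complex.abs_im_le_norm t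
  have htr := abs_le.1 ((Complex.abs_re_le_norm t).trans ht1)
  have him : z.im < -(max 0 N) := by rw [hzim]; linarith [htr.1]
  have hN0 : (0 : ℝ) ≤ max 0 N := le_max_left _ _
  have hNle : N ≤ max 0 N := le_max_right _ _
  obtain ⟨b, hb, hbb⟩ := exists_boundedBelow_rpow hα0 hα p (μ := z.im) (by linarith)
  obtain ⟨R, hR, -⟩ := exists_isResolvent hb hbb (hA.surj_of_boundedBelow hb (by simp) hbb)
  refine ⟨z, isEigenvalue_of_mem_graph hU0 hU, by linarith, ?_, R, hR, ?_⟩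
  · rw [hzre]
    rcases le_or_gt N 0 with hN | hN
    · exact (mul_nonpos_of_nonneg_of_nonpos (abs_nonneg _) hN).trans zero_le_one
    · exact (mul_le_mul_of_nonneg_right (hti.trans htC) hN.le).trans
        (hN' Y ((le_max_right _ _).trans hY))
  · have h1 := hR.apply_of_mem hU
    have h2 : (Complex.I * (z.im : ℂ)) • U - z • U = (-(z.re : ℂ)) • U := by
      rw [← sub_smul]
      congr 1
      conv_lhs => rw [← Complex.re_add_im z]
      simp only [Complex.add_im, Complex.ofReal_im, Complex.mul_im, Complex.ofReal_re, Complex.I_im,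
        Complex.I_re, mul_one, mul_zero, zero_add, add_zero]
      ring
    rw [h2] at h1
    have hUpos : 0 < ‖U‖ := norm_pos_iff.2 hU0
    have h3 : ‖U‖ ≤ ‖R‖ * (|z.re| * ‖U‖) := by
      conv_lhs => rw [← h1]
      refine (R.le_opNorm _).trans_eq ?_
      rw [norm_smul, norm_neg, Complex.norm_real, Real.norm_eq_abs]
    have h4 : 1 ≤ ‖R‖ * |z.re| := by
      rw [← mul_assoc] at h3
      exact le_of_mul_le_mul_right (by rwa [one_mul]) hUpos
    have h5 : 1 ≤ ‖R‖ * (C * Y ^ (p.order - 1)) := by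
      refine h4.trans (mul_le_mul_of_nonneg_left ?_ (norm_nonneg _))
      rw [hzre]; exact hti.trans htC
    have h6 : Y ^ (p.order - 1) = (Y ^ (1 - p.order))⁻¹ := by
      rw [← Real.rpow_neg hYpos.le]; congr 1; ring
    have hYs : 0 < Y ^ (1 - p.order) := Real.rpow_pos_of_pos hYpos _
    have h7 : Y ^ (1 - p.order) ≤ ‖R‖ * C := by
      rw [h6, ← mul_assoc, ← div_eq_mul_inv, le_div_iff₀ hYs, one_mul] at h5
      exact h5
    have h8 : ‖z‖ ^ (1 - p.order) ≤ 2 * Y ^ (1 - p.order) := by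
      have hzn : ‖z‖ ≤ 2 * Y := by
        rw [hz, norm_mul, norm_neg, Complex.norm_I, one_mul]
        refine (norm_add_le _ _).trans ?_
        rw [Complex.norm_real, Real.norm_of_nonneg hYpos.le]
        linarith
      calc ‖z‖ ^ (1 - p.order) ≤ (2 * Y) ^ (1 - p.order) :=
            Real.rpow_le_rpow (norm_nonneg _) hzn hs.le
        _ = 2 ^ (1 - p.order) * Y ^ (1 - p.order) := Real.mul_rpow zero_le_two hYpos.le
        _ ≤ 2 * Y ^ (1 - p.order) := by
            gcongr
            calc (2 : ℝ) ^ (1 - p.order) ≤ 2 ^ (1 : ℝ) :=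
                  Real.rpow_le_rpow_of_exponent_le one_le_two (by linarith [p.order_pos])
              _ = 2 := Real.rpow_one 2
    rw [inv_mul_le_iff₀ (by positivity)]
    linarith

/-- A sequence of complex numbers selected from a property that holds arbitrarily far down. -/
lemma exists_seq_of_forall {P : ℂ → Prop}
    (h : ∀ N : ℝ, ∃ z, P z ∧ z.im < -N ∧ |z.re| * N ≤ 1) :
    ∃ l : ℕ → ℂ, Function.Injective l ∧ (∀ k, P (l k)) ∧
      Tendsto (fun k => (l k).im) atTop atBot ∧ Tendsto (fun k => (l k).re) atTop (𝓝 0) := by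
  choose F hP hF hre using h
  -- The threshold -Im of the previous term makes the imaginary parts strictly decreasing, hence the
  -- terms distinct. The threshold n + 2 drives Im to -∞ and, through |Re| · N ≤ 1, Re to 0.
  set l : ℕ → ℂ := fun k => Nat.rec (F 1) (fun n z => F (max ((n : ℝ) + 2) (-z.im))) k with hl
  have hsucc : ∀ n, l (n + 1) = F (max ((n : ℝ) + 2) (-(l n).im)) := fun n => rfl
  have hzero : l 0 = F 1 := rfl
  have hP' : ∀ k, P (l k) := fun k => by cases k <;> exact hP _
  have him : ∀ k : ℕ, (l k).im ≤ -((k : ℝ) + 1) := fun k => by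
    cases k with
    | zero => simpa [hzero] using (hF 1).le
    | succ n =>
      have h1 := hF (max ((n : ℝ) + 2) (-(l n).im))
      have h2 := le_max_left ((n : ℝ) + 2) (-(l n).im)
      rw [hsucc]; push_cast; linarith
  have hre' : ∀ k : ℕ, |(l k).re| ≤ 1 / ((k : ℝ) + 1) := fun k => by
    rw [le_div_iff₀ (by positivity)]
    cases k with
    | zero => simpa [hzero] using hre 1
    | succ n =>
      have h1 := hre (max ((n : ℝ) + 2) (-(l n).im))
      have h2 := le_max_left ((n : ℝ) + 2) (-(l n).im)
      rw [hsucc]; push_cast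
      refine le_trans (mul_le_mul_of_nonneg_left ?_ (abs_nonneg _)) h1
      linarith
  have hanti : StrictAnti fun k => (l k).im := strictAnti_nat_of_succ_lt fun n => by
    have h1 := hF (max ((n : ℝ) + 2) (-(l n).im))
    have h2 := le_max_right ((n : ℝ) + 2) (-(l n).im)
    rw [hsucc]; linarith
  refine ⟨l, fun a b hab => hanti.injective (congrArg Complex.im hab), hP', ?_, ?_⟩
  · refine tendsto_atBot_mono him ?_
    exact tendsto_neg_atTop_atBot.comp
      (tendsto_atTop_add_const_right _ _ tendsto_natCast_atTop_atTop)
  · exact squeeze_zero_norm hre' tendsto_one_div_add_atTop_nhds_zero_nat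

end Growth

end DegenerateSchrodinger

end

theorem theorem5p1 (p : DegenerateSchrodinger.DampingParams) :
    (∀ τ : ℝ → ℝ, DegenerateSchrodinger.IsDegenerateCoeff τ →
      (∃ S : NNReal →
          DegenerateSchrodinger.StateSpace p →L[ℂ] DegenerateSchrodinger.StateSpace p,
        DegenerateSchrodinger.IsGeneratedBy S (DegenerateSchrodinger.systemOperator τ p)) ∧
      ∀ S : NNReal →
          DegenerateSchrodinger.StateSpace p →L[ℂ] DegenerateSchrodinger.StateSpace p,
        DegenerateSchrodinger.IsGeneratedBy S (DegenerateSchrodinger.systemOperator τ p) →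
          ¬ DegenerateSchrodinger.ExponentiallyStable S) ∧
    (∀ α : ℝ, 0 < α → α < 1 →
      ∃ l : ℕ → ℂ, Function.Injective l ∧
        (∀ k, DegenerateSchrodinger.IsEigenvalue
          (DegenerateSchrodinger.systemOperator (fun x : ℝ => x ^ α) p) (l k)) ∧
        Filter.Tendsto (fun k => (l k).im) Filter.atTop Filter.atBot ∧
        Filter.Tendsto (fun k => (l k).re) Filter.atTop (nhds 0) ∧
        ∃ c > 0, ∀ k,
          ∃ R : DegenerateSchrodinger.StateSpace p →L[ℂ] DegenerateSchrodinger.StateSpace p,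
            DegenerateSchrodinger.IsResolvent
              (DegenerateSchrodinger.systemOperator (fun x : ℝ => x ^ α) p)
              (Complex.I * (l k).im) R ∧
            c * ‖l k‖ ^ (1 - p.order) ≤ ‖R‖) := by
  refine ⟨fun τ hτ => ⟨DegenerateSchrodinger.exists_isGeneratedBy_systemOperator hτ p,
    fun S hS => DegenerateSchrodinger.not_exponentiallyStable hτ hS⟩, fun α hα0 hα => ?_⟩
  obtain ⟨c, hc, h⟩ := DegenerateSchrodinger.exists_eigenvalue_growth hα0 hα p
  obtain ⟨l, hinj, hl, him, hre⟩ := DegenerateSchrodinger.exists_seq_of_forall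
    (P := fun z => DegenerateSchrodinger.IsEigenvalue
        (DegenerateSchrodinger.systemOperator (fun x : ℝ => x ^ α) p) z ∧
      ∃ R : DegenerateSchrodinger.StateSpace p →L[ℂ] DegenerateSchrodinger.StateSpace p,
        DegenerateSchrodinger.IsResolvent
          (DegenerateSchrodinger.systemOperator (fun x : ℝ => x ^ α) p) (Complex.I * z.im) R ∧
        c * ‖z‖ ^ (1 - p.order) ≤ ‖R‖)
    fun N => by
      obtain ⟨z, h1, h2, h3, h4⟩ := h N
      exact ⟨z, ⟨h1, h4⟩, h2, h3⟩
  exact ⟨l, hinj, fun k => (hl k).1, him, hre, c, hc, fun k => (hl k).2⟩
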